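/- Let $\nu\in\{2,3\}$ and $\nu'=\nu(\nu-1)/2$. For $\nu=2$, $x=(x_1,x_2)$ and a scalar $w$ put $x\times w:=(x_2w,-x_1w)$ and $\operatorname{curl}A:=\partial_1A_2-\partial_2A_1$; for $\nu=3$, $\times$ and $\operatorname{curl}$ are the usual ones. A magnetic field $B:\mathbb R^\nu\to\mathbb R^{\nu'}$ is of *medium decay* if $B\in L^p(\mathbb R^\nu)$ for some $p>\nu$, if $|B(x)|\le C|x|^{-\mu}$ for some $\mu>3/2$ and almost all large $|x|$, and, when $\nu=3$, if $\operatorname{div}B=0$ in the sense of tempered distributions. A function $f:\mathbb R^\nu\to\mathbb R$ is called *short-range* here if $\int_0^\infty\sup\{|f(x)| : |x|\ge r\}\,dr<\infty$. A vector potential $A:\mathbb R^\nu\to\mathbb R^\nu$ is of *medium range* if it is continuous, $A(x)=O(|x|^{-\mu'})$ as $|x|\to\infty$ for some $\mu'>1/2$, and its longitudinal component $A(x)\cdot x/|x|$ is short-range. **Proposition (Griesinger gauge).** Fix $h\in C_0^\infty(\mathbb R^\nu,\mathbb R)$ with $\int_{\mathbb R^\nu}h\,dx=1$. Suppose that $B$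 is a magnetic field of medium decay with $B(x)=O(|x|^{-\mu})$ as $|x|\to\infty$ (almost everywhere), where $\mu>3/2$. The Griesinger gauge vector potential is $$A(x):=-\int_{\mathbb R^\nu}\int_0^1 h(z)\,(x-z)\times s\,B\bigl(sx+(1-s)z\bigr)\,ds\,dz .$$ 1. The double integral converges absolutely for every $x\in\mathbb R^\nu$. $A$ is continuous and, as $|x|\to\infty$, satisfies $A(x)=O(|x|^{-1})$ if $\mu>2$, $A(x)=O(|x|^{-1}\log|x|)$ if $\mu=2$, and $A(x)=O(|x|^{-(\mu-1)})$ if $\mu<2$. The longitudinal component $A(x)\cdot x/|x|$ is short-range, and thus $A$ is of medium range. 2. All weak partial derivatives $\partial_iA_k$, $1\le i,k\le\nu$, exist and lie in $L^2_{\mathrm{loc}}(\mathbb R^\nu)$, and $\operatorname{curl}A=B$ almost everywhere. But the weak derivatives do not decay as $O(|x|^{-\mu})$ in general: for each of $\nu=2,3$, each such $h$ and every $\mu>2$ there is a magnetic field $B$ of medium decay with $B(x)=O(|x|^{-\mu})$ such that, for the corresponding $A$, at least one $\partial_iA_k$ is not $O(|x|^{-\mu})$ (almost everywhere, as $|x|\to\infty$).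 -/

import Mathlib

open MeasureTheory Filter Set
open scoped ContDiff SchwartzMap

/-- Euclidean space `ℝⁿ` with its Euclidean norm, inner product and Lebesgue measure. -/
abbrev REuc (n : ℕ) : Type := EuclideanSpace ℝ (Fin n)

/-- `|f(x)| ≤ C |x|^(-μ)` for almost every `x` with `|x|` large. -/
def DecaysAE {n : ℕ} {F : Type*} [NormedAddCommGroup F] (f : REuc n → F) (μ : ℝ) : Prop :=
  ∃ C R : ℝ, ∀ᵐ x : REuc n, R ≤ ‖x‖ → ‖f x‖ ≤ C * ‖x‖ ^ (-μ)

/-- `div B = 0` in the sense of tempered distributions. -/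
def DivFree {n : ℕ} (B : REuc n → REuc n) : Prop :=
  ∀ φ : 𝓢(REuc n, ℝ), ∫ x, fderiv ℝ φ x (B x) = 0

/-- A magnetic field of medium decay in the plane (a scalar field). -/
def MediumDecay2 (B : REuc 2 → ℝ) : Prop :=
  (∃ p : ENNReal, 2 < p ∧ MemLp B p) ∧ ∃ μ : ℝ, 3 / 2 < μ ∧ DecaysAE B μ

/-- A magnetic field of medium decay in three-dimensional space. -/
def MediumDecay3 (B : REuc 3 → REuc 3) : Prop :=
  (∃ p : ENNReal, 3 < p ∧ MemLp B p) ∧ (∃ μ : ℝ, 3 / 2 < μ ∧ DecaysAE B μ) ∧ DivFree B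

/-- The longitudinal component `A(x) · x / |x|` of a vector field. -/
noncomputable def longitudinal {n : ℕ} (A : REuc n → REuc n) (x : REuc n) : ℝ :=
  inner ℝ (A x) x / ‖x‖

/-- Short range, i.e. integrable decay: `∫₀^∞ sup {|f(x)| : |x| ≥ r} dr < ∞`. -/
def ShortRange {n : ℕ} (f : REuc n → ℝ) : Prop :=
  ∫⁻ r in Ioi (0 : ℝ), (⨆ (x : REuc n) (_ : r ≤ ‖x‖), ENNReal.ofReal |f x|) < ⊤

/-- A vector potential of medium range. -/
def MediumRange {n : ℕ} (A : REuc n → REuc n) : Prop :=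
  Continuous A ∧
  (∃ μ : ℝ, 1 / 2 < μ ∧ A =O[Bornology.cobounded (REuc n)] fun x => ‖x‖ ^ (-μ)) ∧
  ShortRange (longitudinal A)

/-- A mollifier: a real test function with integral one. -/
def IsMollifier {n : ℕ} (h : REuc n → ℝ) : Prop :=
  ContDiff ℝ ∞ h ∧ HasCompactSupport h ∧ ∫ x, h x = 1

/-- The planar product `x × w = (x₂ w, -x₁ w)` of a vector and a scalar. -/
noncomputable def cross2 (x : REuc 2) (w : ℝ) : REuc 2 := !₂[x 1 * w, -(x 0 * w)]

/-- The cross product on Euclidean three-space. -/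
noncomputable def cross3 (x w : REuc 3) : REuc 3 :=
  WithLp.toLp 2 (crossProduct (WithLp.ofLp x) (WithLp.ofLp w))

/-- `(z, s) ↦ h(z) (x - z) × s B(s x + (1 - s) z)`, for a product `×` of vectors and fields. -/
noncomputable def griesingerIntegrand {n : ℕ} {F : Type*} [NormedAddCommGroup F] [NormedSpace ℝ F]
    (cross : REuc n → F → REuc n) (h : REuc n → ℝ) (B : REuc n → F) (x : REuc n)
    (q : REuc n × ℝ) : REuc n :=
  h q.1 • cross (x - q.1) (q.2 • B (q.2 • x + (1 - q.2) • q.1))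

/-- The Griesinger gauge `A(x) = -∫ ∫₀¹ h(z) (x - z) × s B(s x + (1 - s) z) ds dz`. -/
noncomputable def griesinger {n : ℕ} {F : Type*} [NormedAddCommGroup F] [NormedSpace ℝ F]
    (cross : REuc n → F → REuc n) (h : REuc n → ℝ) (B : REuc n → F) (x : REuc n) : REuc n :=
  -∫ z : REuc n, ∫ s in (0 : ℝ)..1, griesingerIntegrand cross h B x (z, s)

/-- Absolute convergence of the double integral in the Griesinger gauge, at every point `x`. -/
def GriesingerConverges {n : ℕ} {F : Type*} [NormedAddCommGroup F] [NormedSpace ℝ F]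
    (cross : REuc n → F → REuc n) (h : REuc n → ℝ) (B : REuc n → F) : Prop :=
  ∀ x : REuc n, IntegrableOn (griesingerIntegrand cross h B x) (univ ×ˢ Icc (0 : ℝ) 1)

/-- `g` is the weak partial derivative `∂ᵢ f` on `ℝⁿ`. -/
def IsWeakPartial {n : ℕ} (i : Fin n) (f g : REuc n → ℝ) : Prop :=
  LocallyIntegrable f ∧ LocallyIntegrable g ∧
  ∀ φ : REuc n → ℝ, ContDiff ℝ ∞ φ → HasCompactSupport φ →
    ∫ x, f x * fderiv ℝ φ x (EuclideanSpace.single i 1) = -∫ x, g x * φ x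

/-- `D i k` is the weak partial derivative `∂ᵢ Aₖ`, for all `i` and `k`. -/
def IsWeakJacobian {n : ℕ} (A : REuc n → REuc n) (D : Fin n → Fin n → REuc n → ℝ) : Prop :=
  ∀ i k, IsWeakPartial i (fun x => A x k) (D i k)

/-- `g ∈ L²_loc(ℝⁿ)`. -/
def MemL2Loc {n : ℕ} (g : REuc n → ℝ) : Prop :=
  ∀ K : Set (REuc n), IsCompact K → MemLp g 2 (volume.restrict K)

/-- `curl A = ∂₁A₂ - ∂₂A₁` in the plane, in terms of the derivatives `D i k = ∂ᵢ Aₖ`. -/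
def curl2 (D : Fin 2 → Fin 2 → REuc 2 → ℝ) (x : REuc 2) : ℝ := D 0 1 x - D 1 0 x

/-- `curl A` in three-space, in terms of the derivatives `D i k = ∂ᵢ Aₖ`. -/
noncomputable def curl3 (D : Fin 3 → Fin 3 → REuc 3 → ℝ) (x : REuc 3) : REuc 3 :=
  !₂[D 1 2 x - D 2 1 x, D 2 0 x - D 0 2 x, D 0 1 x - D 1 0 x]

/-- The decay `O(1/|x|)`, `O(log|x|/|x|)`, `O(|x|^(-(μ-1)))` as `|x| → ∞`, according as
`μ > 2`, `μ = 2`, `μ < 2`. -/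
def GriesingerDecay {n : ℕ} (μ : ℝ) (A : REuc n → REuc n) : Prop :=
  (2 < μ → A =O[Bornology.cobounded (REuc n)] fun x => ‖x‖⁻¹) ∧
  (μ = 2 → A =O[Bornology.cobounded (REuc n)] fun x => Real.log ‖x‖ / ‖x‖) ∧
  (μ < 2 → A =O[Bornology.cobounded (REuc n)] fun x => ‖x‖ ^ (-(μ - 1)))

/-!
The Griesinger gauge averages the Poincaré gauge based at `z` over `z ∈ supp h`. Everything up to
the curl is proved for an arbitrary continuous bilinear product `Λ` with `Λ v w ⊥ v` in dimension
at most three.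

*Convergence, continuity, decay.* For fixed `s < 1` the substitution `y = s x + (1 - s) z` and
Hölder's inequality bound the mean `∫ |h(z)| |B(s x + (1 - s) z)| dz` by
`C (1 - s) ^ (-n / p)` (`exists_segmentMean_le`), which is integrable in `s` as `p > n`. For large
`|x|` this bound serves for `s ≲ 1 / |x|`, and the decay of `B` gives `C (s |x|) ^ (-μ)` for the
other `s`. As `(x - z) × b` is orthogonal to `x - z`, only `z` is left in the longitudinal
component, which gains a factor `|x|⁻¹` and so is short-range
(`griesinger_mediumRange_of_memLp`).

*Weak derivatives.* Since `2 μ > 3 ≥ n`, the field `B` is square integrable on the whole space.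
Paired with test functions, a component of `A` becomes a sum of trilinear forms
`∫∫∫ s h(z) g(x) b(s x + (1 - s) z)`. On the Fourier side a derivative `∂ᵢ φ` in the middle slot
costs a factor `s |ξ|`, while the mollifier contributes decay in `(1 - s) |ξ|`; as
`∫₀¹ |ξ| / (1 + (1 - s)² |ξ|²) ds ≤ π / 2`, the form is bounded by the `L²` norms of `φ` and `b`
(`exists_segmentForm_fderiv_le`). Hence `φ ↦ ∫ A_k ∂ᵢ φ` is bounded by the `L²` norm of
`(1 + |x|) φ`, and the Riesz representation theorem gives the weak derivative in `L²_loc`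
(`exists_isWeakJacobian_griesinger`).

*Curl.* For a fixed `z`, integrating the `s`-derivative of the dilates `s ^ (-m) φ(z + (y - z) / s)`
recovers `φ(y)` (`integral_dilate_radialTest`); averaging over `z` uses `∫ h = 1`. In the plane
this is the weak form of `curl A = B`; in space there is one further term, the pairing of a dilated
copy of `B` with a gradient, which vanishes as `div B = 0` (`curl3_griesinger_weak`).

*Slow decay of the derivatives.* Let `ψ` be a test function depending only on `x₁` near the first
axis, a bump located beyond `supp h`, and let `B` be `-∂₁ψ` in the plane and
`(-∂₂ψ, ∂₁ψ, 0)` in space. In a tube around the far part of that axis the last component of `A` is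
`c ∫ h(z) / (x₁ - z₁) dz` with `c ≠ 0`; its derivative there is `-c / x₁² + O(x₁⁻³)`, which is
not `O(|x| ^ (-μ))` for `μ > 2` although `B` has compact support
(`not_decaysAE_weakPartial`).
-/

/-! ### Affine changes of variables and a scaled Hölder inequality -/

lemma measurableEmbedding_affine {n : ℕ} {c : ℝ} (hc : c ≠ 0) (v : REuc n) :
    MeasurableEmbedding (fun z : REuc n => c • z + v) :=
  ((Homeomorph.smulOfNeZero c hc).trans (Homeomorph.addRight v)).measurableEmbedding

lemma map_affine_volume {n : ℕ} {c : ℝ} (hc : c ≠ 0) (v : REuc n) :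
    Measure.map (fun z : REuc n => c • z + v) volume
      = ENNReal.ofReal |(c ^ n)⁻¹| • (volume : Measure (REuc n)) := by
  have h1 : (fun z : REuc n => c • z + v) = (fun z => z + v) ∘ (fun z => c • z) := rfl
  rw [h1, ← Measure.map_map (by fun_prop) (by fun_prop), Measure.map_addHaar_smul _ hc,
    Measure.map_smul, map_add_right_eq_self]
  simp

lemma quasiMeasurePreserving_affine {n : ℕ} {c : ℝ} (hc : c ≠ 0) (v : REuc n) :
    Measure.QuasiMeasurePreserving (fun z : REuc n => c • z + v) volume volume := by
  refine ⟨by fun_prop, ?_⟩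
  rw [map_affine_volume hc]
  exact Measure.smul_absolutelyContinuous

lemma lintegral_comp_affine {n : ℕ} {c : ℝ} (hc : c ≠ 0) (v : REuc n)
    (f : REuc n → ENNReal) :
    ∫⁻ z, f (c • z + v) = ENNReal.ofReal |(c ^ n)⁻¹| * ∫⁻ y, f y := by
  rw [← (measurableEmbedding_affine hc v).lintegral_map f, map_affine_volume hc,
    lintegral_smul_measure, smul_eq_mul]

lemma integral_comp_affine {n : ℕ} {G : Type*} [NormedAddCommGroup G] [NormedSpace ℝ G]
    {c : ℝ} (hc : c ≠ 0) (v : REuc n) (f : REuc n → G) :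
    ∫ z, f (c • z + v) = |(c ^ n)⁻¹| • ∫ y, f y := by
  rw [← (measurableEmbedding_affine hc v).integral_map f, map_affine_volume hc,
    integral_smul_measure, ENNReal.toReal_ofReal (abs_nonneg _)]

lemma eLpNorm_comp_affine {n : ℕ} {G : Type*} [NormedAddCommGroup G]
    {c : ℝ} (hc : 0 < c) (v : REuc n) (f : REuc n → G) (p : ENNReal) :
    eLpNorm (fun z => f (c • z + v)) p volume
      = ENNReal.ofReal (c ^ (-(n * (1 / p).toReal))) * eLpNorm f p volume := by
  have h1 := (measurableEmbedding_affine hc.ne' v).eLpNorm_map_measure (g := f) (p := p)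
    (μ := volume)
  rw [map_affine_volume hc.ne', eLpNorm_smul_measure_of_ne_zero] at h1
  · rw [Function.comp_def] at h1
    rw [← h1, smul_eq_mul, ENNReal.ofReal_rpow_of_pos (by positivity), abs_of_pos (by positivity),
      Real.rpow_neg hc.le, Real.rpow_mul hc.le, Real.rpow_natCast, Real.inv_rpow (by positivity)]
  · simp only [ne_eq, ENNReal.ofReal_eq_zero, not_le]; positivity

/-- Hölder's inequality for a product with a rescaled and translated factor. -/
lemma lintegral_mul_comp_affine_le {n : ℕ} {G₁ G₂ : Type*} [NormedAddCommGroup G₁]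
    [NormedAddCommGroup G₂] {c : ℝ} (hc : 0 < c) (v : REuc n) {g : REuc n → G₁}
    {b : REuc n → G₂} (p q : ENNReal) [hpq : ENNReal.HolderConjugate q p]
    (hg : AEStronglyMeasurable g) (hb : AEStronglyMeasurable b) :
    ∫⁻ x, ‖g x‖ₑ * ‖b (c • x + v)‖ₑ
      ≤ eLpNorm g q volume * (ENNReal.ofReal (c ^ (-(n * (1 / p).toReal)))
          * eLpNorm b p volume) := by
  have hb' : AEStronglyMeasurable (fun x => b (c • x + v)) :=
    hb.comp_quasiMeasurePreserving (quasiMeasurePreserving_affine hc.ne' v)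
  have h := eLpNorm_smul_le_mul_eLpNorm (p := q) (q := p) (r := 1) (μ := (volume : Measure (REuc n)))
    (f := fun x => ‖b (c • x + v)‖) (φ := fun x => ‖g x‖) hb'.norm hg.norm
  rw [eLpNorm_one_eq_lintegral_enorm, eLpNorm_norm, eLpNorm_norm, eLpNorm_comp_affine hc] at h
  simpa [enorm_mul, enorm_norm] using h

/-- For fixed `x`, the map `(z, s) ↦ s x + (1 - s) z` pulls null sets back to null sets. -/
lemma quasiMeasurePreserving_segment {n : ℕ} (x : REuc n) :
    Measure.QuasiMeasurePreserving (fun q : REuc n × ℝ => q.2 • x + (1 - q.2) • q.1)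
      (volume.prod volume) volume := by
  refine QuasiMeasurePreserving.prod_of_left (by fun_prop) ?_
  have : ∀ᵐ s : ℝ, s ≠ 1 := by simp [ae_iff, measure_singleton]
  filter_upwards [this] with s hs
  have := quasiMeasurePreserving_affine (c := 1 - s) (sub_ne_zero.2 hs.symm) (s • x)
  simpa [add_comm] using this

/-- The map `((z, s), x) ↦ s x + (1 - s) z` pulls null sets back to null sets. -/
lemma quasiMeasurePreserving_segment₃ {n : ℕ} :
    Measure.QuasiMeasurePreserving
      (fun q : (REuc n × ℝ) × REuc n => q.1.2 • q.2 + (1 - q.1.2) • q.1.1)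
      ((volume.prod volume).prod volume) volume := by
  refine QuasiMeasurePreserving.prod_of_left (by fun_prop) ?_
  exact ae_of_all _ fun x => quasiMeasurePreserving_segment x

/-! ### Absolute convergence of the double integral -/

lemma prod_restrict_Icc_eq {n : ℕ} :
    (volume : Measure (REuc n × ℝ)).restrict (univ ×ˢ Icc (0 : ℝ) 1)
      = (volume : Measure (REuc n)).prod (volume.restrict (Icc (0 : ℝ) 1)) := by
  rw [Measure.volume_eq_prod, ← Measure.prod_restrict, Measure.restrict_univ]

lemma aestronglyMeasurable_comp_segment {n : ℕ} {F : Type*} [NormedAddCommGroup F]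
    {B : REuc n → F} (hB : AEStronglyMeasurable B) (x : REuc n) :
    AEStronglyMeasurable (fun q : REuc n × ℝ => B (q.2 • x + (1 - q.2) • q.1))
      (volume.prod (volume.restrict (Icc (0 : ℝ) 1))) := by
  have h1 := hB.comp_quasiMeasurePreserving (quasiMeasurePreserving_segment x)
  have h2 := h1.restrict (s := univ ×ˢ Icc (0 : ℝ) 1)
  rwa [← Measure.prod_restrict, Measure.restrict_univ] at h2

lemma aestronglyMeasurable_griesingerIntegrand {n : ℕ} {F : Type*} [NormedAddCommGroup F]
    [NormedSpace ℝ F] (Λ : REuc n →L[ℝ] F →L[ℝ] REuc n) {h : REuc n → ℝ} (hh : Continuous h)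
    {B : REuc n → F} (hB : AEStronglyMeasurable B) (x : REuc n) :
    AEStronglyMeasurable (griesingerIntegrand (fun v w => Λ v w) h B x)
      (volume.prod (volume.restrict (Icc (0 : ℝ) 1))) := by
  unfold griesingerIntegrand
  refine (hh.comp continuous_fst).aestronglyMeasurable.smul ?_
  refine ContinuousLinearMap.aestronglyMeasurable_comp₂ Λ
    (show Continuous fun q : REuc n × ℝ => x - q.1 by fun_prop).aestronglyMeasurable ?_
  exact continuous_snd.aestronglyMeasurable.smul (aestronglyMeasurable_comp_segment hB x)

/-- A continuous function with compact support vanishes off some ball of positive radius. -/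
lemma exists_radius_of_hasCompactSupport {n : ℕ} {h : REuc n → ℝ} (hc : HasCompactSupport h) :
    ∃ r : ℝ, 0 < r ∧ ∀ z, h z ≠ 0 → ‖z‖ ≤ r := by
  obtain ⟨r, hr⟩ := hc.isCompact.isBounded.exists_norm_le
  exact ⟨max r 1, by positivity, fun z hz => (hr z (subset_tsupport h hz)).trans (le_max_left _ _)⟩

lemma enorm_griesingerIntegrand_le {n : ℕ} {F : Type*} [NormedAddCommGroup F]
    [NormedSpace ℝ F] (Λ : REuc n →L[ℝ] F →L[ℝ] REuc n) {h : REuc n → ℝ} {r : ℝ}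
    (hr : ∀ z, h z ≠ 0 → ‖z‖ ≤ r) (B : REuc n → F) (x z : REuc n) (s : ℝ) (hs : 0 ≤ s) :
    ‖griesingerIntegrand (fun v w => Λ v w) h B x (z, s)‖ₑ
      ≤ ENNReal.ofReal (‖Λ‖ * (‖x‖ + r)) * (ENNReal.ofReal s *
          (‖h z‖ₑ * ‖B (s • x + (1 - s) • z)‖ₑ)) := by
  by_cases hz : h z = 0
  · simp [griesingerIntegrand, hz]
  have h1 : ‖griesingerIntegrand (fun v w => Λ v w) h B x (z, s)‖
      ≤ (‖Λ‖ * (‖x‖ + r)) * (s * (‖h z‖ * ‖B (s • x + (1 - s) • z)‖)) := by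
    unfold griesingerIntegrand
    simp only [norm_smul]
    have h2 := Λ.le_opNorm₂ (x - z) (s • B (s • x + (1 - s) • z))
    rw [norm_smul, Real.norm_of_nonneg hs] at h2
    have h3 : ‖x - z‖ ≤ ‖x‖ + r := (norm_sub_le _ _).trans (by linarith [hr z hz])
    calc _ ≤ ‖h z‖ * (‖Λ‖ * ‖x - z‖ * (s * ‖B (s • x + (1 - s) • z)‖)) := by gcongr
      _ ≤ ‖h z‖ * (‖Λ‖ * (‖x‖ + r) * (s * ‖B (s • x + (1 - s) • z)‖)) := by gcongr
      _ = _ := by ring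
  have hr0 : 0 ≤ ‖x‖ + r := by linarith [norm_nonneg x, norm_nonneg z, hr z hz]
  rw [← ofReal_norm, ← ofReal_norm (h z), ← ofReal_norm (B _),
    ← ENNReal.ofReal_mul (norm_nonneg _), ← ENNReal.ofReal_mul hs,
    ← ENNReal.ofReal_mul (by positivity)]
  exact ENNReal.ofReal_le_ofReal h1

/-- The mean `∫ |h(z)| |B(s x + (1 - s) z)| dz` of `|B|` at a point of the segments towards `x`. -/
noncomputable def segmentMean {n : ℕ} {F : Type*} [NormedAddCommGroup F]
    (h : REuc n → ℝ) (B : REuc n → F) (x : REuc n) (s : ℝ) : ENNReal :=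
  ∫⁻ z, ‖h z‖ₑ * ‖B (s • x + (1 - s) • z)‖ₑ

/-- If `B ∈ Lᵖ` with `p > n`, the means of `|B|` are controlled by an integrable power of
`1 - s`, uniformly in `x`. -/
lemma exists_segmentMean_le {n : ℕ} {F : Type*} [NormedAddCommGroup F]
    {h : REuc n → ℝ} (hh : Continuous h) (hc : HasCompactSupport h) {B : REuc n → F}
    {p : ENNReal} (hp1 : 1 ≤ p) (hp : (n : ENNReal) < p) (hB : MemLp B p) :
    ∃ K θ : ℝ, 0 ≤ K ∧ 0 ≤ θ ∧ θ < 1 ∧ ∀ (x : REuc n) (s : ℝ), s < 1 →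
      segmentMean h B x s ≤ ENNReal.ofReal (K * (1 - s) ^ (-θ)) := by
  obtain ⟨q, hq⟩ : ∃ q : ENNReal, ENNReal.HolderConjugate q p := by
    have := ENNReal.HolderConjugate.conjExponent hp1
    exact ⟨_, ENNReal.HolderConjugate.symm (p := p) (q := ENNReal.conjExponent p)⟩
  have hhq : MemLp h q := hh.memLp_of_hasCompactSupport hc
  refine ⟨(eLpNorm h q).toReal * (eLpNorm B p).toReal, n * (1 / p).toReal, by positivity,
    by positivity, ?_, ?_⟩
  · by_cases hpt : p = ⊤
    · simp [hpt]
    have hp0 : (n : ℝ) < p.toReal := by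
      have := ENNReal.toReal_strict_mono hpt hp
      simpa using this
    have hppos : 0 < p.toReal := lt_of_le_of_lt (by positivity) hp0
    rw [one_div, ENNReal.toReal_inv, ← div_eq_mul_inv, div_lt_one hppos]
    exact hp0
  · intro x s hs
    have h1 := lintegral_mul_comp_affine_le (c := 1 - s) (by linarith) (s • x) p q
      hhq.1 hB.1
    unfold segmentMean
    simp_rw [add_comm (s • x)]
    refine h1.trans (le_of_eq ?_)
    rw [ENNReal.ofReal_mul (by positivity), ENNReal.ofReal_mul (by positivity),
      ENNReal.ofReal_toReal hhq.2.ne, ENNReal.ofReal_toReal hB.2.ne]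
    ring

lemma integrableOn_one_sub_rpow {θ : ℝ} (hθ : θ < 1) :
    IntegrableOn (fun s : ℝ => (1 - s) ^ (-θ)) (Icc 0 1) := by
  have h1 : IntervalIntegrable (fun s : ℝ => s ^ (-θ)) volume 0 1 :=
    intervalIntegral.intervalIntegrable_rpow' (by linarith)
  have h2 := (h1.comp_sub_left 1).symm
  simp only [sub_zero, sub_self] at h2
  rw [integrableOn_Icc_iff_integrableOn_Ioc]
  exact (intervalIntegrable_iff_integrableOn_Ioc_of_le zero_le_one).1 h2

lemma ae_restrict_Icc_lt_one : ∀ᵐ s ∂(volume.restrict (Icc (0 : ℝ) 1)), 0 ≤ s ∧ s < 1 := by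
  have h1 : ∀ᵐ s : ℝ, s ≠ 1 := by simp [ae_iff, measure_singleton]
  filter_upwards [ae_restrict_of_ae h1, ae_restrict_mem measurableSet_Icc] with s hs hs'
  exact ⟨hs'.1, lt_of_le_of_ne hs'.2 hs⟩

lemma lintegral_enorm_griesingerIntegrand_le {n : ℕ} {F : Type*} [NormedAddCommGroup F]
    [NormedSpace ℝ F] (Λ : REuc n →L[ℝ] F →L[ℝ] REuc n) {h : REuc n → ℝ} (hh : Continuous h)
    {r : ℝ} (hr : ∀ z, h z ≠ 0 → ‖z‖ ≤ r) {B : REuc n → F}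
    (hB : AEStronglyMeasurable B) (x : REuc n) :
    ∫⁻ q, ‖griesingerIntegrand (fun v w => Λ v w) h B x q‖ₑ
        ∂(volume.prod (volume.restrict (Icc (0 : ℝ) 1)))
      ≤ ENNReal.ofReal (‖Λ‖ * (‖x‖ + r)) *
          ∫⁻ s in Icc (0 : ℝ) 1, ENNReal.ofReal s * segmentMean h B x s := by
  rw [lintegral_prod_symm _ (aestronglyMeasurable_griesingerIntegrand Λ hh hB x).enorm,
    ← lintegral_const_mul' _ _ ENNReal.ofReal_ne_top]
  refine lintegral_mono_ae ?_
  filter_upwards [ae_restrict_Icc_lt_one] with s hs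
  unfold segmentMean
  rw [← lintegral_const_mul' _ _ ENNReal.ofReal_ne_top,
    ← lintegral_const_mul' _ _ ENNReal.ofReal_ne_top]
  exact lintegral_mono fun z => enorm_griesingerIntegrand_le Λ hr B x z s hs.1

lemma griesingerConverges_of_memLp {n : ℕ} {F : Type*} [NormedAddCommGroup F]
    [NormedSpace ℝ F] (Λ : REuc n →L[ℝ] F →L[ℝ] REuc n) {h : REuc n → ℝ} (hh : Continuous h)
    (hc : HasCompactSupport h) {B : REuc n → F} {p : ENNReal} (hp1 : 1 ≤ p)
    (hp : (n : ENNReal) < p) (hB : MemLp B p) :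
    GriesingerConverges (fun v w => Λ v w) h B := by
  intro x
  obtain ⟨r, -, hr⟩ := exists_radius_of_hasCompactSupport hc
  obtain ⟨K, θ, hK, hθ0, hθ, hle⟩ := exists_segmentMean_le hh hc hp1 hp hB
  rw [IntegrableOn, prod_restrict_Icc_eq]
  refine ⟨aestronglyMeasurable_griesingerIntegrand Λ hh hB.1 x, ?_⟩
  refine (lintegral_enorm_griesingerIntegrand_le Λ hh hr hB.1 x).trans_lt ?_
  refine ENNReal.mul_lt_top ENNReal.ofReal_lt_top ?_
  refine lt_of_le_of_lt (b := ∫⁻ s in Icc (0 : ℝ) 1, ENNReal.ofReal (K * (1 - s) ^ (-θ))) ?_ ?_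
  · refine lintegral_mono_ae ?_
    filter_upwards [ae_restrict_Icc_lt_one] with s hs
    calc _ ≤ 1 * segmentMean h B x s := by
          gcongr
          exact ENNReal.ofReal_le_one.2 hs.2.le
      _ ≤ _ := by rw [one_mul]; exact hle x s hs.2
  · exact ((integrableOn_one_sub_rpow hθ).const_mul K).lintegral_lt_top

/-- The Griesinger gauge as a single integral over `(z, s)`. -/
lemma griesinger_eq_neg_integral_prod {n : ℕ} {F : Type*} [NormedAddCommGroup F]
    [NormedSpace ℝ F] {cross : REuc n → F → REuc n} {h : REuc n → ℝ}
    {B : REuc n → F} (hconv : GriesingerConverges cross h B) (x : REuc n) :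
    griesinger cross h B x = -∫ q, griesingerIntegrand cross h B x q
        ∂(volume.prod (volume.restrict (Icc (0 : ℝ) 1))) := by
  have h1 := hconv x
  rw [IntegrableOn, prod_restrict_Icc_eq] at h1
  rw [integral_prod _ h1, griesinger]
  simp_rw [intervalIntegral.integral_of_le zero_le_one, integral_Icc_eq_integral_Ioc]

/-! ### Continuity of the Griesinger gauge -/

lemma continuous_integral_griesingerIntegrand {n : ℕ} {F : Type*} [NormedAddCommGroup F]
    [NormedSpace ℝ F] (Λ : REuc n →L[ℝ] F →L[ℝ] REuc n) {h : REuc n → ℝ} (hh : Continuous h)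
    {r : ℝ} (hr : ∀ z, h z ≠ 0 → ‖z‖ ≤ r) {B : REuc n → F}
    (hB : LocallyIntegrable B) {s : ℝ} (hs0 : 0 ≤ s) (hs1 : s < 1) :
    Continuous fun x => ∫ z, griesingerIntegrand (fun v w => Λ v w) h B x (z, s) := by
  have hs : 1 - s ≠ 0 := by linarith
  -- in the variable `y = s x + (1 - s) z` the kernel is continuous and `B` no longer moves
  let ζ : REuc n → REuc n → REuc n := fun x y => (1 - s)⁻¹ • (y - s • x)
  have key : ∀ x, ∫ z, griesingerIntegrand (fun v w => Λ v w) h B x (z, s)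
      = |((1 - s) ^ n)⁻¹| • ∫ y, ContinuousLinearMap.apply ℝ (REuc n) (B y)
          ((h (ζ x y) * s) • Λ (x - ζ x y)) := by
    intro x
    rw [← integral_comp_affine hs (s • x)]
    refine integral_congr_ae (ae_of_all _ fun z => ?_)
    have h1 : ζ x ((1 - s) • z + s • x) = z := by
      simp only [ζ, add_sub_cancel_right]
      rw [smul_smul, inv_mul_cancel₀ hs, one_smul]
    simp only [h1, griesingerIntegrand, ContinuousLinearMap.apply_apply, map_smul, mul_smul]
    rw [add_comm (s • x)]
  simp_rw [key]
  suffices hI : Continuous fun x => ∫ y, ContinuousLinearMap.apply ℝ (REuc n) (B y)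
      ((h (ζ x y) * s) • Λ (x - ζ x y)) from
    hI.const_smul |((1 - s) ^ n)⁻¹|
  rw [continuous_iff_continuousAt]
  intro x₀
  have hcont := continuousOn_integral_bilinear_of_locally_integrable_of_compact_support
    (μ := (volume : Measure (REuc n)))
    (ContinuousLinearMap.apply ℝ (REuc n) : F →L[ℝ] (F →L[ℝ] REuc n) →L[ℝ] REuc n)
    (f := fun x y => (h (ζ x y) * s) • Λ (x - ζ x y)) (s := Metric.ball x₀ 1)
    (k := Metric.closedBall 0 (r + (‖x₀‖ + 1))) (g := B)
    (isCompact_closedBall _ _) ?_ ?_ (hB.integrableOn_isCompact (isCompact_closedBall _ _))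
  · exact hcont.continuousAt (Metric.ball_mem_nhds _ one_pos)
  · refine Continuous.continuousOn ?_
    simp only [Function.uncurry_def, ζ]
    fun_prop
  · intro x y hx hy
    by_cases h0 : h (ζ x y) = 0
    · simp [h0]
    exfalso
    apply hy
    have h1 := hr _ h0
    have h2 : y = (1 - s) • ζ x y + s • x := by
      simp only [ζ]
      rw [smul_smul, mul_inv_cancel₀ hs, one_smul, sub_add_cancel]
    have h3 : ‖x‖ ≤ ‖x₀‖ + 1 := by
      have h4 : ‖x - x₀‖ < 1 := by simpa [dist_eq_norm] using hx
      have h5 := norm_add_le (x - x₀) x₀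
      rw [sub_add_cancel] at h5
      linarith
    have hr0 : 0 ≤ r := (norm_nonneg _).trans h1
    rw [mem_closedBall_zero_iff, h2]
    calc _ ≤ ‖(1 - s) • ζ x y‖ + ‖s • x‖ := norm_add_le _ _
      _ = (1 - s) * ‖ζ x y‖ + s * ‖x‖ := by
        rw [norm_smul (1 - s), norm_smul s, Real.norm_of_nonneg hs0,
          Real.norm_of_nonneg (by linarith)]
      _ ≤ 1 * r + 1 * (‖x₀‖ + 1) := by gcongr; linarith
      _ = _ := by ring

lemma continuous_griesinger {n : ℕ} {F : Type*} [NormedAddCommGroup F]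
    [NormedSpace ℝ F] (Λ : REuc n →L[ℝ] F →L[ℝ] REuc n) {h : REuc n → ℝ} (hh : Continuous h)
    (hc : HasCompactSupport h) {B : REuc n → F} {p : ENNReal} (hp1 : 1 ≤ p)
    (hp : (n : ENNReal) < p) (hB : MemLp B p) :
    Continuous (griesinger (fun v w => Λ v w) h B) := by
  have hconv := griesingerConverges_of_memLp Λ hh hc hp1 hp hB
  obtain ⟨r, hr0, hr⟩ := exists_radius_of_hasCompactSupport hc
  obtain ⟨K, θ, hK, hθ0, hθ, hle⟩ := exists_segmentMean_le hh hc hp1 hp hB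
  have hint : ∀ x, Integrable (griesingerIntegrand (fun v w => Λ v w) h B x)
      (volume.prod (volume.restrict (Icc (0 : ℝ) 1))) := by
    intro x
    have h1 := hconv x
    rwa [IntegrableOn, prod_restrict_Icc_eq] at h1
  have hA : griesinger (fun v w => Λ v w) h B = fun x => -∫ s in Icc (0 : ℝ) 1,
      ∫ z, griesingerIntegrand (fun v w => Λ v w) h B x (z, s) := by
    ext1 x
    rw [griesinger_eq_neg_integral_prod hconv, integral_prod_symm _ (hint x)]
  rw [hA]
  refine Continuous.neg ?_
  rw [continuous_iff_continuousAt]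
  intro x₀
  refine continuousAt_of_dominated
    (bound := fun s => ‖Λ‖ * (‖x₀‖ + 1 + r) * (K * (1 - s) ^ (-θ))) ?_ ?_ ?_ ?_
  · exact Eventually.of_forall fun x => (hint x).swap.1.integral_prod_right'
  · filter_upwards [Metric.ball_mem_nhds x₀ one_pos] with x hx
    filter_upwards [ae_restrict_Icc_lt_one] with s hs
    have h3 : ‖x‖ ≤ ‖x₀‖ + 1 := by
      have h4 : ‖x - x₀‖ < 1 := by simpa [dist_eq_norm] using hx
      have h5 := norm_add_le (x - x₀) x₀
      rw [sub_add_cancel] at h5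
      linarith
    have hs1 : 0 < 1 - s := by linarith [hs.2]
    rw [← ENNReal.ofReal_le_ofReal_iff (by positivity), ofReal_norm]
    refine (enorm_integral_le_lintegral_enorm _).trans ?_
    calc _ ≤ ∫⁻ z, ENNReal.ofReal (‖Λ‖ * (‖x‖ + r)) * (ENNReal.ofReal s *
          (‖h z‖ₑ * ‖B (s • x + (1 - s) • z)‖ₑ)) :=
          lintegral_mono fun z => enorm_griesingerIntegrand_le Λ hr B x z s hs.1
      _ = ENNReal.ofReal (‖Λ‖ * (‖x‖ + r)) * (ENNReal.ofReal s * segmentMean h B x s) := by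
          rw [lintegral_const_mul' _ _ ENNReal.ofReal_ne_top,
            lintegral_const_mul' _ _ ENNReal.ofReal_ne_top, segmentMean]
      _ ≤ ENNReal.ofReal (‖Λ‖ * (‖x₀‖ + 1 + r)) * (1 * ENNReal.ofReal (K * (1 - s) ^ (-θ))) := by
          gcongr
          · exact ENNReal.ofReal_le_one.2 hs.2.le
          · exact hle x s hs.2
      _ = _ := by rw [one_mul, ← ENNReal.ofReal_mul (by positivity)]
  · exact ((integrableOn_one_sub_rpow hθ).const_mul K).const_mul _
  · filter_upwards [ae_restrict_Icc_lt_one] with s hs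
    exact (continuous_integral_griesingerIntegrand Λ hh hr (hB.locallyIntegrable hp1)
      hs.1 hs.2).continuousAt

/-! ### Decay at infinity -/

lemma DecaysAE.exists_nonneg {n : ℕ} {F : Type*} [NormedAddCommGroup F] {f : REuc n → F} {μ : ℝ}
    (hf : DecaysAE f μ) :
    ∃ C R : ℝ, 0 ≤ C ∧ 1 ≤ R ∧ ∀ᵐ x : REuc n, R ≤ ‖x‖ → ‖f x‖ ≤ C * ‖x‖ ^ (-μ) := by
  obtain ⟨C, R, h⟩ := hf
  refine ⟨max C 0, max R 1, le_max_right _ _, le_max_right _ _, ?_⟩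
  filter_upwards [h] with x hx hR
  refine (hx ((le_max_left _ _).trans hR)).trans ?_
  gcongr
  exact le_max_left _ _

lemma DecaysAE.mono {n : ℕ} {F : Type*} [NormedAddCommGroup F] {f : REuc n → F} {μ μ' : ℝ}
    (hf : DecaysAE f μ) (hμ : μ' ≤ μ) : DecaysAE f μ' := by
  obtain ⟨C, R, hC, hR, h⟩ := hf.exists_nonneg
  refine ⟨C, R, ?_⟩
  filter_upwards [h] with x hx hRx
  refine (hx hRx).trans ?_
  gcongr
  exact hR.trans hRx

/-- Where the points `s x + (1 - s) z` with `z ∈ supp h` are far out, the mean of `|B|` inherits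
the decay of `B`. -/
lemma exists_segmentMean_le_of_decaysAE {n : ℕ} {F : Type*} [NormedAddCommGroup F]
    {h : REuc n → ℝ} (hh : Continuous h) (hc : HasCompactSupport h) {B : REuc n → F}
    {μ : ℝ} (hμ : 0 < μ) (hB : DecaysAE B μ) :
    ∃ C R : ℝ, 0 ≤ C ∧ 1 ≤ R ∧ ∀ (x : REuc n) (s : ℝ), 0 ≤ s → s < 1 → R ≤ s * ‖x‖ →
      segmentMean h B x s ≤ ENNReal.ofReal (C * (s * ‖x‖) ^ (-μ)) := by
  obtain ⟨C, R, hC, hR, hdec⟩ := hB.exists_nonneg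
  obtain ⟨r, hr0, hr⟩ := exists_radius_of_hasCompactSupport hc
  have hhi : Integrable h := hh.integrable_of_hasCompactSupport hc
  refine ⟨C * 2 ^ μ * ∫ z, ‖h z‖, 2 * (R + r),
    mul_nonneg (by positivity) (integral_nonneg fun _ => norm_nonneg _), by linarith, ?_⟩
  intro x s hs0 hs1 hsx
  have hq := (quasiMeasurePreserving_affine (c := 1 - s) (by linarith) (s • x)).ae hdec
  have hpos : 0 < s * ‖x‖ := by linarith
  have h1 : segmentMean h B x s
      ≤ ∫⁻ z, ENNReal.ofReal (C * (2 ^ μ * (s * ‖x‖) ^ (-μ)) * ‖h z‖) := by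
    refine lintegral_mono_ae ?_
    filter_upwards [hq] with z hz
    by_cases h0 : h z = 0
    · simp [h0]
    rw [add_comm] at hz
    have h2 : s * ‖x‖ / 2 ≤ ‖s • x + (1 - s) • z‖ := by
      have h3 := norm_sub_le (s • x + (1 - s) • z) ((1 - s) • z)
      rw [add_sub_cancel_right, norm_smul, norm_smul, Real.norm_of_nonneg hs0,
        Real.norm_of_nonneg (by linarith : 0 ≤ 1 - s)] at h3
      have h4 : (1 - s) * ‖z‖ ≤ 1 * r := by
        gcongr
        · linarith
        · exact hr z h0
      linarith
    have h5 := hz (by linarith)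
    have h6 : ‖s • x + (1 - s) • z‖ ^ (-μ) ≤ 2 ^ μ * (s * ‖x‖) ^ (-μ) := by
      calc _ ≤ (s * ‖x‖ / 2) ^ (-μ) :=
            Real.rpow_le_rpow_of_nonpos (by positivity) h2 (by linarith)
        _ = _ := by
            rw [Real.div_rpow hpos.le (by norm_num), Real.rpow_neg (by norm_num : (0 : ℝ) ≤ 2)]
            field_simp
    rw [← ofReal_norm, ← ofReal_norm (B _), ← ENNReal.ofReal_mul (norm_nonneg _)]
    refine ENNReal.ofReal_le_ofReal ?_
    rw [mul_comm]
    gcongr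
    exact h5.trans (by gcongr)
  refine h1.trans (le_of_eq ?_)
  rw [← ofReal_integral_eq_lintegral_ofReal (hhi.norm.const_mul _)
    (ae_of_all _ fun z => by positivity), integral_const_mul]
  congr 1
  ring

/-- The size of the double integral at distance `|x|`, up to the factor `|x|`: the segment is
split at distance `R` from the origin. -/
lemma exists_lintegral_segmentMean_le {n : ℕ} {F : Type*} [NormedAddCommGroup F]
    {h : REuc n → ℝ} (hh : Continuous h) (hc : HasCompactSupport h) {B : REuc n → F}
    {p : ENNReal} (hp1 : 1 ≤ p) (hp : (n : ENNReal) < p) (hBp : MemLp B p)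
    {μ : ℝ} (hμ : 0 < μ) (hB : DecaysAE B μ) :
    ∃ C R : ℝ, 0 ≤ C ∧ 1 ≤ R ∧ ∀ x : REuc n, 2 * R ≤ ‖x‖ →
      ∫⁻ s in Icc (0 : ℝ) 1, ENNReal.ofReal s * segmentMean h B x s
        ≤ ENNReal.ofReal (C * (‖x‖ ^ (-2 : ℝ)
            + ‖x‖ ^ (-μ) * ∫ s in Icc (R / ‖x‖) 1, s ^ (1 - μ))) := by
  obtain ⟨K, θ, hK, hθ0, hθ, hle⟩ := exists_segmentMean_le hh hc hp1 hp hBp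
  obtain ⟨C, R, hC, hR, hdec⟩ := exists_segmentMean_le_of_decaysAE hh hc hμ hB
  refine ⟨max (K * 2 ^ θ * R ^ 2) C, R, by positivity, hR, ?_⟩
  intro x hx
  have hx0 : 0 < ‖x‖ := by linarith
  set ε := R / ‖x‖ with hε
  have hε0 : 0 < ε := by positivity
  have hε1 : ε ≤ 1 / 2 := by rw [hε, div_le_div_iff₀ hx0 (by norm_num)]; linarith
  have hnear : ∫⁻ s in Icc 0 ε, ENNReal.ofReal s * segmentMean h B x s
      ≤ ENNReal.ofReal (K * 2 ^ θ * R ^ 2 * ‖x‖ ^ (-2 : ℝ)) := by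
    have h1 : ∫⁻ s in Icc 0 ε, ENNReal.ofReal s * segmentMean h B x s
        ≤ ∫⁻ s in Icc 0 ε, ENNReal.ofReal (ε * (K * 2 ^ θ)) := by
      refine setLIntegral_mono' measurableSet_Icc fun s hs => ?_
      rw [ENNReal.ofReal_mul hε0.le]
      gcongr
      · exact hs.2
      · refine (hle x s (by linarith [hs.2])).trans (ENNReal.ofReal_le_ofReal ?_)
        gcongr
        have h2 : (1 / 2 : ℝ) ≤ 1 - s := by linarith [hs.2]
        calc _ ≤ (1 / 2 : ℝ) ^ (-θ) :=
              Real.rpow_le_rpow_of_nonpos (by norm_num) h2 (by linarith)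
          _ = _ := by rw [one_div, Real.inv_rpow (by norm_num), Real.rpow_neg (by norm_num), inv_inv]
    refine h1.trans (le_of_eq ?_)
    rw [setLIntegral_const, Real.volume_Icc, sub_zero, ← ENNReal.ofReal_mul (by positivity),
      Real.rpow_neg hx0.le, hε]
    congr 1
    norm_num
    field_simp
  have hfar : ∫⁻ s in Icc ε 1, ENNReal.ofReal s * segmentMean h B x s
      ≤ ENNReal.ofReal (C * (‖x‖ ^ (-μ) * ∫ s in Icc ε 1, s ^ (1 - μ))) := by
    have hci : IntegrableOn (fun s : ℝ => s ^ (1 - μ)) (Icc ε 1) := by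
      refine ContinuousOn.integrableOn_Icc ?_
      exact ContinuousOn.rpow_const continuousOn_id fun s hs => Or.inl (hε0.trans_le hs.1).ne'
    rw [← mul_assoc, ← integral_const_mul, ofReal_integral_eq_lintegral_ofReal
      (hci.const_mul _) ?_]
    · refine lintegral_mono_ae ?_
      have h1 : ∀ᵐ s : ℝ, s ≠ 1 := by simp [ae_iff, measure_singleton]
      filter_upwards [ae_restrict_of_ae h1, ae_restrict_mem measurableSet_Icc] with s hs1 hs
      have hs0 : 0 < s := hε0.trans_le hs.1
      have h2 : R ≤ s * ‖x‖ := by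
        have := hs.1
        rw [hε, div_le_iff₀ hx0] at this
        exact this
      calc _ ≤ ENNReal.ofReal s * ENNReal.ofReal (C * (s * ‖x‖) ^ (-μ)) := by
            gcongr
            exact hdec x s hs0.le (lt_of_le_of_ne hs.2 hs1) h2
        _ = _ := by
            rw [← ENNReal.ofReal_mul hs0.le, Real.mul_rpow hs0.le hx0.le,
              sub_eq_add_neg, Real.rpow_add hs0, Real.rpow_one]
            congr 1
            ring
    · filter_upwards [ae_restrict_mem measurableSet_Icc] with s hs
      have hs0 : 0 < s := hε0.trans_le hs.1
      positivity
  have hI : 0 ≤ ∫ s in Icc ε 1, s ^ (1 - μ) :=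
    setIntegral_nonneg measurableSet_Icc fun s hs => by
      have hs0 : 0 < s := hε0.trans_le hs.1
      positivity
  have hsplit : Icc (0 : ℝ) 1 = Icc 0 ε ∪ Icc ε 1 :=
    (Icc_union_Icc_eq_Icc hε0.le (by linarith)).symm
  rw [hsplit]
  refine (lintegral_union_le _ _ _).trans ((add_le_add hnear hfar).trans ?_)
  rw [← ENNReal.ofReal_add (by positivity) (by positivity)]
  refine ENNReal.ofReal_le_ofReal ?_
  rw [mul_add]
  gcongr
  · exact le_max_left _ _
  · exact le_max_right _ _

lemma setIntegral_Icc_eq_intervalIntegral {f : ℝ → ℝ} {a b : ℝ} (hab : a ≤ b) :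
    ∫ s in Icc a b, f s = ∫ s in a..b, f s := by
  rw [intervalIntegral.integral_of_le hab, integral_Icc_eq_integral_Ioc]

/-- The decay rate `|x|⁻²`, `|x|⁻² log |x|`, `|x|^(-μ)` of the double integral up to the factor
`|x|`, according as `μ > 2`, `μ = 2`, `μ < 2`. -/
noncomputable def decayRate (μ t : ℝ) : ℝ :=
  if 2 < μ then t ^ (-2 : ℝ) else if μ = 2 then t ^ (-2 : ℝ) * Real.log t else t ^ (-μ)

lemma exists_rate_bound {μ R : ℝ} (hR : 1 ≤ R) :
    ∃ C : ℝ, 0 ≤ C ∧ ∀ t : ℝ, max (2 * R) 3 ≤ t →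
      t ^ (-2 : ℝ) + t ^ (-μ) * ∫ s in Icc (R / t) 1, s ^ (1 - μ) ≤ C * decayRate μ t := by
  have hbasic : ∀ t : ℝ, max (2 * R) 3 ≤ t → 3 ≤ t ∧ 0 < R / t ∧ R / t ≤ 1 := by
    intro t ht
    have h1 := (le_max_left _ _).trans ht
    have h2 := (le_max_right _ _).trans ht
    refine ⟨h2, by positivity, ?_⟩
    rw [div_le_one (by linarith)]
    linarith
  rcases lt_trichotomy μ 2 with hμ | hμ | hμ
  · refine ⟨1 + 1 / (2 - μ), by have : 0 < 2 - μ := by linarith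
                                positivity, fun t ht => ?_⟩
    obtain ⟨h3, hε0, hε1⟩ := hbasic t ht
    have ht0 : 0 < t := by linarith
    have hd : decayRate μ t = t ^ (-μ) := by
      rw [decayRate, if_neg (by linarith), if_neg (by linarith)]
    rw [hd, add_mul, one_mul, mul_comm _ (t ^ (-μ))]
    gcongr
    · linarith
    · rw [setIntegral_Icc_eq_intervalIntegral hε1, integral_rpow (Or.inl (by linarith))]
      rw [show 1 - μ + 1 = 2 - μ by ring, Real.one_rpow]
      gcongr
      have : 0 ≤ (R / t) ^ (2 - μ) := by positivity
      linarith
  · subst hμ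
    refine ⟨2, by norm_num, fun t ht => ?_⟩
    obtain ⟨h3, hε0, hε1⟩ := hbasic t ht
    have ht0 : 0 < t := by linarith
    have hd : decayRate 2 t = t ^ (-2 : ℝ) * Real.log t := by
      rw [decayRate, if_neg (by linarith), if_pos rfl]
    have hlog : 1 ≤ Real.log t := by
      rw [Real.le_log_iff_exp_le ht0]
      linarith [Real.exp_one_lt_d9]
    have hint : ∫ s in Icc (R / t) 1, s ^ (1 - 2 : ℝ) ≤ Real.log t := by
      rw [setIntegral_Icc_eq_intervalIntegral hε1]
      norm_num
      simp_rw [Real.rpow_neg_one]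
      rw [integral_inv_of_pos hε0 one_pos, one_div_div]
      refine Real.log_le_log (by positivity) ?_
      rw [div_le_iff₀ (by linarith)]
      nlinarith
    rw [hd]
    have h0 : 0 ≤ t ^ (-2 : ℝ) := by positivity
    nlinarith [mul_le_mul_of_nonneg_left hint h0, mul_le_mul_of_nonneg_left hlog h0]
  · refine ⟨1 + R ^ (2 - μ) / (μ - 2), by have : 0 < μ - 2 := by linarith
                                          positivity, fun t ht => ?_⟩
    obtain ⟨h3, hε0, hε1⟩ := hbasic t ht
    have ht0 : 0 < t := by linarith
    have hd : decayRate μ t = t ^ (-2 : ℝ) := by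
      rw [decayRate, if_pos (by linarith)]
    have hμ2 : 0 < μ - 2 := by linarith
    rw [hd, add_mul, one_mul]
    refine add_le_add le_rfl ?_
    rw [setIntegral_Icc_eq_intervalIntegral hε1, integral_rpow (Or.inr ⟨by linarith, ?_⟩)]
    · rw [show 1 - μ + 1 = 2 - μ by ring, Real.one_rpow, Real.div_rpow (by linarith) ht0.le]
      have h1 : t ^ (-μ) / t ^ (2 - μ) = t ^ (-2 : ℝ) := by
        rw [← Real.rpow_sub ht0]; congr 1; ring
      have h2 : (1 - R ^ (2 - μ) / t ^ (2 - μ)) / (2 - μ)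
          ≤ R ^ (2 - μ) / (μ - 2) / t ^ (2 - μ) := by
        rw [show 2 - μ = -(μ - 2) by ring] at *
        rw [div_neg, ← neg_div, neg_sub, div_right_comm]
        gcongr
        linarith
      calc _ ≤ t ^ (-μ) * (R ^ (2 - μ) / (μ - 2) / t ^ (2 - μ)) := by gcongr
        _ = R ^ (2 - μ) / (μ - 2) * (t ^ (-μ) / t ^ (2 - μ)) := by ring
        _ = _ := by rw [h1]
    · rw [uIcc_of_le hε1]
      exact fun hmem => absurd hmem.1 (not_le.2 hε0)

lemma mul_decayRate_of_gt {μ t : ℝ} (hμ : 2 < μ) (ht : 0 < t) : t * decayRate μ t = t⁻¹ := by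
  rw [decayRate, if_pos hμ, Real.rpow_neg ht.le]
  norm_num
  field_simp

lemma mul_decayRate_two {t : ℝ} (ht : 0 < t) : t * decayRate 2 t = Real.log t / t := by
  rw [decayRate, if_neg (lt_irrefl _), if_pos rfl, Real.rpow_neg ht.le]
  norm_num
  field_simp

lemma decayRate_of_lt {μ t : ℝ} (hμ : μ < 2) : decayRate μ t = t ^ (-μ) := by
  rw [decayRate, if_neg (by linarith), if_neg (by linarith)]

lemma mul_decayRate_of_lt {μ t : ℝ} (hμ : μ < 2) (ht : 0 < t) :
    t * decayRate μ t = t ^ (-(μ - 1)) := by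
  rw [decayRate_of_lt hμ, show -(μ - 1) = 1 + -μ by ring, Real.rpow_add ht, Real.rpow_one]

lemma exists_lintegral_enorm_griesingerIntegrand_le {n : ℕ} {F : Type*} [NormedAddCommGroup F]
    [NormedSpace ℝ F] (Λ : REuc n →L[ℝ] F →L[ℝ] REuc n) {h : REuc n → ℝ} (hh : Continuous h)
    (hc : HasCompactSupport h) {B : REuc n → F} {p : ENNReal} (hp1 : 1 ≤ p)
    (hp : (n : ENNReal) < p) (hBp : MemLp B p) {μ : ℝ} (hμ : 0 < μ) (hB : DecaysAE B μ) :
    ∃ C X : ℝ, 0 ≤ C ∧ 1 ≤ X ∧ ∀ x : REuc n, X ≤ ‖x‖ → 0 ≤ decayRate μ ‖x‖ ∧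
      ∫⁻ q, ‖griesingerIntegrand (fun v w => Λ v w) h B x q‖ₑ
        ∂(volume.prod (volume.restrict (Icc (0 : ℝ) 1)))
      ≤ ENNReal.ofReal (C * (‖x‖ * decayRate μ ‖x‖)) := by
  obtain ⟨r, hr0, hr⟩ := exists_radius_of_hasCompactSupport hc
  obtain ⟨C, R, hC, hR, hle⟩ := exists_lintegral_segmentMean_le hh hc hp1 hp hBp hμ hB
  obtain ⟨C', hC', hrate⟩ := exists_rate_bound (μ := μ) hR
  refine ⟨‖Λ‖ * 2 * (C * C'), max (max (2 * R) 3) r, by positivity,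
    le_max_of_le_left (le_max_of_le_right (by norm_num)), fun x hx => ?_⟩
  have hx1 : max (2 * R) 3 ≤ ‖x‖ := (le_max_left _ _).trans hx
  have hx2 : r ≤ ‖x‖ := (le_max_right _ _).trans hx
  have hx3 : 3 ≤ ‖x‖ := (le_max_right _ _).trans hx1
  have hd0 : 0 ≤ decayRate μ ‖x‖ := by
    unfold decayRate
    have := Real.log_nonneg (by linarith : (1 : ℝ) ≤ ‖x‖)
    split_ifs <;> positivity
  refine ⟨hd0, (lintegral_enorm_griesingerIntegrand_le Λ hh hr hBp.1 x).trans ?_⟩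
  refine (mul_le_mul_right (hle x ((le_max_left _ _).trans hx1)) _).trans ?_
  rw [← ENNReal.ofReal_mul (by positivity)]
  refine ENNReal.ofReal_le_ofReal ?_
  calc _ ≤ ‖Λ‖ * (‖x‖ + r) * (C * (C' * decayRate μ ‖x‖)) := by
        gcongr
        exact hrate _ hx1
    _ ≤ ‖Λ‖ * (‖x‖ + ‖x‖) * (C * (C' * decayRate μ ‖x‖)) := by gcongr
    _ = _ := by ring

/-- The potential decays, and its radial component decays one order faster: `(x - z) × w` is
orthogonal to `x - z`, so pairing with `x` amounts to pairing with the bounded vector `z`. -/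
lemma exists_norm_griesinger_le {n : ℕ} {F : Type*} [NormedAddCommGroup F]
    [NormedSpace ℝ F] (Λ : REuc n →L[ℝ] F →L[ℝ] REuc n) (hΛ : ∀ v w, inner ℝ (Λ v w) v = 0)
    {h : REuc n → ℝ} (hh : Continuous h)
    (hc : HasCompactSupport h) {B : REuc n → F} {p : ENNReal} (hp1 : 1 ≤ p)
    (hp : (n : ENNReal) < p) (hBp : MemLp B p) {μ : ℝ} (hμ : 0 < μ) (hB : DecaysAE B μ) :
    ∃ C X : ℝ, 0 ≤ C ∧ 1 ≤ X ∧ ∀ x : REuc n, X ≤ ‖x‖ →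
      ‖griesinger (fun v w => Λ v w) h B x‖ ≤ C * (‖x‖ * decayRate μ ‖x‖) ∧
      |longitudinal (griesinger (fun v w => Λ v w) h B) x| ≤ C * decayRate μ ‖x‖ := by
  obtain ⟨r, hr0, hr⟩ := exists_radius_of_hasCompactSupport hc
  obtain ⟨C, X, hC, hX, hle⟩ :=
    exists_lintegral_enorm_griesingerIntegrand_le Λ hh hc hp1 hp hBp hμ hB
  have hconv := griesingerConverges_of_memLp Λ hh hc hp1 hp hBp
  refine ⟨C * (1 + r), X, by positivity, hX, fun x hx => ?_⟩
  obtain ⟨hd0, hx2⟩ := hle x hx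
  have hx0 : 0 < ‖x‖ := by linarith
  have hint : Integrable (griesingerIntegrand (fun v w => Λ v w) h B x)
      (volume.prod (volume.restrict (Icc (0 : ℝ) 1))) := by
    have h1 := hconv x
    rwa [IntegrableOn, prod_restrict_Icc_eq] at h1
  set ν := (volume : Measure (REuc n)).prod (volume.restrict (Icc (0 : ℝ) 1)) with hν
  have hI : ∫ q, ‖griesingerIntegrand (fun v w => Λ v w) h B x q‖ ∂ν
      ≤ C * (‖x‖ * decayRate μ ‖x‖) := by
    rw [integral_norm_eq_lintegral_enorm hint.1]
    exact ENNReal.toReal_le_of_le_ofReal (by positivity) hx2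
  have hCr : C * (‖x‖ * decayRate μ ‖x‖) ≤ C * (1 + r) * (‖x‖ * decayRate μ ‖x‖) := by
    gcongr
    nlinarith
  constructor
  · rw [griesinger_eq_neg_integral_prod hconv, norm_neg]
    exact ((norm_integral_le_integral_norm _).trans hI).trans hCr
  · have h1 : inner ℝ (griesinger (fun v w => Λ v w) h B x) x
        = -∫ q, inner ℝ q.1 (griesingerIntegrand (fun v w => Λ v w) h B x q) ∂ν := by
      rw [griesinger_eq_neg_integral_prod hconv, inner_neg_left, real_inner_comm,
        ← integral_inner hint]
      congr 1
      refine integral_congr_ae (ae_of_all _ fun q => ?_)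
      have h2 : inner ℝ (x - q.1) (griesingerIntegrand (fun v w => Λ v w) h B x q) = 0 := by
        rw [griesingerIntegrand, inner_smul_right, real_inner_comm, hΛ, mul_zero]
      rw [inner_sub_left, sub_eq_zero] at h2
      exact h2
    have h3 : |inner ℝ (griesinger (fun v w => Λ v w) h B x) x|
        ≤ r * (C * (‖x‖ * decayRate μ ‖x‖)) := by
      rw [h1, abs_neg]
      refine (abs_integral_le_integral_abs).trans ?_
      refine le_trans (integral_mono_of_nonneg (ae_of_all _ fun q => abs_nonneg _)
        (hint.norm.const_mul r) (ae_of_all _ fun q => ?_)) ?_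
      · by_cases h0 : h q.1 = 0
        · simp [griesingerIntegrand, h0]
        · refine (abs_real_inner_le_norm _ _).trans ?_
          exact mul_le_mul_of_nonneg_right (hr _ h0) (norm_nonneg _)
      · rw [integral_const_mul]
        exact mul_le_mul_of_nonneg_left hI hr0.le
    rw [longitudinal, abs_div, abs_norm, div_le_iff₀ hx0]
    refine h3.trans ?_
    have : 0 ≤ C * (‖x‖ * decayRate μ ‖x‖) := by positivity
    linarith

lemma shortRange_of_le {n : ℕ} {f : REuc n → ℝ} {M C X a : ℝ} (hM : ∀ x, |f x| ≤ M) (hC : 0 ≤ C)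
    (hX : 0 < X) (ha : 1 < a) (hf : ∀ x, X ≤ ‖x‖ → |f x| ≤ C * ‖x‖ ^ (-a)) :
    ShortRange f := by
  unfold ShortRange
  rw [← Ioc_union_Ioi_eq_Ioi hX.le]
  refine (lintegral_union_le _ _ _).trans_lt (ENNReal.add_lt_top.2 ⟨?_, ?_⟩)
  · refine lt_of_le_of_lt (b := ∫⁻ r in Ioc 0 X, ENNReal.ofReal M) ?_ ?_
    · exact lintegral_mono fun r => iSup₂_le fun x _ => ENNReal.ofReal_le_ofReal (hM x)
    · rw [setLIntegral_const, Real.volume_Ioc]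
      exact ENNReal.mul_lt_top ENNReal.ofReal_lt_top ENNReal.ofReal_lt_top
  · refine lt_of_le_of_lt (b := ∫⁻ r in Ioi X, ENNReal.ofReal (C * r ^ (-a))) ?_ ?_
    · refine setLIntegral_mono' measurableSet_Ioi fun r hr => iSup₂_le fun x hx => ?_
      have hr0 : 0 < r := hX.trans hr
      refine ENNReal.ofReal_le_ofReal ((hf x ((le_of_lt hr).trans hx)).trans ?_)
      gcongr 1
      exact Real.rpow_le_rpow_of_nonpos hr0 hx (by linarith)
    · exact ((integrableOn_Ioi_rpow_of_lt (by linarith) hX).const_mul C).lintegral_lt_top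

/-- The decay of the potential and the faster decay of its longitudinal part, as consequences of
`exists_norm_griesinger_le`. -/
lemma griesinger_mediumRange_of_memLp {n : ℕ} {F : Type*} [NormedAddCommGroup F]
    [NormedSpace ℝ F] (Λ : REuc n →L[ℝ] F →L[ℝ] REuc n) (hΛ : ∀ v w, inner ℝ (Λ v w) v = 0)
    {h : REuc n → ℝ} (hh : Continuous h)
    (hc : HasCompactSupport h) {B : REuc n → F} {p : ENNReal} (hp1 : 1 ≤ p)
    (hp : (n : ENNReal) < p) (hBp : MemLp B p) {μ : ℝ} (hμ : 3 / 2 < μ) (hB : DecaysAE B μ) :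
    GriesingerDecay μ (griesinger (fun v w => Λ v w) h B) ∧
    ShortRange (longitudinal (griesinger (fun v w => Λ v w) h B)) ∧
    MediumRange (griesinger (fun v w => Λ v w) h B) := by
  have hcont := continuous_griesinger Λ hh hc hp1 hp hBp
  set A := griesinger (fun v w => Λ v w) h B with hA
  have hdecay : GriesingerDecay μ A := by
    obtain ⟨C, X, hC, hX, hle⟩ := exists_norm_griesinger_le Λ hΛ hh hc hp1 hp hBp
      (by linarith) hB
    have hO : A =O[Bornology.cobounded (REuc n)] fun x => ‖x‖ * decayRate μ ‖x‖ := by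
      refine Asymptotics.IsBigO.of_bound C ?_
      filter_upwards [eventually_cobounded_le_norm X] with x hx
      refine (hle x hx).1.trans ?_
      gcongr
      exact Real.le_norm_self _
    have hpos : ∀ᶠ x : REuc n in Bornology.cobounded (REuc n), 0 < ‖x‖ := by
      filter_upwards [eventually_cobounded_le_norm 1] with x hx
      linarith
    refine ⟨fun h2 => hO.congr' (EventuallyEq.rfl) ?_, fun h2 => hO.congr' EventuallyEq.rfl ?_,
      fun h2 => hO.congr' EventuallyEq.rfl ?_⟩
    · filter_upwards [hpos] with x hx using mul_decayRate_of_gt h2 hx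
    · subst h2
      filter_upwards [hpos] with x hx using mul_decayRate_two hx
    · filter_upwards [hpos] with x hx using mul_decayRate_of_lt h2 hx
  -- weakening the exponent to one below `2` avoids the case distinction
  obtain ⟨μ', hm1, hm2, hm3⟩ : ∃ μ' : ℝ, 3 / 2 < μ' ∧ μ' < 2 ∧ μ' ≤ μ :=
    ⟨min μ (7 / 4), lt_min hμ (by norm_num), (min_le_right _ _).trans_lt (by norm_num),
      min_le_left _ _⟩
  obtain ⟨C, X, hC, hX, hle⟩ := exists_norm_griesinger_le Λ hΛ hh hc hp1 hp hBp
    (by linarith) (hB.mono hm3)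
  have hshort : ShortRange (longitudinal A) := by
    obtain ⟨M, hM⟩ := (isCompact_closedBall (0 : REuc n) X).exists_bound_of_continuousOn
      hcont.continuousOn
    refine shortRange_of_le (M := max M (C * X ^ (-μ'))) (C := C) (X := X) (a := μ')
      (fun x => ?_) hC (by linarith) (by linarith) (fun x hx => ?_)
    · rcases le_total ‖x‖ X with hx | hx
      · refine le_trans ?_ (le_max_of_le_left (hM x (by simpa using hx)))
        rw [longitudinal, abs_div, abs_norm]
        exact div_le_of_le_mul₀ (norm_nonneg _) (norm_nonneg _) (abs_real_inner_le_norm _ _)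
      · refine le_trans (hle x hx).2 (le_max_of_le_right ?_)
        rw [decayRate_of_lt hm2]
        gcongr 1
        exact Real.rpow_le_rpow_of_nonpos (by linarith) hx (by linarith)
    · rw [← decayRate_of_lt hm2]
      exact (hle x hx).2
  refine ⟨hdecay, hshort, hcont, ⟨μ' - 1, by linarith, ?_⟩, hshort⟩
  refine Asymptotics.IsBigO.of_bound C ?_
  filter_upwards [eventually_cobounded_le_norm X] with x hx
  rw [← mul_decayRate_of_lt hm2 (by linarith)]
  refine (hle x hx).1.trans ?_
  gcongr
  exact Real.le_norm_self _

/-! ### A trilinear form on segments -/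

lemma memLp_two_of_decaysAE {n : ℕ} {F : Type*} [NormedAddCommGroup F] {B : REuc n → F}
    {p : ENNReal} (hp : 2 ≤ p) (hBp : MemLp B p) {μ : ℝ} (hμ : (n : ℝ) < 2 * μ)
    (hB : DecaysAE B μ) : MemLp B 2 := by
  obtain ⟨C, R, hC, hR, hdec⟩ := hB.exists_nonneg
  have hn : (0 : ℝ) ≤ n := by positivity
  rw [← integrable_norm_rpow_iff hBp.1 (by norm_num) (by norm_num), ← integrableOn_univ,
    ← union_compl_self (Metric.closedBall (0 : REuc n) R)]
  refine IntegrableOn.union ?_ ?_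
  · have : IsFiniteMeasure (volume.restrict (Metric.closedBall (0 : REuc n) R)) :=
      ⟨by simpa using (isCompact_closedBall (0 : REuc n) R).measure_lt_top⟩
    have h1 : MemLp B 2 (volume.restrict (Metric.closedBall (0 : REuc n) R)) :=
      hBp.restrict _ |>.mono_exponent hp
    exact (integrable_norm_rpow_iff h1.1 (by norm_num) (by norm_num)).2 h1
  · have hi : Integrable fun x : REuc n => C ^ 2 * 2 ^ (2 * μ) * (1 + ‖x‖) ^ (-(2 * μ)) :=
      (integrable_one_add_norm (by simpa using hμ)).const_mul _
    refine Integrable.mono' hi.integrableOn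
      (hBp.1.norm.aemeasurable.pow_const _).aestronglyMeasurable.restrict ?_
    filter_upwards [ae_restrict_of_ae hdec,
      ae_restrict_mem Metric.isClosed_closedBall.measurableSet.compl] with x hx hxR
    have hxR' : R < ‖x‖ := by simpa using hxR
    have h1 := hx hxR'.le
    rw [Real.norm_of_nonneg (by positivity)]
    norm_num
    calc ‖B x‖ ^ 2 ≤ (C * ‖x‖ ^ (-μ)) ^ 2 := by gcongr
      _ ≤ (C * ((1 + ‖x‖) / 2) ^ (-μ)) ^ 2 := by
        gcongr ?_ ^ 2
        gcongr 1
        exact Real.rpow_le_rpow_of_nonpos (by positivity) (by linarith) (by linarith)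
      _ = _ := by
        rw [Real.div_rpow (by positivity) (by norm_num), mul_pow, div_pow,
          ← Real.rpow_natCast (_ ^ (-μ)), ← Real.rpow_mul (by positivity),
          ← Real.rpow_natCast (_ ^ (-μ)), ← Real.rpow_mul (by norm_num), div_eq_mul_inv,
          ← Real.rpow_neg (by norm_num)]
        push_cast
        ring_nf

/-- The measure `dz ds dx` on triples `((z, s), x)` with `0 ≤ s ≤ 1`. -/
noncomputable abbrev segmentMeasure (n : ℕ) : Measure ((REuc n × ℝ) × REuc n) :=
  ((volume : Measure (REuc n)).prod (volume.restrict (Icc (0 : ℝ) 1))).prod volume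

/-- The integrand `s h(z) g(x) b(s x + (1 - s) z)`. -/
noncomputable def segmentIntegrand {n : ℕ} {𝕜 : Type*} [RCLike 𝕜] (h g b : REuc n → 𝕜)
    (q : (REuc n × ℝ) × REuc n) : 𝕜 :=
  (q.1.2 : 𝕜) * (h q.1.1 * (g q.2 * b (q.1.2 • q.2 + (1 - q.1.2) • q.1.1)))

/-- The trilinear form `∫∫∫ s h(z) g(x) b(s x + (1 - s) z) ds dz dx`. -/
noncomputable def segmentForm {n : ℕ} {𝕜 : Type*} [RCLike 𝕜] (h g b : REuc n → 𝕜) : 𝕜 :=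
  ∫ q, segmentIntegrand h g b q ∂(segmentMeasure n)

lemma quasiMeasurePreserving_segmentMeasure {n : ℕ} :
    Measure.QuasiMeasurePreserving
      (fun q : (REuc n × ℝ) × REuc n => q.1.2 • q.2 + (1 - q.1.2) • q.1.1)
      (segmentMeasure n) volume :=
  quasiMeasurePreserving_segment₃.mono_left
    ((Measure.AbsolutelyContinuous.rfl.prod Measure.restrict_le_self.absolutelyContinuous).prod
      Measure.AbsolutelyContinuous.rfl)

lemma aestronglyMeasurable_segmentIntegrand {n : ℕ} {𝕜 : Type*} [RCLike 𝕜] {h g b : REuc n → 𝕜}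
    (hh : AEStronglyMeasurable h) (hg : AEStronglyMeasurable g) (hb : AEStronglyMeasurable b) :
    AEStronglyMeasurable (segmentIntegrand h g b) (segmentMeasure n) := by
  unfold segmentIntegrand
  refine AEStronglyMeasurable.mul ?_ (hh.comp_fst.comp_fst.mul (hg.comp_snd.mul
    (hb.comp_quasiMeasurePreserving quasiMeasurePreserving_segmentMeasure)))
  exact (RCLike.continuous_ofReal.comp
    (continuous_snd.comp continuous_fst)).aestronglyMeasurable

/-- In dimension at most three the trilinear form is bounded on `L¹ × L² × L²`: rescaling the
last factor costs `s ^ (-n / 2)`, which the factor `s` makes integrable. -/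
lemma lintegral_segmentIntegrand_le {n : ℕ} (hn : n ≤ 3) {𝕜 : Type*} [RCLike 𝕜]
    {h g b : REuc n → 𝕜}
    (hh : AEStronglyMeasurable h) (hg : AEStronglyMeasurable g) (hb : AEStronglyMeasurable b) :
    ∫⁻ q, ‖segmentIntegrand h g b q‖ₑ ∂(segmentMeasure n)
      ≤ 2 * (eLpNorm h 1 * (eLpNorm g 2 * eLpNorm b 2)) := by
  rw [lintegral_prod _ (aestronglyMeasurable_segmentIntegrand hh hg hb).enorm]
  have h1 : ∀ᵐ q ∂((volume : Measure (REuc n)).prod (volume.restrict (Icc (0 : ℝ) 1))),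
      0 < q.2 ∧ q.2 ≤ 1 := by
    have h2 : ∀ᵐ s ∂(volume.restrict (Icc (0 : ℝ) 1)), 0 < s ∧ s ≤ 1 := by
      have h3 : ∀ᵐ s : ℝ, s ≠ 0 := by simp [ae_iff, measure_singleton]
      filter_upwards [ae_restrict_of_ae h3, ae_restrict_mem measurableSet_Icc] with s hs hs'
      exact ⟨lt_of_le_of_ne hs'.1 hs.symm, hs'.2⟩
    exact Measure.quasiMeasurePreserving_snd.ae h2
  calc _ ≤ ∫⁻ q : REuc n × ℝ, (‖h q.1‖ₑ * (ENNReal.ofReal (q.2 ^ (-(1 / 2) : ℝ)))) *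
        (eLpNorm g 2 * eLpNorm b 2)
          ∂((volume : Measure (REuc n)).prod (volume.restrict (Icc (0 : ℝ) 1))) := by
        refine lintegral_mono_ae ?_
        filter_upwards [h1] with q ⟨hq0, hq1⟩
        simp only [segmentIntegrand, enorm_mul]
        rw [lintegral_const_mul' _ _ enorm_ne_top, lintegral_const_mul' _ _ enorm_ne_top]
        have h2 := lintegral_mul_comp_affine_le hq0 ((1 - q.2) • q.1) 2 2 hg hb
        have h3 : ‖(q.2 : 𝕜)‖ₑ = ENNReal.ofReal q.2 := by
          rw [← ofReal_norm, RCLike.norm_ofReal, abs_of_pos hq0]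
        have h4 : ENNReal.ofReal q.2 * ENNReal.ofReal (q.2 ^ (-(n * (1 / 2 : ENNReal).toReal)))
            ≤ ENNReal.ofReal (q.2 ^ (-(1 / 2) : ℝ)) := by
          rw [← ENNReal.ofReal_mul hq0.le]
          refine ENNReal.ofReal_le_ofReal ?_
          nth_rewrite 1 [← Real.rpow_one q.2]
          rw [← Real.rpow_add hq0]
          refine Real.rpow_le_rpow_of_exponent_ge hq0 hq1 ?_
          have : (n : ℝ) ≤ 3 := by exact_mod_cast hn
          norm_num
          linarith
        rw [h3]
        calc _ ≤ ENNReal.ofReal q.2 * (‖h q.1‖ₑ * (eLpNorm g 2 *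
              (ENNReal.ofReal (q.2 ^ (-(n * (1 / 2 : ENNReal).toReal))) * eLpNorm b 2))) := by
              gcongr
          _ = ‖h q.1‖ₑ * (ENNReal.ofReal q.2 *
              ENNReal.ofReal (q.2 ^ (-(n * (1 / 2 : ENNReal).toReal)))) *
              (eLpNorm g 2 * eLpNorm b 2) := by ring
          _ ≤ _ := by gcongr
    _ = (eLpNorm h 1 * ∫⁻ s in Icc (0 : ℝ) 1, ENNReal.ofReal (s ^ (-(1 / 2) : ℝ))) *
        (eLpNorm g 2 * eLpNorm b 2) := by
        have hm : AEMeasurable (fun s : ℝ => ENNReal.ofReal (s ^ (-(1 / 2) : ℝ)))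
            (volume.restrict (Icc 0 1)) := by fun_prop
        have hhm : AEMeasurable
            (fun q : REuc n × ℝ => ‖h q.1‖ₑ * ENNReal.ofReal (q.2 ^ (-(1 / 2) : ℝ)))
            (volume.prod (volume.restrict (Icc 0 1))) := hh.enorm.comp_fst.mul hm.comp_snd
        rw [lintegral_mul_const'' _ hhm, lintegral_prod_mul hh.enorm hm, eLpNorm_one_eq_lintegral_enorm]
    _ = _ := by
        have h5 : ∫⁻ s in Icc (0 : ℝ) 1, ENNReal.ofReal (s ^ (-(1 / 2) : ℝ)) = 2 := by
          have hi : IntegrableOn (fun s : ℝ => s ^ (-(1 / 2) : ℝ)) (Icc 0 1) := by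
            rw [integrableOn_Icc_iff_integrableOn_Ioc]
            exact (intervalIntegrable_iff_integrableOn_Ioc_of_le zero_le_one).1
              (intervalIntegral.intervalIntegrable_rpow' (by norm_num))
          rw [← ofReal_integral_eq_lintegral_ofReal hi, setIntegral_Icc_eq_intervalIntegral
            zero_le_one, integral_rpow (Or.inl (by norm_num))]
          · norm_num
          · filter_upwards [ae_restrict_mem measurableSet_Icc] with s hs
            exact Real.rpow_nonneg hs.1 _
        rw [h5]
        ring

lemma integrable_segmentIntegrand {n : ℕ} (hn : n ≤ 3) {𝕜 : Type*} [RCLike 𝕜]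
    {h g b : REuc n → 𝕜} (hh : Integrable h) (hg : MemLp g 2) (hb : MemLp b 2) :
    Integrable (segmentIntegrand h g b) (segmentMeasure n) := by
  refine ⟨aestronglyMeasurable_segmentIntegrand hh.1 hg.1 hb.1, ?_⟩
  refine (lintegral_segmentIntegrand_le hn hh.1 hg.1 hb.1).trans_lt ?_
  exact ENNReal.mul_lt_top (by norm_num) (ENNReal.mul_lt_top (memLp_one_iff_integrable.2 hh).2
    (ENNReal.mul_lt_top hg.2 hb.2))

lemma norm_segmentForm_le {n : ℕ} (hn : n ≤ 3) {𝕜 : Type*} [RCLike 𝕜]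
    {h g b : REuc n → 𝕜} (hh : Integrable h) (hg : MemLp g 2) (hb : MemLp b 2) :
    ‖segmentForm h g b‖
      ≤ 2 * ((eLpNorm h 1).toReal * ((eLpNorm g 2).toReal * (eLpNorm b 2).toReal)) := by
  have h1 := (enorm_integral_le_lintegral_enorm (segmentIntegrand h g b)).trans
    (lintegral_segmentIntegrand_le hn hh.1 hg.1 hb.1)
  have h2 : 2 * (eLpNorm h 1 * (eLpNorm g 2 * eLpNorm b 2)) ≠ ⊤ :=
    (ENNReal.mul_lt_top (by norm_num) (ENNReal.mul_lt_top (memLp_one_iff_integrable.2 hh).2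
      (ENNReal.mul_lt_top hg.2 hb.2))).ne
  have h3 := ENNReal.toReal_mono h2 h1
  simpa [segmentForm] using h3

lemma segmentForm_sub_right {n : ℕ} (hn : n ≤ 3) {𝕜 : Type*} [RCLike 𝕜]
    {h g b b' : REuc n → 𝕜} (hh : Integrable h) (hg : MemLp g 2) (hb : MemLp b 2)
    (hb' : MemLp b' 2) : segmentForm h g (b - b') = segmentForm h g b - segmentForm h g b' := by
  unfold segmentForm
  rw [← integral_sub (integrable_segmentIntegrand hn hh hg hb)
    (integrable_segmentIntegrand hn hh hg hb')]
  refine integral_congr_ae (ae_of_all _ fun q => ?_)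
  simp only [segmentIntegrand, Pi.sub_apply]
  ring

lemma segmentForm_sub_middle {n : ℕ} (hn : n ≤ 3) {𝕜 : Type*} [RCLike 𝕜]
    {h g g' b : REuc n → 𝕜} (hh : Integrable h) (hg : MemLp g 2) (hg' : MemLp g' 2)
    (hb : MemLp b 2) : segmentForm h (g - g') b = segmentForm h g b - segmentForm h g' b := by
  unfold segmentForm
  rw [← integral_sub (integrable_segmentIntegrand hn hh hg hb)
    (integrable_segmentIntegrand hn hh hg' hb)]
  refine integral_congr_ae (ae_of_all _ fun q => ?_)
  simp only [segmentIntegrand, Pi.sub_apply]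
  ring

/-! ### The Fourier bound for one derivative -/

section FourierBound

open scoped FourierTransform LineDeriv

/-- For fixed `s`, the trilinear form factorizes under the Fourier transform. -/
lemma integral_segment_eq_integral_fourier {n : ℕ} (h g b : 𝓢(REuc n, ℂ)) (s : ℝ) :
    ∫ z, ∫ x, h z * (g x * b (s • x + (1 - s) • z))
      = ∫ ξ, (𝓕⁻ b) ξ * ((𝓕 h) ((1 - s) • ξ) * (𝓕 g) (s • ξ)) := by
  have hb : ∀ y, b y = ∫ ξ, ((𝐞 (-inner ℝ ξ y) : Circle) : ℂ) * (𝓕⁻ b) ξ := by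
    intro y
    have hbb : 𝓕 (𝓕⁻ b) = b := FourierTransform.fourier_fourierInv_eq b
    calc b y = (𝓕 (𝓕⁻ b)) y := by rw [hbb]
      _ = _ := by
        rw [SchwartzMap.fourier_coe, Real.fourier_eq]
        rfl
  let K : REuc n × REuc n → REuc n → ℂ := fun p ξ =>
    ((𝐞 (-inner ℝ ξ (s • p.2 + (1 - s) • p.1)) : Circle) : ℂ) * ((h p.1 * g p.2) * (𝓕⁻ b) ξ)
  have hK : Integrable (Function.uncurry K)
      (((volume : Measure (REuc n)).prod (volume : Measure (REuc n))).prod volume) := by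
    refine Integrable.bdd_mul (c := 1) ((h.integrable.mul_prod g.integrable).mul_prod
      (𝓕⁻ b).integrable) ?_
      (ae_of_all _ fun _ => (Circle.norm_coe _).le)
    refine Continuous.aestronglyMeasurable ?_
    have := Real.continuous_fourierChar
    fun_prop
  have hmul : Integrable (fun p : REuc n × REuc n => h p.1 * (g p.2 * b (s • p.2 + (1 - s) • p.1)))
      (volume.prod volume) := by
    obtain ⟨M, hM⟩ : ∃ M, ∀ y, ‖b y‖ ≤ M := by
      obtain ⟨M, -, hM⟩ := b.decay 0 0
      exact ⟨M, fun y => by simpa using hM y⟩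
    have := ((h.integrable (μ := volume)).mul_prod (g.integrable (μ := volume))).mul_bdd (c := M)
      (g := fun p : REuc n × REuc n => b (s • p.2 + (1 - s) • p.1)) ?_ (ae_of_all _ fun p => hM _)
    · simpa [mul_assoc] using this
    · have := b.continuous
      exact (by fun_prop : Continuous fun p : REuc n × REuc n =>
        b (s • p.2 + (1 - s) • p.1)).aestronglyMeasurable
  calc ∫ z, ∫ x, h z * (g x * b (s • x + (1 - s) • z))
      = ∫ p : REuc n × REuc n, h p.1 * (g p.2 * b (s • p.2 + (1 - s) • p.1))
          ∂(volume.prod volume) := (integral_prod _ hmul).symm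
    _ = ∫ p : REuc n × REuc n, (∫ ξ, K p ξ) ∂(volume.prod volume) := by
        refine integral_congr_ae (ae_of_all _ fun p => ?_)
        simp only [K]
        rw [hb, ← mul_assoc, ← integral_const_mul]
        refine integral_congr_ae (ae_of_all _ fun ξ => ?_)
        simp only
        ring
    _ = ∫ ξ, ∫ p : REuc n × REuc n, K p ξ ∂(volume.prod volume) := integral_integral_swap hK
    _ = _ := by
        refine integral_congr_ae (ae_of_all _ fun ξ => ?_)
        simp only [SchwartzMap.fourier_coe, Real.fourier_eq]
        rw [← integral_prod_mul, ← integral_const_mul]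
        refine integral_congr_ae (ae_of_all _ fun p => ?_)
        have hchar : ((𝐞 (-inner ℝ ξ (s • p.2 + (1 - s) • p.1)) : Circle) : ℂ)
            = ((𝐞 (-inner ℝ p.1 ((1 - s) • ξ)) : Circle) : ℂ) *
              ((𝐞 (-inner ℝ p.2 (s • ξ)) : Circle) : ℂ) := by
          rw [← Circle.coe_mul, ← AddChar.map_add_eq_mul]
          congr 2
          rw [inner_add_right, inner_smul_right, inner_smul_right, inner_smul_right,
            inner_smul_right, real_inner_comm ξ, real_inner_comm ξ]
          ring
        simp only [K, hchar, Circle.smul_def, smul_eq_mul]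
        ring

/-- The weight `|ξ| / (1 + (1 - s)² |ξ|²)`. -/
noncomputable def segmentWeight (s t : ℝ) : ℝ := t / (1 + ((1 - s) * t) ^ 2)

lemma segmentWeight_nonneg {s t : ℝ} (ht : 0 ≤ t) : 0 ≤ segmentWeight s t := by
  unfold segmentWeight; positivity

lemma lintegral_segmentWeight_le {t : ℝ} (ht : 0 ≤ t) :
    ∫⁻ s in Icc (0 : ℝ) 1, ENNReal.ofReal (segmentWeight s t) ≤ ENNReal.ofReal (Real.pi / 2) := by
  have hcont : Continuous fun s : ℝ => segmentWeight s t := by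
    unfold segmentWeight
    refine Continuous.div (by fun_prop) (by fun_prop) fun s => by positivity
  rw [← ofReal_integral_eq_lintegral_ofReal hcont.continuousOn.integrableOn_Icc
    (ae_of_all _ fun s => segmentWeight_nonneg ht)]
  refine ENNReal.ofReal_le_ofReal ?_
  rw [setIntegral_Icc_eq_intervalIntegral zero_le_one]
  have hderiv : ∀ s ∈ uIcc (0 : ℝ) 1,
      HasDerivAt (fun s => -Real.arctan ((1 - s) * t)) (segmentWeight s t) s := by
    intro s _
    have h1 : HasDerivAt (fun s : ℝ => (1 - s) * t) (-1 * t) s :=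
      ((hasDerivAt_id s).const_sub 1).mul_const t
    refine h1.arctan.neg.congr_deriv ?_
    unfold segmentWeight
    ring
  rw [intervalIntegral.integral_eq_sub_of_hasDerivAt hderiv (hcont.intervalIntegrable _ _)]
  simp only [sub_self, zero_mul, Real.arctan_zero, neg_zero, sub_zero, one_mul, zero_sub, neg_neg]
  exact (Real.arctan_lt_pi_div_two t).le

lemma lintegral_mul_segmentWeight_le {n : ℕ} {u : REuc n → ℂ} (hu : Continuous u) :
    ∫⁻ s in Icc (0 : ℝ) 1, ∫⁻ ξ, ‖u ξ‖ₑ ^ 2 * ENNReal.ofReal (segmentWeight s ‖ξ‖)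
      ≤ ENNReal.ofReal (Real.pi / 2) * ∫⁻ ξ, ‖u ξ‖ₑ ^ 2 := by
  have hm : Measurable fun q : ℝ × REuc n =>
      ‖u q.2‖ₑ ^ 2 * ENNReal.ofReal (segmentWeight q.1 ‖q.2‖) := by
    unfold segmentWeight
    have := hu.measurable
    fun_prop
  rw [lintegral_lintegral_swap hm.aemeasurable, mul_comm, ← lintegral_mul_const' _ _
    ENNReal.ofReal_ne_top]
  refine lintegral_mono fun ξ => ?_
  rw [lintegral_const_mul' _ _ (by simp)]
  gcongr
  exact lintegral_segmentWeight_le (norm_nonneg _)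

/-- The multiplier estimate: along the segment from `ξ` to `0` the frequency variable sweeps a
ray, so the factor `|ξ|` produced by one derivative is absorbed by the `s`-integration. -/
lemma lintegral_mul_dilate_segmentWeight_le {n : ℕ} (hn : n ≤ 3) {u v : REuc n → ℂ}
    (hu : Continuous u) (hv : Continuous v) :
    ∫⁻ s in Icc (0 : ℝ) 1, ∫⁻ ξ, ‖u ξ‖ₑ * (ENNReal.ofReal (s ^ 2) * ‖v (s • ξ)‖ₑ) *
        ENNReal.ofReal (segmentWeight s ‖ξ‖)
      ≤ ENNReal.ofReal (Real.pi / 2) * (eLpNorm u 2 * eLpNorm v 2) := by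
  have hL2 : ∀ w : REuc n → ℂ, eLpNorm w 2 = (∫⁻ ξ, ‖w ξ‖ₑ ^ 2) ^ (1 / 2 : ℝ) := by
    intro w
    rw [eLpNorm_eq_lintegral_rpow_enorm_toReal (by norm_num) (by norm_num)]
    simp
  set W : ℝ × REuc n → ENNReal := fun q => ENNReal.ofReal √(segmentWeight q.1 ‖q.2‖) with hW
  have hWm : Measurable W := by
    simp only [hW, segmentWeight]
    fun_prop
  have hWsq : ∀ q, W q ^ 2 = ENNReal.ofReal (segmentWeight q.1 ‖q.2‖) := by
    intro q
    simp only [hW]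
    rw [← ENNReal.ofReal_pow (Real.sqrt_nonneg _), Real.sq_sqrt (segmentWeight_nonneg
      (norm_nonneg _))]
  have hum := hu.measurable
  have hvm := hv.measurable
  set f : ℝ × REuc n → ENNReal := fun q => ‖u q.2‖ₑ * W q with hf
  set g : ℝ × REuc n → ENNReal := fun q =>
    ENNReal.ofReal (q.1 ^ 2) * ‖v (q.1 • q.2)‖ₑ * W q with hg
  have hfm : Measurable f := by fun_prop
  have hgm : Measurable g := by fun_prop
  set ν : Measure (ℝ × REuc n) := (volume.restrict (Icc (0 : ℝ) 1)).prod volume with hν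
  have hCS := ENNReal.lintegral_mul_le_Lp_mul_Lq ν Real.HolderConjugate.two_two
    hfm.aemeasurable hgm.aemeasurable
  have hf2 : ∫⁻ q, f q ^ (2 : ℝ) ∂ν ≤ ENNReal.ofReal (Real.pi / 2) * ∫⁻ ξ, ‖u ξ‖ₑ ^ 2 := by
    refine le_trans (le_of_eq ?_) (lintegral_mul_segmentWeight_le hu)
    rw [lintegral_prod _ (by fun_prop)]
    simp only [hf, ENNReal.rpow_two, mul_pow, hWsq]
  have hg2 : ∫⁻ q, g q ^ (2 : ℝ) ∂ν ≤ ENNReal.ofReal (Real.pi / 2) * ∫⁻ ξ, ‖v ξ‖ₑ ^ 2 := by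
    refine le_trans ?_ (lintegral_mul_segmentWeight_le hv)
    rw [lintegral_prod _ (by fun_prop)]
    have h0 : ∀ᵐ s : ℝ, s ≠ 0 := by simp [ae_iff, measure_singleton]
    refine lintegral_mono_ae ?_
    filter_upwards [ae_restrict_of_ae h0, ae_restrict_mem measurableSet_Icc] with s hs0 hs
    have hs1 : 0 < s := lt_of_le_of_ne hs.1 hs0.symm
    simp only [hg, ENNReal.rpow_two, mul_pow, hWsq]
    -- compare with the weight at the rescaled frequency `s ξ`; this is where `n ≤ 3` enters
    have hpt : ∀ ξ : REuc n, ENNReal.ofReal (s ^ 2) ^ 2 * ‖v (s • ξ)‖ₑ ^ 2 *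
        ENNReal.ofReal (segmentWeight s ‖ξ‖) ≤ ENNReal.ofReal (s ^ 3) *
        (‖v (s • ξ)‖ₑ ^ 2 * ENNReal.ofReal (segmentWeight s ‖s • ξ‖)) := by
      intro ξ
      have h1 : (s ^ 2) ^ 2 * segmentWeight s ‖ξ‖ ≤ s ^ 3 * segmentWeight s ‖s • ξ‖ := by
        rw [norm_smul, Real.norm_of_nonneg hs1.le]
        unfold segmentWeight
        have h2 : 1 + ((1 - s) * (s * ‖ξ‖)) ^ 2 ≤ 1 + ((1 - s) * ‖ξ‖) ^ 2 := by
          have h3 : s * ‖ξ‖ ≤ ‖ξ‖ := mul_le_of_le_one_left (norm_nonneg _) hs.2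
          have h4 : 0 ≤ 1 - s := by linarith [hs.2]
          gcongr
        calc (s ^ 2) ^ 2 * (‖ξ‖ / (1 + ((1 - s) * ‖ξ‖) ^ 2))
            = s ^ 3 * (s * ‖ξ‖ / (1 + ((1 - s) * ‖ξ‖) ^ 2)) := by ring
          _ ≤ _ := by gcongr
      calc _ = ‖v (s • ξ)‖ₑ ^ 2 * ENNReal.ofReal ((s ^ 2) ^ 2 * segmentWeight s ‖ξ‖) := by
            rw [ENNReal.ofReal_mul (by positivity), ENNReal.ofReal_pow (p := s ^ 2) (by positivity)]
            ring
        _ ≤ ‖v (s • ξ)‖ₑ ^ 2 * ENNReal.ofReal (s ^ 3 * segmentWeight s ‖s • ξ‖) := by gcongr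
        _ = _ := by
            rw [ENNReal.ofReal_mul (by positivity)]
            ring
    refine (lintegral_mono hpt).trans ?_
    rw [lintegral_const_mul' _ _ ENNReal.ofReal_ne_top]
    have h5 := lintegral_comp_affine hs1.ne' (0 : REuc n)
      (fun ζ => ‖v ζ‖ₑ ^ 2 * ENNReal.ofReal (segmentWeight s ‖ζ‖))
    simp only [add_zero] at h5
    rw [h5, ← mul_assoc, ← ENNReal.ofReal_mul (by positivity)]
    refine mul_le_of_le_one_left (by positivity) (ENNReal.ofReal_le_one.2 ?_)
    rw [abs_of_pos (by positivity), ← div_eq_mul_inv, div_le_one (by positivity)]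
    exact pow_le_pow_of_le_one hs1.le hs.2 hn
  have hkey : ∫⁻ q, (f * g) q ∂ν
      ≤ ENNReal.ofReal (Real.pi / 2) * (eLpNorm u 2 * eLpNorm v 2) := by
    refine hCS.trans ?_
    rw [hL2, hL2]
    calc _ ≤ (ENNReal.ofReal (Real.pi / 2) * ∫⁻ ξ, ‖u ξ‖ₑ ^ 2) ^ (1 / 2 : ℝ) *
          (ENNReal.ofReal (Real.pi / 2) * ∫⁻ ξ, ‖v ξ‖ₑ ^ 2) ^ (1 / 2 : ℝ) := by gcongr
      _ = ENNReal.ofReal (Real.pi / 2) ^ (1 / 2 : ℝ) * ENNReal.ofReal (Real.pi / 2) ^ (1 / 2 : ℝ) *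
          ((∫⁻ ξ, ‖u ξ‖ₑ ^ 2) ^ (1 / 2 : ℝ) * (∫⁻ ξ, ‖v ξ‖ₑ ^ 2) ^ (1 / 2 : ℝ)) := by
        rw [ENNReal.mul_rpow_of_nonneg _ _ (by norm_num),
          ENNReal.mul_rpow_of_nonneg _ _ (by norm_num)]
        ring
      _ = _ := by
        rw [← ENNReal.rpow_add _ _ (by simp [Real.pi_pos]) ENNReal.ofReal_ne_top]
        norm_num
  refine le_trans (le_of_eq ?_) hkey
  rw [lintegral_prod _ (by fun_prop)]
  refine lintegral_congr fun s => lintegral_congr fun ξ => ?_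
  simp only [Pi.mul_apply, hf, hg, ← hWsq (s, ξ)]
  ring

end FourierBound

section DerivativeBound

open scoped FourierTransform LineDeriv

lemma SchwartzMap.eLpNorm_fourier {n : ℕ} (f : 𝓢(REuc n, ℂ)) :
    eLpNorm (𝓕 f : 𝓢(REuc n, ℂ)) 2 = eLpNorm f 2 := by
  have h := SchwartzMap.norm_fourier_toL2_eq f
  rw [SchwartzMap.norm_toLp, SchwartzMap.norm_toLp] at h
  have h1 : MemLp (𝓕 f : 𝓢(REuc n, ℂ)) 2 := (𝓕 f : 𝓢(REuc n, ℂ)).memLp 2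
  have h2 : MemLp f 2 := f.memLp 2
  rwa [ENNReal.toReal_eq_toReal_iff' h1.2.ne h2.2.ne] at h

lemma SchwartzMap.eLpNorm_fourierInv {n : ℕ} (f : 𝓢(REuc n, ℂ)) :
    eLpNorm (𝓕⁻ f : 𝓢(REuc n, ℂ)) 2 = eLpNorm f 2 := by
  rw [← SchwartzMap.eLpNorm_fourier (𝓕⁻ f)]
  have hbb : 𝓕 (𝓕⁻ f) = f := FourierTransform.fourier_fourierInv_eq f
  rw [hbb]

lemma SchwartzMap.exists_norm_le_div {n : ℕ} (f : 𝓢(REuc n, ℂ)) :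
    ∃ C : ℝ, 0 ≤ C ∧ ∀ x, ‖f x‖ ≤ C / (1 + ‖x‖ ^ 2) := by
  obtain ⟨C, hC, h0⟩ := f.decay 0 0
  obtain ⟨C', hC', h2⟩ := f.decay 2 0
  refine ⟨C + C', by positivity, fun x => ?_⟩
  rw [le_div_iff₀ (by positivity)]
  have h3 := h0 x
  have h4 := h2 x
  simp only [norm_iteratedFDeriv_zero, pow_zero, one_mul] at h3 h4
  linarith

lemma norm_fourier_lineDeriv_le {n : ℕ} (f : 𝓢(REuc n, ℂ)) {m : REuc n} (hm : ‖m‖ ≤ 1)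
    (ξ : REuc n) : ‖(𝓕 (∂_{m} f)) ξ‖ ≤ 2 * Real.pi * (‖ξ‖ * ‖(𝓕 f) ξ‖) := by
  have htg : (inner ℝ · m : REuc n → ℝ).HasTemperateGrowth := by fun_prop
  rw [SchwartzMap.fourier_lineDerivOp_eq, smul_apply,
    SchwartzMap.smulLeftCLM_apply_apply htg, norm_smul, norm_smul]
  have h1 : ‖(2 * Real.pi * Complex.I : ℂ)‖ = 2 * Real.pi := by
    simp [abs_of_pos Real.pi_pos]
  rw [h1]
  gcongr
  refine (norm_inner_le_norm ξ m).trans ?_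
  exact mul_le_of_le_one_right (norm_nonneg _) hm

lemma enorm_mul_le_of_norm_mul_le {s K W : ℝ} {a b c d : ℂ} (hs : 0 ≤ s) (hK : 0 ≤ K)
    (h : s * (‖a‖ * (‖b‖ * ‖c‖)) ≤ K * (‖a‖ * (s ^ 2 * ‖d‖) * W)) :
    ‖(s : ℂ)‖ₑ * (‖a‖ₑ * (‖b‖ₑ * ‖c‖ₑ))
      ≤ ENNReal.ofReal K * (‖a‖ₑ * (ENNReal.ofReal (s ^ 2) * ‖d‖ₑ) * ENNReal.ofReal W) := by
  simp only [← ofReal_norm]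
  rw [Complex.norm_real, Real.norm_of_nonneg hs, ← ENNReal.ofReal_mul (norm_nonneg _),
    ← ENNReal.ofReal_mul (norm_nonneg _), ← ENNReal.ofReal_mul hs,
    ← ENNReal.ofReal_mul (by positivity), ← ENNReal.ofReal_mul (norm_nonneg _),
    ← ENNReal.ofReal_mul (by positivity), ← ENNReal.ofReal_mul hK]
  exact ENNReal.ofReal_le_ofReal h

lemma segmentForm_eq_integral_fourier {n : ℕ} (hn : n ≤ 3) (h g b : 𝓢(REuc n, ℂ)) :
    segmentForm h g b = ∫ s in Icc (0 : ℝ) 1, (s : ℂ) *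
      ∫ ξ, (𝓕⁻ b) ξ * ((𝓕 h) ((1 - s) • ξ) * (𝓕 g) (s • ξ)) := by
  have hint := integrable_segmentIntegrand hn (h := h) (g := g) (b := b) h.integrable
    (g.memLp 2) (b.memLp 2)
  rw [segmentForm, integral_prod _ hint, integral_prod_symm _ hint.integral_prod_left]
  refine integral_congr_ae (ae_of_all _ fun s => ?_)
  simp only [segmentIntegrand]
  rw [← integral_segment_eq_integral_fourier, ← integral_const_mul]
  refine integral_congr_ae (ae_of_all _ fun z => ?_)
  simp only
  rw [← integral_const_mul]
  rfl

lemma enorm_segmentForm_lineDeriv_le {n : ℕ} (hn : n ≤ 3) (h : 𝓢(REuc n, ℂ)) {m : REuc n}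
    (hm : ‖m‖ ≤ 1) {C : ℝ} (hC : 0 ≤ C) (hdec : ∀ ξ, ‖(𝓕 h) ξ‖ ≤ C / (1 + ‖ξ‖ ^ 2))
    (φ b : 𝓢(REuc n, ℂ)) :
    ‖segmentForm h (∂_{m} φ : 𝓢(REuc n, ℂ)) b‖ₑ ≤ ENNReal.ofReal (2 * Real.pi * C) *
      (ENNReal.ofReal (Real.pi / 2) * (eLpNorm b 2 * eLpNorm φ 2)) := by
  rw [segmentForm_eq_integral_fourier hn, ← SchwartzMap.eLpNorm_fourierInv b,
    ← SchwartzMap.eLpNorm_fourier φ]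
  refine (enorm_integral_le_lintegral_enorm _).trans ?_
  refine le_trans ?_ (mul_le_mul_right (lintegral_mul_dilate_segmentWeight_le hn
    (𝓕⁻ b : 𝓢(REuc n, ℂ)).continuous (𝓕 φ : 𝓢(REuc n, ℂ)).continuous) _)
  rw [← lintegral_const_mul' _ _ ENNReal.ofReal_ne_top]
  refine setLIntegral_mono' measurableSet_Icc fun s hs => ?_
  rw [enorm_mul, ← lintegral_const_mul' _ _ ENNReal.ofReal_ne_top]
  refine (mul_le_mul_right (enorm_integral_le_lintegral_enorm _) _).trans ?_
  rw [← lintegral_const_mul' _ _ enorm_ne_top]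
  refine lintegral_mono fun ξ => ?_
  rw [enorm_mul, enorm_mul]
  refine enorm_mul_le_of_norm_mul_le hs.1 (by positivity) ?_
  have h4 := norm_fourier_lineDeriv_le φ hm (s • ξ)
  have h5 := hdec ((1 - s) • ξ)
  rw [norm_smul, Real.norm_of_nonneg hs.1] at h4
  rw [norm_smul, Real.norm_of_nonneg (by linarith [hs.2])] at h5
  have hs0 := hs.1
  calc _ ≤ s * (‖(𝓕⁻ b) ξ‖ * (C / (1 + ((1 - s) * ‖ξ‖) ^ 2) *
        (2 * Real.pi * (s * ‖ξ‖ * ‖(𝓕 φ) (s • ξ)‖)))) := by gcongr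
    _ = _ := by unfold segmentWeight; ring

/-- The `L²` estimate for one derivative of the trilinear form. -/
lemma exists_segmentForm_lineDeriv_le {n : ℕ} (hn : n ≤ 3) (h : 𝓢(REuc n, ℂ)) {m : REuc n}
    (hm : ‖m‖ ≤ 1) :
    ∃ C : ℝ, 0 ≤ C ∧ ∀ φ b : 𝓢(REuc n, ℂ), ‖segmentForm h (∂_{m} φ : 𝓢(REuc n, ℂ)) b‖
      ≤ C * ((eLpNorm φ 2).toReal * (eLpNorm b 2).toReal) := by
  obtain ⟨C, hC, hdec⟩ := SchwartzMap.exists_norm_le_div (𝓕 h)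
  refine ⟨2 * Real.pi * C * (Real.pi / 2), by positivity, fun φ b => ?_⟩
  have h2 := enorm_segmentForm_lineDeriv_le hn h hm hC hdec φ b
  have hb : MemLp b 2 := b.memLp 2
  have hφ : MemLp φ 2 := φ.memLp 2
  have hfin : ENNReal.ofReal (2 * Real.pi * C) *
      (ENNReal.ofReal (Real.pi / 2) * (eLpNorm b 2 * eLpNorm φ 2)) ≠ ⊤ :=
    (ENNReal.mul_lt_top ENNReal.ofReal_lt_top (ENNReal.mul_lt_top ENNReal.ofReal_lt_top
      (ENNReal.mul_lt_top hb.2 hφ.2))).ne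
  have h6 := ENNReal.toReal_mono hfin h2
  rw [toReal_enorm] at h6
  refine h6.trans (le_of_eq ?_)
  rw [ENNReal.toReal_mul, ENNReal.toReal_mul, ENNReal.toReal_mul,
    ENNReal.toReal_ofReal (by positivity), ENNReal.toReal_ofReal (by positivity)]
  ring

lemma exists_schwartzMap_ofReal {n : ℕ} {φ : REuc n → ℝ} (hφ : ContDiff ℝ ∞ φ)
    (hc : HasCompactSupport φ) : ∃ f : 𝓢(REuc n, ℂ), ∀ x, f x = (φ x : ℂ) := by
  have h1 : HasCompactSupport fun x => (φ x : ℂ) :=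
    hc.comp_left (g := ((↑) : ℝ → ℂ)) Complex.ofReal_zero
  have h2 : ContDiff ℝ ∞ fun x => (φ x : ℂ) := Complex.ofRealCLM.contDiff.comp hφ
  exact ⟨h1.toSchwartzMap h2, fun x => rfl⟩

lemma segmentForm_ofReal {n : ℕ} (h g b : REuc n → ℝ) :
    segmentForm (fun x => (h x : ℂ)) (fun x => (g x : ℂ)) (fun x => (b x : ℂ))
      = ((segmentForm h g b : ℝ) : ℂ) := by
  unfold segmentForm
  rw [← integral_complex_ofReal]
  refine integral_congr_ae (ae_of_all _ fun q => ?_)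
  simp [segmentIntegrand]

lemma eLpNorm_complex_ofReal {n : ℕ} (f : REuc n → ℝ) (p : ENNReal) :
    eLpNorm (fun x => (f x : ℂ)) p = eLpNorm f p :=
  eLpNorm_congr_norm_ae (ae_of_all _ fun x => by simp)

lemma contDiff_fderiv_apply {n : ℕ} {φ : REuc n → ℝ} (hφ : ContDiff ℝ ∞ φ) (v : REuc n) :
    ContDiff ℝ ∞ fun x => fderiv ℝ φ x v :=
  (hφ.fderiv_right (m := ∞) (by simp)).clm_apply contDiff_const

lemma hasCompactSupport_fderiv_apply {n : ℕ} {φ : REuc n → ℝ} (hc : HasCompactSupport φ)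
    (v : REuc n) : HasCompactSupport fun x => fderiv ℝ φ x v :=
  hc.fderiv_apply ℝ v

/-- The derivative bound for real test functions, extended to all of `L²` in the last argument by
density. -/
lemma exists_segmentForm_fderiv_le {n : ℕ} (hn : n ≤ 3) {h : REuc n → ℝ} (hh : ContDiff ℝ ∞ h)
    (hc : HasCompactSupport h) {m : REuc n} (hm : ‖m‖ ≤ 1) :
    ∃ C : ℝ, 0 ≤ C ∧ ∀ φ b : REuc n → ℝ, ContDiff ℝ ∞ φ → HasCompactSupport φ → MemLp b 2 →
      |segmentForm h (fun x => fderiv ℝ φ x m) b|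
        ≤ C * ((eLpNorm φ 2).toReal * (eLpNorm b 2).toReal) := by
  obtain ⟨hS, hhS⟩ := exists_schwartzMap_ofReal hh hc
  obtain ⟨C, hC, hbound⟩ := exists_segmentForm_lineDeriv_le hn hS hm
  refine ⟨C, hC, fun φ b hφ hφc hb => ?_⟩
  obtain ⟨φS, hφS⟩ := exists_schwartzMap_ofReal hφ hφc
  have htest : ∀ f : REuc n → ℝ, ContDiff ℝ ∞ f → HasCompactSupport f →
      |segmentForm h (fun x => fderiv ℝ φ x m) f|
        ≤ C * ((eLpNorm φ 2).toReal * (eLpNorm f 2).toReal) := by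
    intro f hf hfc
    obtain ⟨fS, hfS⟩ := exists_schwartzMap_ofReal hf hfc
    have h1 := hbound φS fS
    have h2 : (∂_{m} φS : 𝓢(REuc n, ℂ)) = fun x => ((fderiv ℝ φ x m : ℝ) : ℂ) := by
      ext x
      rw [SchwartzMap.lineDerivOp_apply_eq_fderiv]
      have h3 : (φS : REuc n → ℂ) = fun x => (φ x : ℂ) := funext hφS
      have h4 : HasFDerivAt (fun x => (φ x : ℂ)) (Complex.ofRealCLM.comp (fderiv ℝ φ x)) x :=
        Complex.ofRealCLM.hasFDerivAt.comp x
          (hφ.differentiable (by simp)).differentiableAt.hasFDerivAt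
      rw [h3, h4.fderiv]
      rfl
    rw [h2, show (φS : REuc n → ℂ) = fun x => (φ x : ℂ) from funext hφS,
      show (fS : REuc n → ℂ) = fun x => (f x : ℂ) from funext hfS,
      show (hS : REuc n → ℂ) = fun x => (h x : ℂ) from funext hhS, segmentForm_ofReal,
      eLpNorm_complex_ofReal, eLpNorm_complex_ofReal, Complex.norm_real, Real.norm_eq_abs] at h1
    exact h1
  have hhi : Integrable h := hh.continuous.integrable_of_hasCompactSupport hc
  have hg2 : MemLp (fun x => fderiv ℝ φ x m) 2 :=
    (contDiff_fderiv_apply hφ m).continuous.memLp_of_hasCompactSupport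
      (hasCompactSupport_fderiv_apply hφc m)
  set a := (eLpNorm φ 2).toReal with ha
  set D := 2 * ((eLpNorm h 1).toReal * (eLpNorm (fun x => fderiv ℝ φ x m) 2).toReal) with hD
  have hlim : ∀ ε : ℝ, 0 < ε → |segmentForm h (fun x => fderiv ℝ φ x m) b|
      ≤ C * (a * (eLpNorm b 2).toReal) + (C * a + D) * ε := by
    intro ε hε
    obtain ⟨f, hfc, hf, hfε⟩ := MemLp.exist_eLpNorm_sub_le (by norm_num) (by norm_num) hb hε
    have hf2 : MemLp f 2 := hf.continuous.memLp_of_hasCompactSupport hfc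
    have hε' : (eLpNorm (b - f) 2).toReal ≤ ε := ENNReal.toReal_le_of_le_ofReal hε.le hfε
    have h1 := norm_segmentForm_le hn hhi hg2 (hb.sub hf2)
    rw [segmentForm_sub_right hn hhi hg2 hb hf2, Real.norm_eq_abs] at h1
    have h2 := htest f hf hfc
    have h3 : (eLpNorm f 2).toReal ≤ (eLpNorm b 2).toReal + ε := by
      have h4 : eLpNorm f 2 ≤ eLpNorm b 2 + eLpNorm (b - f) 2 := by
        have h5 := eLpNorm_sub_le hb.1 (hb.sub hf2).1 (p := 2) (by norm_num)
        rwa [sub_sub_cancel] at h5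
      have h6 := ENNReal.toReal_mono (ENNReal.add_lt_top.2 ⟨hb.2, (hb.sub hf2).2⟩).ne h4
      rw [ENNReal.toReal_add hb.2.ne (hb.sub hf2).2.ne] at h6
      linarith
    have h7 : |segmentForm h (fun x => fderiv ℝ φ x m) b|
        ≤ |segmentForm h (fun x => fderiv ℝ φ x m) b - segmentForm h (fun x => fderiv ℝ φ x m) f|
          + |segmentForm h (fun x => fderiv ℝ φ x m) f| := by
      have := abs_add_le (segmentForm h (fun x => fderiv ℝ φ x m) b -
        segmentForm h (fun x => fderiv ℝ φ x m) f) (segmentForm h (fun x => fderiv ℝ φ x m) f)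
      rwa [sub_add_cancel] at this
    have h8 : C * (a * (eLpNorm f 2).toReal) ≤ C * (a * ((eLpNorm b 2).toReal + ε)) := by
      gcongr
    have h9 : 2 * ((eLpNorm h 1).toReal * ((eLpNorm (fun x => fderiv ℝ φ x m) 2).toReal *
        (eLpNorm (b - f) 2).toReal)) ≤ D * ε := by
      rw [hD, mul_assoc, mul_assoc]
      gcongr
    linarith
  refine le_of_forall_pos_le_add fun δ hδ => ?_
  have hK : 0 ≤ C * a + D := by positivity
  refine (hlim (δ / (C * a + D + 1)) (by positivity)).trans ?_
  gcongr
  rw [mul_div_assoc', div_le_iff₀ (by positivity)]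
  nlinarith

end DerivativeBound

/-! ### From a weighted bound to weak derivatives -/

/-- A linear functional dominated by the norm of the image in a Hilbert space is represented by a
vector of that space. -/
lemma exists_inner_eq_of_le {V H : Type*} [AddCommGroup V] [Module ℝ V] [NormedAddCommGroup H]
    [InnerProductSpace ℝ H] [CompleteSpace H] (e : V →ₗ[ℝ] H) (l : V →ₗ[ℝ] ℝ) {C : ℝ}
    (h : ∀ v, |l v| ≤ C * ‖e v‖) : ∃ g : H, ∀ v, l v = inner ℝ g (e v) := by
  obtain ⟨f, hf, -⟩ := exists_extension_norm_eq (LinearMap.range e) (l.compLeftInverse e)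
  refine ⟨(InnerProductSpace.toDual ℝ H).symm f, fun v => ?_⟩
  rw [InnerProductSpace.toDual_symm_apply]
  have h1 := hf ⟨e v, LinearMap.mem_range_self e v⟩
  rw [h1]
  exact (LinearMap.compLeftInverse_apply_of_bdd l e ⟨C, h⟩ v _ rfl).symm

/-- The real test functions on `ℝⁿ`. -/
def testFunctions (n : ℕ) : Submodule ℝ (REuc n → ℝ) where
  carrier := {φ | ContDiff ℝ ∞ φ ∧ HasCompactSupport φ}
  add_mem' h₁ h₂ := ⟨h₁.1.add h₂.1, h₁.2.add h₂.2⟩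
  zero_mem' := ⟨contDiff_const, HasCompactSupport.zero⟩
  smul_mem' c _ h := ⟨contDiff_const.smul h.1, h.2.smul_left (f := fun _ => c)⟩

lemma memLp_weight_mul {n : ℕ} {φ : REuc n → ℝ} (hφ : Continuous φ) (hc : HasCompactSupport φ)
    (p : ENNReal) : MemLp (fun x => (1 + ‖x‖) * φ x) p :=
  (by fun_prop : Continuous fun x => (1 + ‖x‖) * φ x).memLp_of_hasCompactSupport hc.mul_left

/-- A bound on `φ ↦ ∫ f ∂ᵢφ` by a weighted `L²` norm of `φ` yields a weak partial derivative in
`L²_loc`; the weight spares a localization. -/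
lemma exists_isWeakPartial_of_le {n : ℕ} {f : REuc n → ℝ} (hf : Continuous f) (i : Fin n) {C : ℝ}
    (h : ∀ φ : REuc n → ℝ, ContDiff ℝ ∞ φ → HasCompactSupport φ →
      |∫ x, f x * fderiv ℝ φ x (EuclideanSpace.single i 1)|
        ≤ C * (eLpNorm (fun x => (1 + ‖x‖) * φ x) 2).toReal) :
    ∃ D : REuc n → ℝ, IsWeakPartial i f D ∧ MemL2Loc D := by
  let e : testFunctions n →ₗ[ℝ] Lp ℝ 2 (volume : Measure (REuc n)) :=
    { toFun := fun φ => (memLp_weight_mul φ.2.1.continuous φ.2.2 2).toLp _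
      map_add' := fun φ ψ => by
        rw [← MemLp.toLp_add, MemLp.toLp_eq_toLp_iff]
        exact ae_of_all _ fun x => by simp [mul_add]
      map_smul' := fun c φ => by
        rw [RingHom.id_apply, ← MemLp.toLp_const_smul, MemLp.toLp_eq_toLp_iff]
        exact ae_of_all _ fun x => by simp [mul_left_comm] }
  have hint : ∀ φ : testFunctions n, Integrable fun x =>
      f x * fderiv ℝ φ x (EuclideanSpace.single i 1) := by
    intro φ
    have h1 := (contDiff_fderiv_apply φ.2.1 (EuclideanSpace.single i 1)).continuous
    exact (hf.mul h1).integrable_of_hasCompactSupport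
      (hasCompactSupport_fderiv_apply φ.2.2 _).mul_left
  let l : testFunctions n →ₗ[ℝ] ℝ :=
    { toFun := fun φ => ∫ x, f x * fderiv ℝ φ x (EuclideanSpace.single i 1)
      map_add' := fun φ ψ => by
        rw [← integral_add (hint φ) (hint ψ)]
        refine integral_congr_ae (ae_of_all _ fun x => ?_)
        have h1 := (φ.2.1.differentiable (by simp)) x
        have h2 := (ψ.2.1.differentiable (by simp)) x
        simp only [Submodule.coe_add]
        rw [fderiv_add h1 h2, add_apply, mul_add]
      map_smul' := fun c φ => by
        rw [RingHom.id_apply, smul_eq_mul, ← integral_const_mul]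
        refine integral_congr_ae (ae_of_all _ fun x => ?_)
        have h1 := (φ.2.1.differentiable (by simp)) x
        simp only [Submodule.coe_smul]
        rw [fderiv_const_smul h1, smul_apply, smul_eq_mul]
        ring }
  obtain ⟨g, hg⟩ := exists_inner_eq_of_le e l (C := C) fun φ => by
    have h1 := h φ φ.2.1 φ.2.2
    simpa only [e, l, LinearMap.coe_mk, AddHom.coe_mk, Lp.norm_toLp] using h1
  have hgm : MemLp g 2 := Lp.memLp g
  have hD : MemL2Loc fun x => -((1 + ‖x‖) * g x) := by
    intro K hK
    obtain ⟨M, hM⟩ := hK.isBounded.exists_norm_le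
    refine (hgm.restrict K).of_le_mul (c := 1 + M) ?_ ?_
    · exact ((by fun_prop : Continuous fun x : REuc n => 1 + ‖x‖).aestronglyMeasurable.mul
        hgm.1).neg.restrict
    · filter_upwards [ae_restrict_mem hK.measurableSet] with x hx
      rw [norm_neg, norm_mul, Real.norm_of_nonneg (by positivity)]
      gcongr
      exact hM x hx
  refine ⟨_, ⟨hf.locallyIntegrable, ?_, fun φ hφ hc => ?_⟩, hD⟩
  · rw [locallyIntegrable_iff]
    intro K hK
    have : IsFiniteMeasure (volume.restrict K) := ⟨by simpa using hK.measure_lt_top⟩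
    exact (hD K hK).integrable (by norm_num)
  · have h1 := hg ⟨φ, hφ, hc⟩
    rw [L2.inner_def] at h1
    simp only [e, l, LinearMap.coe_mk, AddHom.coe_mk] at h1
    rw [h1, ← integral_neg]
    refine integral_congr_ae ?_
    filter_upwards [(memLp_weight_mul hφ.continuous hc 2).coeFn_toLp] with x hx
    rw [hx]
    simp
    ring

lemma cross_apply_eq_sum {n : ℕ} {F : Type*} [NormedAddCommGroup F]
    [NormedSpace ℝ F] (Λ : REuc n →L[ℝ] F →L[ℝ] REuc n) (v : REuc n) (w : F) (k : Fin n) :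
    Λ v w k = ∑ j, v j * Λ (EuclideanSpace.single j 1) w k := by
  have h1 : v = ∑ j, v j • EuclideanSpace.single j (1 : ℝ) := by
    have := (EuclideanSpace.basisFun (Fin n) ℝ).sum_repr v
    simpa using this.symm
  conv_lhs => rw [h1]
  simp [map_sum]

/-- The coefficient field `y ↦ (eⱼ × B(y))ₖ`. -/
noncomputable def crossCoeff {n : ℕ} {F : Type*} [NormedAddCommGroup F]
    [NormedSpace ℝ F] (Λ : REuc n →L[ℝ] F →L[ℝ] REuc n) (B : REuc n → F) (j k : Fin n)
    (y : REuc n) : ℝ := Λ (EuclideanSpace.single j 1) (B y) k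

lemma memLp_crossCoeff {n : ℕ} {F : Type*} [NormedAddCommGroup F]
    [NormedSpace ℝ F] (Λ : REuc n →L[ℝ] F →L[ℝ] REuc n) {B : REuc n → F} {p : ENNReal}
    (hB : MemLp B p) (j k : Fin n) : MemLp (crossCoeff Λ B j k) p :=
  ((EuclideanSpace.proj k : REuc n →L[ℝ] ℝ) ∘L Λ (EuclideanSpace.single j 1)).comp_memLp' hB

lemma mul_griesingerIntegrand_apply {n : ℕ} {F : Type*} [NormedAddCommGroup F]
    [NormedSpace ℝ F] (Λ : REuc n →L[ℝ] F →L[ℝ] REuc n) (h g : REuc n → ℝ) (B : REuc n → F)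
    (k : Fin n) (q : (REuc n × ℝ) × REuc n) :
    g q.2 * griesingerIntegrand (fun v w => Λ v w) h B q.2 q.1 k
      = ∑ j, (segmentIntegrand h (fun x => x j * g x) (crossCoeff Λ B j k) q
          - segmentIntegrand (fun z => z j * h z) g (crossCoeff Λ B j k) q) := by
  simp only [griesingerIntegrand, PiLp.smul_apply, smul_eq_mul, map_smul]
  rw [cross_apply_eq_sum, Finset.mul_sum, Finset.mul_sum, Finset.mul_sum]
  refine Finset.sum_congr rfl fun j _ => ?_
  simp only [segmentIntegrand, crossCoeff, PiLp.sub_apply, RCLike.ofReal_real_eq_id, id]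
  ring

/-- The pairing of a component of the Griesinger gauge with a test function, as one absolutely
convergent integral and as a sum of trilinear forms. -/
lemma integral_griesinger_apply_mul {n : ℕ} (hn : n ≤ 3) {F : Type*} [NormedAddCommGroup F]
    [NormedSpace ℝ F] (Λ : REuc n →L[ℝ] F →L[ℝ] REuc n) {h : REuc n → ℝ} (hh : Continuous h)
    (hc : HasCompactSupport h) {B : REuc n → F}
    (hconv : GriesingerConverges (fun v w => Λ v w) h B) (hB : MemLp B 2)
    {g : REuc n → ℝ} (hg : Continuous g) (hgc : HasCompactSupport g) (k : Fin n) :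
    Integrable (fun q : (REuc n × ℝ) × REuc n =>
      g q.2 * griesingerIntegrand (fun v w => Λ v w) h B q.2 q.1 k) (segmentMeasure n) ∧
    ∫ x, griesinger (fun v w => Λ v w) h B x k * g x
      = -∫ q, g q.2 * griesingerIntegrand (fun v w => Λ v w) h B q.2 q.1 k ∂(segmentMeasure n) ∧
    ∫ x, griesinger (fun v w => Λ v w) h B x k * g x
      = -∑ j, (segmentForm h (fun x => x j * g x) (crossCoeff Λ B j k)
          - segmentForm (fun z => z j * h z) g (crossCoeff Λ B j k)) := by
  have hhi : Integrable h := hh.integrable_of_hasCompactSupport hc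
  have hzi : ∀ j : Fin n, Integrable fun z => z j * h z := fun j =>
    (by fun_prop : Continuous fun z : REuc n => z j * h z).integrable_of_hasCompactSupport
      hc.mul_left
  have hg2 : MemLp g 2 := hg.memLp_of_hasCompactSupport hgc
  have hxg : ∀ j : Fin n, MemLp (fun x => x j * g x) 2 := fun j =>
    (by fun_prop : Continuous fun z : REuc n => z j * g z).memLp_of_hasCompactSupport
      hgc.mul_left
  have hi1 : ∀ j, Integrable (segmentIntegrand h (fun x => x j * g x) (crossCoeff Λ B j k))
      (segmentMeasure n) := fun j =>
    integrable_segmentIntegrand hn hhi (hxg j) (memLp_crossCoeff Λ hB j k)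
  have hi2 : ∀ j, Integrable (segmentIntegrand (fun z => z j * h z) g (crossCoeff Λ B j k))
      (segmentMeasure n) := fun j =>
    integrable_segmentIntegrand hn (hzi j) hg2 (memLp_crossCoeff Λ hB j k)
  have hint : Integrable (fun q : (REuc n × ℝ) × REuc n =>
      g q.2 * griesingerIntegrand (fun v w => Λ v w) h B q.2 q.1 k) (segmentMeasure n) := by
    simp_rw [mul_griesingerIntegrand_apply]
    exact integrable_finsetSum _ fun j _ => (hi1 j).sub (hi2 j)
  have heq : ∫ x, griesinger (fun v w => Λ v w) h B x k * g x
      = -∫ q, g q.2 * griesingerIntegrand (fun v w => Λ v w) h B q.2 q.1 k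
          ∂(segmentMeasure n) := by
    rw [integral_prod_symm _ hint, ← integral_neg]
    refine integral_congr_ae (ae_of_all _ fun x => ?_)
    simp only
    have hx : Integrable (griesingerIntegrand (fun v w => Λ v w) h B x)
        (volume.prod (volume.restrict (Icc (0 : ℝ) 1))) := by
      have h1 := hconv x
      rwa [IntegrableOn, prod_restrict_Icc_eq] at h1
    rw [griesinger_eq_neg_integral_prod hconv, integral_const_mul, PiLp.neg_apply]
    have h2 : ∫ q, griesingerIntegrand (fun v w => Λ v w) h B x q k
          ∂(volume.prod (volume.restrict (Icc (0 : ℝ) 1)))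
        = (∫ q, griesingerIntegrand (fun v w => Λ v w) h B x q
          ∂(volume.prod (volume.restrict (Icc (0 : ℝ) 1)))) k :=
      (EuclideanSpace.proj k : REuc n →L[ℝ] ℝ).integral_comp_comm hx
    rw [h2]
    ring
  refine ⟨hint, heq, ?_⟩
  rw [heq]
  simp_rw [mul_griesingerIntegrand_apply]
  have hsum := integral_finsetSum Finset.univ
    (f := fun j q => segmentIntegrand h (fun x => x j * g x) (crossCoeff Λ B j k) q
      - segmentIntegrand (fun z => z j * h z) g (crossCoeff Λ B j k) q)
    (fun j _ => (hi1 j).sub (hi2 j))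
  rw [hsum]
  congr 1
  refine Finset.sum_congr rfl fun j _ => ?_
  exact integral_sub (hi1 j) (hi2 j)

lemma fderiv_coord_mul {n : ℕ} {φ : REuc n → ℝ} (hφ : ContDiff ℝ ∞ φ) (i j : Fin n)
    (x : REuc n) :
    fderiv ℝ (fun y => y j * φ y) x (EuclideanSpace.single i 1)
      = x j * fderiv ℝ φ x (EuclideanSpace.single i 1) + (if i = j then 1 else 0) * φ x := by
  have h1 : HasFDerivAt (fun y : REuc n => y j) (EuclideanSpace.proj j : REuc n →L[ℝ] ℝ) x :=
    (EuclideanSpace.proj j : REuc n →L[ℝ] ℝ).hasFDerivAt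
  have h2 := (hφ.differentiable (by simp) x).hasFDerivAt
  have h3 : fderiv ℝ (fun y => y j * φ y) x = _ := (h1.mul h2).fderiv
  rw [h3]
  by_cases hij : i = j
  · subst hij
    simp
  · simp [hij, Ne.symm hij]

lemma contDiff_coord_mul {n : ℕ} {φ : REuc n → ℝ} (hφ : ContDiff ℝ ∞ φ) (j : Fin n) :
    ContDiff ℝ ∞ fun y : REuc n => y j * φ y :=
  (EuclideanSpace.proj j : REuc n →L[ℝ] ℝ).contDiff.mul hφ

/-- The Griesinger gauge of a square integrable field has weak derivatives in `L²_loc`. -/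
lemma exists_isWeakJacobian_griesinger {n : ℕ} (hn : n ≤ 3) {F : Type*} [NormedAddCommGroup F]
    [NormedSpace ℝ F] (Λ : REuc n →L[ℝ] F →L[ℝ] REuc n) {h : REuc n → ℝ} (hh : ContDiff ℝ ∞ h)
    (hc : HasCompactSupport h) {B : REuc n → F}
    (hconv : GriesingerConverges (fun v w => Λ v w) h B)
    (hcont : Continuous (griesinger (fun v w => Λ v w) h B)) (hB : MemLp B 2) :
    ∃ D : Fin n → Fin n → REuc n → ℝ,
      IsWeakJacobian (griesinger (fun v w => Λ v w) h B) D ∧ ∀ i k, MemL2Loc (D i k) := by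
  suffices H : ∀ i k, ∃ D : REuc n → ℝ,
      IsWeakPartial i (fun x => griesinger (fun v w => Λ v w) h B x k) D ∧ MemL2Loc D by
    choose D hD using H
    exact ⟨D, fun i k => (hD i k).1, fun i k => (hD i k).2⟩
  intro i k
  have hm : ‖EuclideanSpace.single i (1 : ℝ)‖ ≤ 1 := by simp
  have hhi : Integrable h := hh.continuous.integrable_of_hasCompactSupport hc
  obtain ⟨C, hC, hCle⟩ := exists_segmentForm_fderiv_le hn hh hc hm
  choose C' hC' hCle' using fun j : Fin n =>
    exists_segmentForm_fderiv_le hn (contDiff_coord_mul hh j) hc.mul_left hm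
  have hb := fun j => memLp_crossCoeff Λ hB j k
  refine exists_isWeakPartial_of_le
    (C := ∑ j, (C + 2 * (eLpNorm h 1).toReal + C' j) * (eLpNorm (crossCoeff Λ B j k) 2).toReal)
    (by fun_prop) i fun φ hφ hφc => ?_
  have hgc := hasCompactSupport_fderiv_apply hφc (EuclideanSpace.single i 1)
  have hgs := contDiff_fderiv_apply hφ (EuclideanSpace.single i 1)
  obtain ⟨-, -, heq⟩ := integral_griesinger_apply_mul hn Λ hh.continuous hc hconv hB
    hgs.continuous hgc k
  rw [heq, abs_neg, Finset.sum_mul]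
  refine (Finset.abs_sum_le_sum_abs _ _).trans (Finset.sum_le_sum fun j _ => ?_)
  have hφ2 : MemLp φ 2 := hφ.continuous.memLp_of_hasCompactSupport hφc
  set N := (eLpNorm (fun x => (1 + ‖x‖) * φ x) 2).toReal with hN
  have hle : ∀ f : REuc n → ℝ, (∀ x, |f x| ≤ (1 + ‖x‖) * |φ x|) → (eLpNorm f 2).toReal ≤ N := by
    intro f hf
    refine ENNReal.toReal_mono (memLp_weight_mul hφ.continuous hφc 2).2.ne ?_
    refine eLpNorm_mono fun x => ?_
    rw [norm_mul, Real.norm_of_nonneg (by positivity : 0 ≤ 1 + ‖x‖)]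
    exact hf x
  have hxφ : ContDiff ℝ ∞ fun x => x j * φ x := contDiff_coord_mul hφ j
  have hδ2 : MemLp (fun x => (if i = j then 1 else 0) * φ x) 2 := hφ2.const_mul _
  have h1 : segmentForm h (fun x => x j * fderiv ℝ φ x (EuclideanSpace.single i 1))
        (crossCoeff Λ B j k)
      = segmentForm h (fun x => fderiv ℝ (fun y => y j * φ y) x (EuclideanSpace.single i 1))
          (crossCoeff Λ B j k)
        - segmentForm h (fun x => (if i = j then 1 else 0) * φ x) (crossCoeff Λ B j k) := by
    rw [← segmentForm_sub_middle hn hhi _ hδ2 (hb j)]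
    · congr 1
      ext x
      rw [Pi.sub_apply, fderiv_coord_mul hφ]
      ring
    · exact (contDiff_fderiv_apply hxφ _).continuous.memLp_of_hasCompactSupport
        (hasCompactSupport_fderiv_apply hφc.mul_left _)
  have h2 := hCle _ _ hxφ hφc.mul_left (hb j)
  have h3 := norm_segmentForm_le hn hhi hδ2 (hb j)
  have h4 := hCle' j _ _ hφ hφc (hb j)
  rw [Real.norm_eq_abs] at h3
  have hb0 : 0 ≤ (eLpNorm (crossCoeff Λ B j k) 2).toReal := ENNReal.toReal_nonneg
  have hN1 : (eLpNorm (fun x => x j * φ x) 2).toReal ≤ N := hle _ fun x => by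
    rw [abs_mul]
    gcongr
    have := PiLp.norm_apply_le x j
    rw [Real.norm_eq_abs] at this
    linarith
  have hN2 : (eLpNorm (fun x => (if i = j then 1 else 0) * φ x) 2).toReal ≤ N := hle _ fun x => by
    rw [abs_mul]
    gcongr
    split_ifs <;> simp
    positivity
  have hN3 : (eLpNorm φ 2).toReal ≤ N := hle _ fun x => by
    nlinarith [norm_nonneg x, abs_nonneg (φ x)]
  have h5 : C * ((eLpNorm (fun x => x j * φ x) 2).toReal *
      (eLpNorm (crossCoeff Λ B j k) 2).toReal)
      ≤ C * (N * (eLpNorm (crossCoeff Λ B j k) 2).toReal) := by gcongr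
  have h6 : 2 * ((eLpNorm h 1).toReal *
      ((eLpNorm (fun x => (if i = j then 1 else 0) * φ x) 2).toReal *
        (eLpNorm (crossCoeff Λ B j k) 2).toReal))
      ≤ 2 * ((eLpNorm h 1).toReal * (N * (eLpNorm (crossCoeff Λ B j k) 2).toReal)) := by gcongr
  have h7 : C' j * ((eLpNorm φ 2).toReal * (eLpNorm (crossCoeff Λ B j k) 2).toReal)
      ≤ C' j * (N * (eLpNorm (crossCoeff Λ B j k) 2).toReal) := by
    have := hC' j
    gcongr
  rw [h1]
  refine (abs_sub _ _).trans ((add_le_add_left (abs_sub _ _) _).trans ?_)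
  linarith

/-! ### The curl: integration along rays -/

/-- Minus the divergence-type expression `m φ + (x - z) · ∇φ`: up to a power of `s`, the
`s`-derivative of the dilates of `φ` about `z`. -/
noncomputable def radialTest {n : ℕ} (m : ℕ) (φ : REuc n → ℝ) (z x : REuc n) : ℝ :=
  -(m * φ x) - fderiv ℝ φ x (x - z)

lemma continuous_radialTest {n : ℕ} (m : ℕ) {φ : REuc n → ℝ} (hφ : ContDiff ℝ ∞ φ) :
    Continuous fun p : REuc n × REuc n => radialTest m φ p.1 p.2 := by
  unfold radialTest
  have h1 := hφ.continuous
  have h2 := hφ.continuous_fderiv (by simp)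
  fun_prop

lemma exists_radialTest_eq_zero {n : ℕ} (m : ℕ) {φ : REuc n → ℝ}
    (hc : HasCompactSupport φ) (z : REuc n) :
    ∃ R : ℝ, 0 < R ∧ ∀ x, R < ‖x - z‖ → φ x = 0 ∧ radialTest m φ z x = 0 := by
  obtain ⟨R, hR⟩ := hc.isCompact.isBounded.exists_norm_le
  refine ⟨max (R + ‖z‖) 1, by positivity, fun x hx => ?_⟩
  have h1 : x ∉ tsupport φ := by
    intro hmem
    have h2 := hR x hmem
    have h3 := norm_sub_le x z
    have h4 := (le_max_left (R + ‖z‖) 1).trans_lt hx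
    linarith
  have h5 : φ x = 0 := image_eq_zero_of_notMem_tsupport h1
  have h6 : fderiv ℝ φ x = 0 := by
    have h7 : x ∉ tsupport (fderiv ℝ φ) := fun hmem => h1 (tsupport_fderiv_subset ℝ hmem)
    exact image_eq_zero_of_notMem_tsupport h7
  refine ⟨h5, ?_⟩
  simp [radialTest, h5, h6]

lemma hasCompactSupport_radialTest {n : ℕ} (m : ℕ) {φ : REuc n → ℝ}
    (hc : HasCompactSupport φ) (z : REuc n) : HasCompactSupport (radialTest m φ z) := by
  obtain ⟨R, hR, h⟩ := exists_radialTest_eq_zero m hc z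
  refine HasCompactSupport.of_support_subset_isCompact (isCompact_closedBall z R) fun x hx => ?_
  by_contra hx'
  exact hx (h x (by simpa [dist_eq_norm] using hx')).2

lemma hasDerivAt_dilate {n : ℕ} (m : ℕ) {φ : REuc n → ℝ} (hφ : ContDiff ℝ ∞ φ)
    (z y : REuc n) {s : ℝ} (hs : 0 < s) :
    HasDerivAt (fun s : ℝ => s⁻¹ ^ m * φ (s⁻¹ • (y - z) + z))
      (s⁻¹ ^ (m + 1) * radialTest m φ z (s⁻¹ • (y - z) + z)) s := by
  have h1 : HasDerivAt (fun s : ℝ => s⁻¹) (-(s ^ 2)⁻¹) s := hasDerivAt_inv hs.ne'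
  have h2 : HasDerivAt (fun s : ℝ => s⁻¹ • (y - z) + z) (-(s ^ 2)⁻¹ • (y - z)) s :=
    (h1.smul_const (y - z)).add_const z
  have h3 : HasDerivAt (fun s : ℝ => φ (s⁻¹ • (y - z) + z))
      (fderiv ℝ φ (s⁻¹ • (y - z) + z) (-(s ^ 2)⁻¹ • (y - z))) s :=
    ((hφ.differentiable (by simp) _).hasFDerivAt).comp_hasDerivAt s h2
  refine ((h1.fun_pow m).mul h3).congr_deriv ?_
  rw [radialTest, add_sub_cancel_right, map_smul, map_smul, smul_eq_mul, smul_eq_mul]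
  rw [← inv_pow]
  generalize s⁻¹ = t
  rcases m with _ | m
  · simp
    ring
  · simp only [Nat.add_sub_cancel]
    push_cast
    ring

/-- Integrating the dilates along a ray recovers the test function. -/
lemma integral_dilate_radialTest {n : ℕ} (m : ℕ) {φ : REuc n → ℝ} (hφ : ContDiff ℝ ∞ φ)
    (hc : HasCompactSupport φ) {z y : REuc n} (hyz : y ≠ z) :
    ∫ s in Icc (0 : ℝ) 1, s⁻¹ ^ (m + 1) * radialTest m φ z (s⁻¹ • (y - z) + z) = φ y := by
  obtain ⟨R, hR, hzero⟩ := exists_radialTest_eq_zero m hc z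
  have hd : 0 < ‖y - z‖ := norm_pos_iff.2 (sub_ne_zero.2 hyz)
  -- below `δ` the dilated argument has left the support of `φ`
  set δ : ℝ := min 1 (‖y - z‖ / (2 * R)) with hδ
  have hδ0 : 0 < δ := by positivity
  have hδ1 : δ ≤ 1 := min_le_left _ _
  have hfar : ∀ s, 0 < s → s ≤ δ → R < ‖s⁻¹ • (y - z) + z - z‖ := by
    intro s hs hsδ
    rw [add_sub_cancel_right, norm_smul, norm_inv, Real.norm_of_nonneg hs.le,
      ← div_eq_inv_mul, lt_div_iff₀ hs]
    have h1 : s ≤ ‖y - z‖ / (2 * R) := hsδ.trans (min_le_right _ _)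
    rw [le_div_iff₀ (by positivity)] at h1
    linarith [mul_pos hs hR]
  have hcont : ContinuousOn (fun s : ℝ => s⁻¹ ^ (m + 1) *
      radialTest m φ z (s⁻¹ • (y - z) + z)) (Icc δ 1) := by
    have h1 : ContinuousOn (fun s : ℝ => s⁻¹) (Icc δ 1) :=
      continuousOn_inv₀.mono fun s hs => (hδ0.trans_le hs.1).ne'
    have h2 : Continuous fun x => radialTest m φ z x :=
      (continuous_radialTest m hφ).comp (by fun_prop : Continuous fun x : REuc n => (z, x))
    exact (h1.pow _).mul (h2.comp_continuousOn ((h1.smul continuousOn_const).add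
      continuousOn_const))
  have hzero' : ∀ s ∈ Ioc (0 : ℝ) δ, s⁻¹ ^ (m + 1) *
      radialTest m φ z (s⁻¹ • (y - z) + z) = 0 := fun s hs => by
    rw [(hzero _ (hfar s hs.1 hs.2)).2, mul_zero]
  have hint1 : IntegrableOn (fun s : ℝ => s⁻¹ ^ (m + 1) *
      radialTest m φ z (s⁻¹ • (y - z) + z)) (Ioc 0 δ) :=
    integrableOn_zero.congr_fun (fun s hs => (hzero' s hs).symm) measurableSet_Ioc
  have hint2 : IntegrableOn (fun s : ℝ => s⁻¹ ^ (m + 1) *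
      radialTest m φ z (s⁻¹ • (y - z) + z)) (Ioc δ 1) :=
    hcont.integrableOn_Icc.mono_set Ioc_subset_Icc_self
  rw [integral_Icc_eq_integral_Ioc, ← Ioc_union_Ioc_eq_Ioc hδ0.le hδ1,
    setIntegral_union (Ioc_disjoint_Ioc_of_le le_rfl) measurableSet_Ioc hint1 hint2,
    setIntegral_eq_zero_of_forall_eq_zero hzero', zero_add,
    ← intervalIntegral.integral_of_le hδ1,
    intervalIntegral.integral_eq_sub_of_hasDerivAt
      (f := fun s : ℝ => s⁻¹ ^ m * φ (s⁻¹ • (y - z) + z))]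
  · rw [(hzero _ (hfar δ hδ0 le_rfl)).1]
    simp
  · intro s hs
    rw [uIcc_of_le hδ1] at hs
    exact hasDerivAt_dilate m hφ z y (hδ0.trans_le hs.1)
  · rw [← uIcc_of_le hδ1] at hcont
    exact hcont.intervalIntegrable

lemma inv_smul_segment_sub {n : ℕ} {s : ℝ} (hs : s ≠ 0) (x z : REuc n) :
    s⁻¹ • (s • x + (1 - s) • z - z) + z = x := by
  have h1 : s • x + (1 - s) • z - z = s • (x - z) := by module
  rw [h1, smul_smul, inv_mul_cancel₀ hs, one_smul, sub_add_cancel]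

/-- For a fixed base point `z`: the `s`-integral of the pairings of `b` along the segments towards
`z` with the radial test function is the pairing of `b` with `φ`. -/
lemma integral_segment_radialTest {m : ℕ} (hm : m ≤ 1) {b φ : REuc (m + 2) → ℝ}
    (hb : MemLp b 2) (hφ : ContDiff ℝ ∞ φ) (hc : HasCompactSupport φ) (z : REuc (m + 2)) :
    ∫ s in Icc (0 : ℝ) 1, ∫ x, s * (b (s • x + (1 - s) • z) * radialTest m φ z x)
      = ∫ y, b y * φ y := by
  have hψ : Continuous (radialTest m φ z) :=
    (continuous_radialTest m hφ).comp (by fun_prop : Continuous fun x : REuc (m + 2) => (z, x))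
  have hψ2 : MemLp (radialTest m φ z) 2 :=
    hψ.memLp_of_hasCompactSupport (hasCompactSupport_radialTest m hc z)
  set K : ℝ → REuc (m + 2) → ℝ := fun s y =>
    s⁻¹ ^ (m + 1) * radialTest m φ z (s⁻¹ • (y - z) + z) with hK
  have h0 : ∀ᵐ s : ℝ, s ≠ 0 := by simp [ae_iff, measure_singleton]
  have hchange : ∀ s : ℝ, 0 < s → ∫ x, s * (b (s • x + (1 - s) • z) * radialTest m φ z x)
      = ∫ y, b y * K s y := by
    intro s hs
    have h1 := integral_comp_affine hs.ne' ((1 - s) • z)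
      (fun y => b y * radialTest m φ z (s⁻¹ • (y - z) + z))
    simp only [inv_smul_segment_sub hs.ne'] at h1
    rw [integral_const_mul, h1, smul_eq_mul, ← mul_assoc, ← integral_const_mul]
    refine integral_congr_ae (ae_of_all _ fun y => ?_)
    have hsc : s * |(s ^ (m + 2))⁻¹| = s⁻¹ ^ (m + 1) := by
      have h2 : s ^ (m + 2) = s * s ^ (m + 1) := by ring
      rw [abs_of_pos (by positivity), h2, mul_inv, mul_inv_cancel_left₀ hs.ne', inv_pow]
    simp only [hK]
    rw [hsc]
    ring
  have hmeas : AEStronglyMeasurable (Function.uncurry fun s y => b y * K s y)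
      ((volume.restrict (Icc (0 : ℝ) 1)).prod volume) := by
    refine hb.1.comp_snd.mul ?_
    have h2 : Measurable (radialTest m φ z) := hψ.measurable
    have : Measurable (Function.uncurry K) := by
      simp only [hK, Function.uncurry_def]
      fun_prop
    exact this.aestronglyMeasurable
  have hint : Integrable (Function.uncurry fun s y => b y * K s y)
      ((volume.restrict (Icc (0 : ℝ) 1)).prod volume) := by
    refine ⟨hmeas, ?_⟩
    rw [HasFiniteIntegral, lintegral_prod _ hmeas.enorm]
    refine lt_of_le_of_lt (b := ∫⁻ s in Icc (0 : ℝ) 1, ENNReal.ofReal (s ^ (-(1 / 2) : ℝ)) *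
      (eLpNorm (radialTest m φ z) 2 * eLpNorm b 2)) ?_ ?_
    · refine lintegral_mono_ae ?_
      filter_upwards [ae_restrict_of_ae h0, ae_restrict_mem measurableSet_Icc] with s hs0 hs
      have hs1 : 0 < s := lt_of_le_of_ne hs.1 hs0.symm
      have h1 := lintegral_comp_affine hs1.ne' ((1 - s) • z)
        (fun y => ‖radialTest m φ z (s⁻¹ • (y - z) + z)‖ₑ * ‖b y‖ₑ)
      simp only [inv_smul_segment_sub hs1.ne'] at h1
      have h2 := lintegral_mul_comp_affine_le hs1 ((1 - s) • z) 2 2 hψ2.1 hb.1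
      rw [h1] at h2
      have h3 : ∫⁻ y, ‖b y * K s y‖ₑ = ENNReal.ofReal s * (ENNReal.ofReal |(s ^ (m + 2))⁻¹| *
          ∫⁻ y, ‖radialTest m φ z (s⁻¹ • (y - z) + z)‖ₑ * ‖b y‖ₑ) := by
        rw [← lintegral_const_mul' _ _ ENNReal.ofReal_ne_top,
          ← lintegral_const_mul' _ _ ENNReal.ofReal_ne_top]
        refine lintegral_congr fun y => ?_
        rw [← mul_assoc (ENNReal.ofReal s), ← ENNReal.ofReal_mul hs1.le]
        simp only [hK, enorm_mul]
        have h4 : ‖s⁻¹ ^ (m + 1)‖ₑ = ENNReal.ofReal (s * |(s ^ (m + 2))⁻¹|) := by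
          rw [← ofReal_norm, Real.norm_of_nonneg (by positivity), abs_of_pos (by positivity)]
          have h5 : s ^ (m + 2) = s * s ^ (m + 1) := by ring
          rw [h5, mul_inv, mul_inv_cancel_left₀ hs1.ne', inv_pow]
        rw [h4]
        ring
      simp only [Function.uncurry_apply_pair]
      rw [h3]
      refine (mul_le_mul_right h2 _).trans ?_
      have h5 : ENNReal.ofReal s * ENNReal.ofReal
          (s ^ (-(((m + 2 : ℕ) : ℝ) * (1 / 2 : ENNReal).toReal)))
          ≤ ENNReal.ofReal (s ^ (-(1 / 2) : ℝ)) := by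
        rw [← ENNReal.ofReal_mul hs1.le]
        refine ENNReal.ofReal_le_ofReal ?_
        nth_rewrite 1 [← Real.rpow_one s]
        rw [← Real.rpow_add hs1]
        refine Real.rpow_le_rpow_of_exponent_ge hs1 hs.2 ?_
        have : (m : ℝ) ≤ 1 := by exact_mod_cast hm
        norm_num
        linarith
      calc _ = (ENNReal.ofReal s * ENNReal.ofReal
            (s ^ (-(((m + 2 : ℕ) : ℝ) * (1 / 2 : ENNReal).toReal)))) *
            (eLpNorm (radialTest m φ z) 2 * eLpNorm b 2) := by ring
        _ ≤ _ := by gcongr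
    · rw [lintegral_mul_const' _ _ (ENNReal.mul_lt_top hψ2.2 hb.2).ne]
      refine ENNReal.mul_lt_top ?_ (ENNReal.mul_lt_top hψ2.2 hb.2)
      have hi : IntegrableOn (fun s : ℝ => s ^ (-(1 / 2) : ℝ)) (Icc 0 1) := by
        rw [integrableOn_Icc_iff_integrableOn_Ioc]
        exact (intervalIntegrable_iff_integrableOn_Ioc_of_le zero_le_one).1
          (intervalIntegral.intervalIntegrable_rpow' (by norm_num))
      exact hi.lintegral_lt_top
  calc _ = ∫ s in Icc (0 : ℝ) 1, ∫ y, b y * K s y := by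
        refine integral_congr_ae ?_
        filter_upwards [ae_restrict_of_ae h0, ae_restrict_mem measurableSet_Icc] with s hs0 hs
        exact hchange s (lt_of_le_of_ne hs.1 hs0.symm)
    _ = ∫ y, ∫ s in Icc (0 : ℝ) 1, b y * K s y := integral_integral_swap hint
    _ = _ := by
        have h6 : ∀ᵐ y : REuc (m + 2), y ≠ z := by simp [ae_iff, measure_singleton]
        refine integral_congr_ae ?_
        filter_upwards [h6] with y hy
        rw [integral_const_mul, integral_dilate_radialTest m hφ hc hy]

lemma clm_apply_eq_sum {n : ℕ} (L : REuc n →L[ℝ] ℝ) (v : REuc n) :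
    L v = ∑ j, v j * L (EuclideanSpace.single j 1) := by
  have h1 : v = ∑ j, v j • EuclideanSpace.single j (1 : ℝ) := by
    have := (EuclideanSpace.basisFun (Fin n) ℝ).sum_repr v
    simpa using this.symm
  conv_lhs => rw [h1]
  simp [map_sum]

/-- Averaging `integral_segment_radialTest` over base points with total weight one. -/
lemma integral_segmentMeasure_radialTest {m : ℕ} (hm : m ≤ 1) {h b φ : REuc (m + 2) → ℝ}
    (hh : Continuous h) (hhc : HasCompactSupport h) (hh1 : ∫ x, h x = 1)
    (hb : MemLp b 2) (hφ : ContDiff ℝ ∞ φ) (hc : HasCompactSupport φ) :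
    Integrable (fun q : (REuc (m + 2) × ℝ) × REuc (m + 2) => h q.1.1 * (q.1.2 *
      (b (q.1.2 • q.2 + (1 - q.1.2) • q.1.1) * radialTest m φ q.1.1 q.2)))
      (segmentMeasure (m + 2)) ∧
    ∫ q, h q.1.1 * (q.1.2 *
      (b (q.1.2 • q.2 + (1 - q.1.2) • q.1.1) * radialTest m φ q.1.1 q.2)) ∂(segmentMeasure (m + 2))
      = ∫ y, b y * φ y := by
  have hn : m + 2 ≤ 3 := by omega
  have hhi : Integrable h := hh.integrable_of_hasCompactSupport hhc
  have hint : Integrable (fun q : (REuc (m + 2) × ℝ) × REuc (m + 2) => h q.1.1 * (q.1.2 *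
      (b (q.1.2 • q.2 + (1 - q.1.2) • q.1.1) * radialTest m φ q.1.1 q.2)))
      (segmentMeasure (m + 2)) := by
    have hφ' := hφ.continuous_fderiv (by simp)
    have hφc' : HasCompactSupport (fderiv ℝ φ) := hc.fderiv ℝ
    have h0 : MemLp (radialTest m φ 0) 2 :=
      ((continuous_radialTest m hφ).comp (by fun_prop :
        Continuous fun x : REuc (m + 2) => ((0 : REuc (m + 2)), x))).memLp_of_hasCompactSupport
        (hasCompactSupport_radialTest m hc 0)
    have hj : ∀ j : Fin (m + 2), MemLp (fun x => fderiv ℝ φ x (EuclideanSpace.single j 1)) 2 :=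
      fun j => (contDiff_fderiv_apply hφ _).continuous.memLp_of_hasCompactSupport
        (hasCompactSupport_fderiv_apply hc _)
    have hzj : ∀ j : Fin (m + 2), Integrable fun z : REuc (m + 2) => z j * h z := fun j =>
      (by fun_prop : Continuous fun z : REuc (m + 2) => z j * h z).integrable_of_hasCompactSupport
        hhc.mul_left
    refine ((integrable_segmentIntegrand hn hhi h0 hb).add (integrable_finsetSum Finset.univ
      fun j _ => integrable_segmentIntegrand hn (hzj j) (hj j) hb)).congr (ae_of_all _ fun q => ?_)
    simp only [Pi.add_apply, segmentIntegrand, radialTest, RCLike.ofReal_real_eq_id, id, sub_zero,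
      map_sub]
    rw [clm_apply_eq_sum (fderiv ℝ φ q.2) q.1.1, sub_sub_eq_add_sub, add_sub_right_comm,
      mul_add, mul_add, mul_add, Finset.mul_sum, Finset.mul_sum, Finset.mul_sum]
    congr 1
    · ring
    · exact Finset.sum_congr rfl fun j _ => by ring
  refine ⟨hint, ?_⟩
  rw [integral_prod _ hint, integral_prod _ hint.integral_prod_left]
  calc _ = ∫ z, h z * ∫ y, b y * φ y := by
        refine integral_congr_ae (ae_of_all _ fun z => ?_)
        simp only [integral_const_mul]
        rw [← integral_segment_radialTest hm hb hφ hc z]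
        simp only [integral_const_mul]
    _ = _ := by rw [integral_mul_const, hh1, one_mul]

lemma ae_eq_of_integral_mul_eq {n : ℕ} {f g : REuc n → ℝ} (hf : LocallyIntegrable f)
    (hg : LocallyIntegrable g)
    (H : ∀ φ : REuc n → ℝ, ContDiff ℝ ∞ φ → HasCompactSupport φ →
      ∫ x, f x * φ x = ∫ x, g x * φ x) : ∀ᵐ x, f x = g x := by
  refine ae_eq_of_integral_contDiff_smul_eq hf hg fun φ hφ hc => ?_
  simpa only [smul_eq_mul, mul_comm] using H φ hφ hc

/-- The planar product as a continuous bilinear map. -/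
noncomputable def crossCLM2 : REuc 2 →L[ℝ] ℝ →L[ℝ] REuc 2 :=
  (LinearMap.mk₂ ℝ cross2
    (fun v v' w => by ext i; fin_cases i <;> simp [cross2] <;> ring)
    (fun c v w => by ext i; fin_cases i <;> simp [cross2] <;> ring)
    (fun v w w' => by ext i; fin_cases i <;> simp [cross2] <;> ring)
    (fun c v w => by ext i; fin_cases i <;> simp [cross2] <;> ring)).toContinuousBilinearMap

/-- The cross product of Euclidean three-space as a continuous bilinear map. -/
noncomputable def crossCLM3 : REuc 3 →L[ℝ] REuc 3 →L[ℝ] REuc 3 :=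
  (LinearMap.mk₂ ℝ cross3
    (fun v v' w => by simp [cross3]) (fun c v w => by simp [cross3])
    (fun v w w' => by simp [cross3]) (fun c v w => by simp [cross3])).toContinuousBilinearMap

lemma crossCLM2_apply (v : REuc 2) (w : ℝ) : crossCLM2 v w = cross2 v w := rfl

lemma crossCLM3_apply (v w : REuc 3) : crossCLM3 v w = cross3 v w := rfl

lemma inner_crossCLM2 (v : REuc 2) (w : ℝ) : inner ℝ (crossCLM2 v w) v = 0 := by
  simp [crossCLM2_apply, cross2, PiLp.inner_apply, Fin.sum_univ_two]
  ring

lemma inner_crossCLM3 (v w : REuc 3) : inner ℝ (crossCLM3 v w) v = 0 := by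
  simp [crossCLM3_apply, cross3, cross_apply, PiLp.inner_apply, Fin.sum_univ_three]
  ring

/-! ### The curl of the Griesinger gauge -/

/-- Two weak partial derivatives whose difference pairs with test functions as `b` does. -/
lemma ae_sub_eq_of_weakPartial {n : ℕ} {i j : Fin n} {f g Df Dg b : REuc n → ℝ}
    (hf : IsWeakPartial i f Df) (hg : IsWeakPartial j g Dg) (hb : LocallyIntegrable b)
    (H : ∀ φ : REuc n → ℝ, ContDiff ℝ ∞ φ → HasCompactSupport φ →
      (∫ x, f x * fderiv ℝ φ x (EuclideanSpace.single i 1))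
        - ∫ x, g x * fderiv ℝ φ x (EuclideanSpace.single j 1) = -∫ x, b x * φ x) :
    ∀ᵐ x, Df x - Dg x = b x := by
  refine ae_eq_of_integral_mul_eq (hf.2.1.sub hg.2.1) hb fun φ hφ hc => ?_
  have hi : ∀ {u : REuc n → ℝ}, LocallyIntegrable u → Integrable fun x => u x * φ x :=
    fun hu => by
      simpa only [smul_eq_mul, mul_comm] using
        hu.integrable_smul_left_of_hasCompactSupport hφ.continuous hc
  have h1 := H φ hφ hc
  rw [hf.2.2 φ hφ hc, hg.2.2 φ hφ hc] at h1
  simp only [sub_mul]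
  rw [integral_sub (hi hf.2.1) (hi hg.2.1)]
  linarith

/-- In the plane the curl of the integrand is exactly the radial expression with `m = 0`. -/
lemma curl2_griesinger_weak {h : REuc 2 → ℝ} (hh : Continuous h) (hhc : HasCompactSupport h)
    (hh1 : ∫ x, h x = 1) {B : REuc 2 → ℝ}
    (hconv : GriesingerConverges (fun v w => crossCLM2 v w) h B) (hB : MemLp B 2)
    {φ : REuc 2 → ℝ} (hφ : ContDiff ℝ ∞ φ) (hc : HasCompactSupport φ) :
    (∫ x, griesinger (fun v w => crossCLM2 v w) h B x 1
        * fderiv ℝ φ x (EuclideanSpace.single 0 1))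
      - ∫ x, griesinger (fun v w => crossCLM2 v w) h B x 0
        * fderiv ℝ φ x (EuclideanSpace.single 1 1) = -∫ x, B x * φ x := by
  have hd := fun i : Fin 2 => (contDiff_fderiv_apply hφ (EuclideanSpace.single i 1)).continuous
  have hdc := fun i : Fin 2 => hasCompactSupport_fderiv_apply hc (EuclideanSpace.single i (1 : ℝ))
  obtain ⟨hi1, he1, -⟩ := integral_griesinger_apply_mul (by norm_num) crossCLM2 hh hhc hconv hB
    (hd 0) (hdc 0) 1
  obtain ⟨hi0, he0, -⟩ := integral_griesinger_apply_mul (by norm_num) crossCLM2 hh hhc hconv hB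
    (hd 1) (hdc 1) 0
  rw [he1, he0, ← (integral_segmentMeasure_radialTest (m := 0) (by norm_num) hh hhc hh1 hB hφ hc).2,
    ← neg_add', neg_inj, ← sub_eq_add_neg, ← integral_sub hi1 hi0]
  refine integral_congr_ae (ae_of_all _ fun q => ?_)
  simp only [griesingerIntegrand, crossCLM2_apply, cross2, radialTest, clm_apply_eq_sum
    (fderiv ℝ φ q.2) (q.2 - q.1.1), Fin.sum_univ_two]
  simp
  ring

lemma fderiv_comp_affine {n : ℕ} {χ : REuc n → ℝ} (hχ : ContDiff ℝ ∞ χ) (c : ℝ) (v y w : REuc n) :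
    fderiv ℝ (fun y => χ (c • (y - v) + v)) y w = c * fderiv ℝ χ (c • (y - v) + v) w := by
  have h1 : HasFDerivAt (fun y : REuc n => c • (y - v) + v) (c • ContinuousLinearMap.id ℝ (REuc n))
      y := (((hasFDerivAt_id y).sub_const v).const_smul c).add_const v
  have h2 := ((hχ.differentiable (by simp) (c • (y - v) + v)).hasFDerivAt).comp y h1
  have h3 : fderiv ℝ (fun y => χ (c • (y - v) + v)) y = _ := h2.fderiv
  rw [h3]
  simp

/-- Divergence-free fields stay divergence-free under dilations about a point. -/
lemma DivFree.integral_comp_segment {n : ℕ} {B : REuc n → REuc n} (hB : DivFree B) {s : ℝ}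
    (hs : s ≠ 0) (z : REuc n) {χ : REuc n → ℝ} (hχ : ContDiff ℝ ∞ χ) (hc : HasCompactSupport χ) :
    ∫ x, fderiv ℝ χ x (B (s • x + (1 - s) • z)) = 0 := by
  set ψ : REuc n → ℝ := fun y => χ (s⁻¹ • (y - z) + z) with hψ
  have hψs : ContDiff ℝ ∞ ψ := hχ.comp (by fun_prop)
  have hψc : HasCompactSupport ψ := by
    have h1 := hc.comp_homeomorph (((Homeomorph.subRight z).trans
      (Homeomorph.smulOfNeZero s⁻¹ (inv_ne_zero hs))).trans (Homeomorph.addRight z))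
    exact h1
  have h2 : ∫ y, fderiv ℝ ψ y (B y) = 0 := hB (hψc.toSchwartzMap hψs)
  have h3 := integral_comp_affine hs ((1 - s) • z) (fun y => fderiv ℝ ψ y (B y))
  rw [h2, smul_zero] at h3
  have h4 : ∀ x, fderiv ℝ ψ (s • x + (1 - s) • z) (B (s • x + (1 - s) • z))
      = s⁻¹ * fderiv ℝ χ x (B (s • x + (1 - s) • z)) := fun x => by
    rw [hψ, fderiv_comp_affine hχ, inv_smul_segment_sub hs]
  simp only [h4] at h3
  rw [integral_const_mul] at h3
  exact (mul_eq_zero.1 h3).resolve_left (inv_ne_zero hs)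

lemma contDiff_coord_sub_mul {n : ℕ} {φ : REuc n → ℝ} (hφ : ContDiff ℝ ∞ φ) (z : REuc n)
    (l : Fin n) : ContDiff ℝ ∞ fun x => (x - z) l * φ x :=
  ((EuclideanSpace.proj l : REuc n →L[ℝ] ℝ).contDiff.comp (contDiff_id.sub contDiff_const)).mul hφ

lemma fderiv_coord_sub_mul {n : ℕ} {φ : REuc n → ℝ} (hφ : ContDiff ℝ ∞ φ) (z : REuc n)
    (l : Fin n) (x w : REuc n) :
    fderiv ℝ (fun x => (x - z) l * φ x) x w = w l * φ x + (x - z) l * fderiv ℝ φ x w := by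
  have h1 : HasFDerivAt (fun y : REuc n => (y - z) l) (EuclideanSpace.proj l : REuc n →L[ℝ] ℝ) x :=
    (EuclideanSpace.proj l : REuc n →L[ℝ] ℝ).hasFDerivAt.comp x ((hasFDerivAt_id x).sub_const z)
  have h2 := (hφ.differentiable (by simp) x).hasFDerivAt
  have h3 : fderiv ℝ (fun y => (y - z) l * φ y) x = _ := (h1.mul h2).fderiv
  rw [h3]
  simp
  ring

/-- In dimension three the curl of the integrand is the radial expression, as in the plane, up to
the pairing of the dilated field with a gradient, which vanishes as the field is
divergence-free. -/
lemma curl3_griesinger_weak {h : REuc 3 → ℝ} (hh : Continuous h) (hhc : HasCompactSupport h)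
    (hh1 : ∫ x, h x = 1) {B : REuc 3 → REuc 3}
    (hconv : GriesingerConverges (fun v w => crossCLM3 v w) h B) (hB : MemLp B 2)
    (hdiv : DivFree B) {φ : REuc 3 → ℝ} (hφ : ContDiff ℝ ∞ φ) (hc : HasCompactSupport φ)
    (l : Fin 3) :
    (∫ x, griesinger (fun v w => crossCLM3 v w) h B x (l + 2)
        * fderiv ℝ φ x (EuclideanSpace.single (l + 1) 1))
      - ∫ x, griesinger (fun v w => crossCLM3 v w) h B x (l + 1)
        * fderiv ℝ φ x (EuclideanSpace.single (l + 2) 1) = -∫ x, B x l * φ x := by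
  have hd := fun i : Fin 3 => (contDiff_fderiv_apply hφ (EuclideanSpace.single i 1)).continuous
  have hdc := fun i : Fin 3 => hasCompactSupport_fderiv_apply hc (EuclideanSpace.single i (1 : ℝ))
  obtain ⟨hi1, he1, -⟩ := integral_griesinger_apply_mul (by norm_num) crossCLM3 hh hhc hconv hB
    (hd (l + 1)) (hdc (l + 1)) (l + 2)
  obtain ⟨hi0, he0, -⟩ := integral_griesinger_apply_mul (by norm_num) crossCLM3 hh hhc hconv hB
    (hd (l + 2)) (hdc (l + 2)) (l + 1)
  have hBl : MemLp (fun x => B x l) 2 :=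
    (EuclideanSpace.proj l : REuc 3 →L[ℝ] ℝ).comp_memLp' hB
  obtain ⟨hi, he⟩ := integral_segmentMeasure_radialTest (m := 1) (by norm_num) hh hhc hh1 hBl hφ hc
  rw [he1, he0, ← he, ← neg_add', neg_inj, ← sub_eq_add_neg, ← integral_sub hi1 hi0,
    ← sub_eq_zero]
  refine (integral_sub (hi1.sub hi0) hi).symm.trans ?_
  have hpt : ∀ q : (REuc 3 × ℝ) × REuc 3,
      fderiv ℝ φ q.2 (EuclideanSpace.single (l + 1) 1) *
          griesingerIntegrand (fun v w => crossCLM3 v w) h B q.2 q.1 (l + 2)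
        - fderiv ℝ φ q.2 (EuclideanSpace.single (l + 2) 1) *
          griesingerIntegrand (fun v w => crossCLM3 v w) h B q.2 q.1 (l + 1)
        - h q.1.1 * (q.1.2 * (B (q.1.2 • q.2 + (1 - q.1.2) • q.1.1) l *
          radialTest 1 φ q.1.1 q.2))
      = h q.1.1 * q.1.2 * fderiv ℝ (fun x => (x - q.1.1) l * φ x) q.2
          (B (q.1.2 • q.2 + (1 - q.1.2) • q.1.1)) := by
    intro q
    rw [fderiv_coord_sub_mul hφ]
    generalize hb : B (q.1.2 • q.2 + (1 - q.1.2) • q.1.1) = b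
    simp only [griesingerIntegrand, hb, crossCLM3_apply, cross3, cross_apply, radialTest,
      clm_apply_eq_sum (fderiv ℝ φ q.2) (q.2 - q.1.1), clm_apply_eq_sum (fderiv ℝ φ q.2) b,
      Fin.sum_univ_three]
    fin_cases l <;> simp <;> ring
  have hint := ((hi1.sub hi0).sub hi).congr (ae_of_all _ hpt)
  refine (integral_congr_ae (ae_of_all _ hpt)).trans ?_
  rw [integral_prod _ hint]
  refine integral_eq_zero_of_ae ?_
  have h0 : ∀ᵐ s ∂(volume.restrict (Icc (0 : ℝ) 1)), s ≠ 0 :=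
    ae_restrict_of_ae (by simp [ae_iff, measure_singleton])
  filter_upwards [Measure.quasiMeasurePreserving_snd.ae h0] with q hq
  rw [integral_const_mul, hdiv.integral_comp_segment hq _ (contDiff_coord_sub_mul hφ q.1 l)
    hc.mul_left, mul_zero, Pi.zero_apply]

lemma curl2_griesinger {h : REuc 2 → ℝ} (hh : Continuous h) (hhc : HasCompactSupport h)
    (hh1 : ∫ x, h x = 1) {B : REuc 2 → ℝ}
    (hconv : GriesingerConverges (fun v w => crossCLM2 v w) h B) (hB : MemLp B 2)
    {D : Fin 2 → Fin 2 → REuc 2 → ℝ}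
    (hD : IsWeakJacobian (griesinger (fun v w => crossCLM2 v w) h B) D) :
    ∀ᵐ x, curl2 D x = B x :=
  ae_sub_eq_of_weakPartial (hD 0 1) (hD 1 0) (hB.locallyIntegrable (by norm_num))
    fun _ hφ hc => curl2_griesinger_weak hh hhc hh1 hconv hB hφ hc

lemma curl3_griesinger {h : REuc 3 → ℝ} (hh : Continuous h) (hhc : HasCompactSupport h)
    (hh1 : ∫ x, h x = 1) {B : REuc 3 → REuc 3}
    (hconv : GriesingerConverges (fun v w => crossCLM3 v w) h B) (hB : MemLp B 2)
    (hdiv : DivFree B) {D : Fin 3 → Fin 3 → REuc 3 → ℝ}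
    (hD : IsWeakJacobian (griesinger (fun v w => crossCLM3 v w) h B) D) :
    ∀ᵐ x, curl3 D x = B x := by
  have H : ∀ l : Fin 3, ∀ᵐ x, D (l + 1) (l + 2) x - D (l + 2) (l + 1) x = B x l := fun l =>
    ae_sub_eq_of_weakPartial (hD _ _) (hD _ _)
      (((EuclideanSpace.proj l : REuc 3 →L[ℝ] ℝ).comp_memLp' hB).locallyIntegrable (by norm_num))
      fun _ hφ hc => curl3_griesinger_weak hh hhc hh1 hconv hB hdiv hφ hc l
  filter_upwards [H 0, H 1, H 2] with x h0 h1 h2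
  ext l
  fin_cases l
  · exact h0
  · exact h1
  · exact h2

/-! ### A gauge whose derivatives decay only quadratically -/

/-- The kernel `1 / y_i`, cut off to the half-space `1 ≤ y_i`. -/
noncomputable def reciprocalKernel {n : ℕ} (i : Fin n) (y : REuc n) : ℝ :=
  if 1 ≤ y i then (y i)⁻¹ else 0

lemma locallyIntegrable_reciprocalKernel {n : ℕ} (i : Fin n) :
    LocallyIntegrable (reciprocalKernel i) := by
  have hm : Measurable (reciprocalKernel i) := by
    have h1 : Measurable fun y : REuc n => y i := (by fun_prop : Continuous _).measurable
    exact Measurable.ite (measurableSet_le measurable_const h1) h1.inv measurable_const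
  refine (locallyIntegrable_const (1 : ℝ)).mono hm.aestronglyMeasurable (ae_of_all _ fun y => ?_)
  rw [reciprocalKernel]
  split_ifs with h
  · rw [norm_inv, Real.norm_of_nonneg (by linarith), norm_one]
    exact inv_le_one_of_one_le₀ h
  · simp

lemma abs_coord_le_norm {n : ℕ} (x : REuc n) (i : Fin n) : |x i| ≤ ‖x‖ := by
  simpa using PiLp.norm_apply_le x i

/-- Convolving a function supported in the ball of radius `r` with the cut-off reciprocal kernel. -/
lemma convolution_reciprocalKernel {n : ℕ} (i : Fin n) {g : REuc n → ℝ} {r : ℝ}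
    (hr : ∀ z, g z ≠ 0 → ‖z‖ ≤ r) {x : REuc n} (hx : r + 1 < x i) :
    ∫ t, reciprocalKernel i t * g (x - t) = ∫ z, g z / (x i - z i) := by
  rw [← integral_sub_left_eq_self _ _ x]
  refine integral_congr_ae (ae_of_all _ fun z => ?_)
  simp only [sub_sub_cancel]
  by_cases hz : g z = 0
  · simp [hz]
  · have h1 : 1 ≤ (x - z) i := by
      have := (abs_le.1 ((abs_coord_le_norm z i).trans (hr z hz))).2
      rw [PiLp.sub_apply]
      linarith
    rw [reciprocalKernel, if_pos h1, PiLp.sub_apply, div_eq_inv_mul]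

lemma integral_fderiv_apply_eq_zero {n : ℕ} {h : REuc n → ℝ} (hh : ContDiff ℝ ∞ h)
    (hc : HasCompactSupport h) (v : REuc n) : ∫ z, fderiv ℝ h z v = 0 := by
  have h1 := integral_mul_fderiv_eq_neg_fderiv_mul_of_integrable (μ := volume)
    (f := fun _ : REuc n => (1 : ℝ)) (g := h) (v := v)
    (by simp) (by
      simpa using (contDiff_fderiv_apply hh v).continuous.integrable_of_hasCompactSupport
        (hasCompactSupport_fderiv_apply hc v))
    (by simpa using hh.continuous.integrable_of_hasCompactSupport hc)
    (fun _ _ => by fun_prop) (fun x _ => hh.differentiable (by simp) x)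
  simpa using h1

lemma integral_coord_mul_fderiv {n : ℕ} {h : REuc n → ℝ} (hh : ContDiff ℝ ∞ h)
    (hc : HasCompactSupport h) (i : Fin n) :
    ∫ z : REuc n, z i * fderiv ℝ h z (EuclideanSpace.single i 1) = -∫ z, h z := by
  have h1 := integral_fderiv_apply_eq_zero (contDiff_coord_mul hh i) hc.mul_left
    (EuclideanSpace.single i 1)
  simp only [fderiv_coord_mul hh, if_true, one_mul] at h1
  rw [integral_add _ (hh.continuous.integrable_of_hasCompactSupport hc)] at h1
  · linarith
  · have h2 := (contDiff_fderiv_apply hh (EuclideanSpace.single i 1)).continuous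
    exact (by fun_prop : Continuous fun z : REuc n => z i *
      fderiv ℝ h z (EuclideanSpace.single i 1)).integrable_of_hasCompactSupport
      (hasCompactSupport_fderiv_apply hc _).mul_left

/-- The first two moments of `∂ᵢ h` are `0` and `-1`, so its reciprocal transform is
`-1 / t² + O(1 / t³)`. -/
lemma exists_abs_moment_le {n : ℕ} {h : REuc n → ℝ} (hh : ContDiff ℝ ∞ h)
    (hc : HasCompactSupport h) (hh1 : ∫ x, h x = 1) (i : Fin n) {r : ℝ} (hr0 : 0 < r)
    (hr : ∀ z, fderiv ℝ h z (EuclideanSpace.single i 1) ≠ 0 → ‖z‖ ≤ r) :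
    ∃ M : ℝ, ∀ t, r < t →
      |t ^ 2 * (∫ z : REuc n, fderiv ℝ h z (EuclideanSpace.single i 1) / (t - z i)) + 1|
        ≤ M / (t - r) := by
  set g : REuc n → ℝ := fun z => fderiv ℝ h z (EuclideanSpace.single i 1) with hg
  have hgc : Continuous g := (contDiff_fderiv_apply hh _).continuous
  have hgs : HasCompactSupport g := hasCompactSupport_fderiv_apply hc _
  have hg1 : Integrable g := hgc.integrable_of_hasCompactSupport hgs
  have hg2 : Integrable fun z : REuc n => z i * g z :=
    (by fun_prop : Continuous fun z : REuc n => z i * g z).integrable_of_hasCompactSupport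
      hgs.mul_left
  refine ⟨∫ z, r ^ 2 * |g z|, fun t ht => ?_⟩
  have ht0 : 0 < t - r := by linarith
  have hzt : ∀ z, g z ≠ 0 → t - r ≤ t - z i := fun z hz => by
    have := (abs_le.1 ((abs_coord_le_norm z i).trans (hr z hz))).2
    linarith
  have hexp : ∀ z : REuc n, t ^ 2 * (g z / (t - z i))
      = t * g z + z i * g z + z i ^ 2 * g z / (t - z i) := fun z => by
    by_cases hz : g z = 0
    · simp [hz]
    · have h1 : t - z i ≠ 0 := (ht0.trans_le (hzt z hz)).ne'
      field_simp
      ring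
  have hbd : ∀ z : REuc n, ‖z i ^ 2 * g z / (t - z i)‖ ≤ r ^ 2 * |g z| / (t - r) := fun z => by
    by_cases hz : g z = 0
    · simp [hz]
    · have h1 := hzt z hz
      have h2 := (abs_coord_le_norm z i).trans (hr z hz)
      rw [norm_div, norm_mul, norm_pow, Real.norm_eq_abs, Real.norm_eq_abs,
        Real.norm_of_nonneg (ht0.le.trans h1)]
      gcongr
  have hbi : Integrable fun z : REuc n => r ^ 2 * |g z| / (t - r) :=
    (hg1.abs.const_mul _).div_const _
  have hg3 : Integrable fun z : REuc n => z i ^ 2 * g z / (t - z i) := by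
    refine hbi.mono' ?_ (ae_of_all _ hbd)
    have : Measurable fun z : REuc n => z i := (by fun_prop : Continuous _).measurable
    exact (((this.pow_const 2).mul hgc.measurable).div
      (measurable_const.sub this)).aestronglyMeasurable
  have hsum : t ^ 2 * (∫ z : REuc n, g z / (t - z i)) + 1
      = ∫ z : REuc n, z i ^ 2 * g z / (t - z i) := by
    rw [← integral_const_mul]
    simp only [hexp]
    rw [integral_add (f := fun z : REuc n => t * g z + z i * g z)
        ((hg1.const_mul t).add hg2) hg3, integral_add (hg1.const_mul t) hg2, integral_const_mul, integral_fderiv_apply_eq_zero hh hc, integral_coord_mul_fderiv hh hc,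
      hh1]
    ring
  rw [hsum, ← integral_div]
  exact norm_integral_le_of_norm_le hbi (ae_of_all _ hbd)

/-- The half-infinite tube `x_i > N`, `|x_j| < 1` for `j ≠ i`. -/
def tube {n : ℕ} (i : Fin n) (N : ℝ) : Set (REuc n) := {x | N < x i ∧ ∀ j, j ≠ i → |x j| < 1}

lemma isOpen_tube {n : ℕ} (i : Fin n) (N : ℝ) : IsOpen (tube i N) := by
  have h1 : IsOpen {x : REuc n | N < x i} := isOpen_lt continuous_const (by fun_prop)
  have h2 : IsOpen (⋂ j : Fin n, {x : REuc n | j ≠ i → |x j| < 1}) := by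
    refine isOpen_iInter_of_finite fun j => ?_
    by_cases hj : j = i
    · simp [hj]
    · simp only [ne_eq, hj, not_false_eq_true, forall_const]
      exact isOpen_lt (by fun_prop) continuous_const
  convert h1.inter h2 using 1
  ext x
  simp [tube]

lemma volume_tube_pos {n : ℕ} (i : Fin n) (N : ℝ) : 0 < volume (tube i N) := by
  refine (isOpen_tube i N).measure_pos _ ⟨EuclideanSpace.single i (N + 1), ?_, fun j hj => ?_⟩
  · simp
  · simp [hj]

/-- The weak derivative on a tube of the reciprocal transform of `h` is given by `∂ᵢ h`. -/
lemma ae_weakPartial_eq_on_tube {n : ℕ} {h : REuc n → ℝ} (hh : ContDiff ℝ ∞ h)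
    (hc : HasCompactSupport h) {i : Fin n} {r : ℝ} (hr : ∀ z ∈ tsupport h, ‖z‖ ≤ r)
    {f D : REuc n → ℝ} (hD : IsWeakPartial i f D) {c N : ℝ} (hN : r + 1 ≤ N)
    (hf : ∀ x ∈ tube i N, f x = c * ∫ z : REuc n, h z / (x i - z i)) :
    ∀ᵐ x, x ∈ tube i N →
      D x = c * ∫ z : REuc n, fderiv ℝ h z (EuclideanSpace.single i 1) / (x i - z i) := by
  set e : REuc n := EuclideanSpace.single i 1 with he
  have hK := locallyIntegrable_reciprocalKernel i
  set L := ContinuousLinearMap.mul ℝ ℝ with hL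
  set G : REuc n → ℝ := convolution (reciprocalKernel i) h L volume with hG
  have hGs : ContDiff ℝ ∞ G := hc.contDiff_convolution_right L hK hh
  have hGd : ∀ x, fderiv ℝ G x e = ∫ t, reciprocalKernel i t * fderiv ℝ h (x - t) e := by
    intro x
    rw [(hc.hasFDerivAt_convolution_right L hK (hh.of_le (by simp)) x).fderiv,
      convolution_precompR_apply L hK (hc.fderiv ℝ) (hh.continuous_fderiv (by simp))]
    rfl
  have hr1 : ∀ z, h z ≠ 0 → ‖z‖ ≤ r := fun z hz => hr z (subset_tsupport h hz)
  have hr2 : ∀ z, fderiv ℝ h z e ≠ 0 → ‖z‖ ≤ r := fun z hz => hr z <| by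
    refine tsupport_fderiv_subset ℝ (subset_tsupport _ ?_)
    intro h0
    exact hz (by rw [h0, zero_apply])
  have hGf : ∀ x ∈ tube i N, f x = c * G x := fun x hx => by
    rw [hf x hx, ← convolution_reciprocalKernel i hr1 (hN.trans_lt hx.1)]
    rfl
  have hGd' : ∀ x ∈ tube i N, fderiv ℝ G x e = ∫ z : REuc n, fderiv ℝ h z e / (x i - z i) :=
    fun x hx => by
      rw [hGd, convolution_reciprocalKernel i (g := fun z => fderiv ℝ h z e) hr2
        (hN.trans_lt hx.1)]
  have hGe := contDiff_fderiv_apply hGs e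
  have key : ∀ᵐ x, x ∈ tube i N → D x - c * fderiv ℝ G x e = 0 := by
    refine (isOpen_tube i N).ae_eq_zero_of_integral_contDiff_smul_eq_zero ?_ fun φ hφ hφc hφU => ?_
    · exact (hD.2.1.sub (hGe.continuous.const_mul c).locallyIntegrable).locallyIntegrableOn _
    · have hiD : Integrable fun x => D x * φ x := by
        simpa only [smul_eq_mul, mul_comm] using
          hD.2.1.integrable_smul_left_of_hasCompactSupport hφ.continuous hφc
      have hiG : Integrable fun x => fderiv ℝ G x e * φ x :=
        (hGe.continuous.mul hφ.continuous).integrable_of_hasCompactSupport hφc.mul_left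
      have h1 := hD.2.2 φ hφ hφc
      have h2 : ∫ x, f x * fderiv ℝ φ x e = c * ∫ x, G x * fderiv ℝ φ x e := by
        rw [← integral_const_mul]
        refine integral_congr_ae (ae_of_all _ fun x => ?_)
        by_cases hx : x ∈ tube i N
        · simp only [hGf x hx, mul_assoc]
        · have h3 : fderiv ℝ φ x = 0 :=
            image_eq_zero_of_notMem_tsupport fun hm => hx (hφU (tsupport_fderiv_subset ℝ hm))
          simp [h3]
      have h4 : ∫ x, G x * fderiv ℝ φ x e = -∫ x, fderiv ℝ G x e * φ x := by
        refine integral_mul_fderiv_eq_neg_fderiv_mul_of_integrable hiG ?_ ?_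
          (fun x _ => hGs.differentiable (by simp) x) (fun x _ => hφ.differentiable (by simp) x)
        · exact (hGs.continuous.mul (contDiff_fderiv_apply hφ e).continuous
            ).integrable_of_hasCompactSupport (hasCompactSupport_fderiv_apply hφc e).mul_left
        · exact (hGs.continuous.mul hφ.continuous).integrable_of_hasCompactSupport hφc.mul_left
      have h5 : ∀ x, φ x • (D x - c * fderiv ℝ G x e) = D x * φ x - c * (fderiv ℝ G x e * φ x) :=
        fun x => by simp only [smul_eq_mul]; ring
      simp only [h5]
      rw [integral_sub hiD (hiG.const_mul c), integral_const_mul]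
      rw [h2, h4] at h1
      linarith
  filter_upwards [key] with x hx hxU
  rw [← hGd' x hxU]
  linarith [hx hxU]

/-- A function that on a tube is a nonzero multiple of the reciprocal transform of a mollifier has
no weak derivative along the tube decaying faster than `|x|⁻²`. -/
lemma not_decaysAE_weakPartial {n : ℕ} {h : REuc n → ℝ} (hh : ContDiff ℝ ∞ h)
    (hc : HasCompactSupport h) (hh1 : ∫ x, h x = 1) {i : Fin n}
    {f D : REuc n → ℝ} (hD : IsWeakPartial i f D) {c N : ℝ} (hc0 : c ≠ 0)
    (hf : ∀ x ∈ tube i N, f x = c * ∫ z : REuc n, h z / (x i - z i)) {μ : ℝ} (hμ : 2 < μ) :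
    ¬ DecaysAE D μ := by
  intro hdec
  obtain ⟨C, R, hC, hR, hdec⟩ := hdec.exists_nonneg
  obtain ⟨r', hr'⟩ := hc.isCompact.isBounded.exists_norm_le
  set r := max r' 1 with hr
  have hr0 : 0 < r := by positivity
  have hrs : ∀ z ∈ tsupport h, ‖z‖ ≤ r := fun z hz => (hr' z hz).trans (le_max_left _ _)
  obtain ⟨M, hM⟩ := exists_abs_moment_le hh hc hh1 i hr0 fun z hz => hrs z <| by
    refine tsupport_fderiv_subset ℝ (subset_tsupport _ ?_)
    intro h0
    exact hz (by rw [h0, zero_apply])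
  -- beyond `T` the leading term `|c| / t²` exceeds the assumed bound
  have hlim1 : Tendsto (fun t : ℝ => M / (t - r)) atTop (nhds 0) :=
    tendsto_const_nhds.div_atTop (tendsto_atTop_add_const_right _ _ tendsto_id)
  have hlim2 : Tendsto (fun t : ℝ => C * t ^ (-(μ - 2))) atTop (nhds 0) := by
    simpa using (tendsto_rpow_neg_atTop (by linarith : 0 < μ - 2)).const_mul C
  have hcp : 0 < |c| / 2 := by positivity
  obtain ⟨T, hT⟩ := eventually_atTop.1 ((hlim1.eventually_lt_const one_half_pos).and
    (hlim2.eventually_lt_const hcp))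
  set N' := max (max N T) (max R (r + 1)) with hN'
  have hNN' : N ≤ N' := (le_max_left _ _).trans (le_max_left _ _)
  have hTN' : T ≤ N' := (le_max_right _ _).trans (le_max_left _ _)
  have hRN' : R ≤ N' := (le_max_left _ _).trans (le_max_right _ _)
  have hrN' : r + 1 ≤ N' := (le_max_right _ _).trans (le_max_right _ _)
  have hae := ae_weakPartial_eq_on_tube hh hc hrs hD hrN' fun x hx =>
    hf x ⟨hNN'.trans_lt hx.1, hx.2⟩
  have hempty : ∀ᵐ x, x ∉ tube i N' := by
    filter_upwards [hae, hdec] with x hx hxd hxU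
    have hx1 := hxU.1
    have ht0 : 0 < x i := by linarith
    have hle : x i ≤ ‖x‖ := (le_abs_self _).trans (abs_coord_le_norm x i)
    have h1 := hxd (by linarith)
    rw [hx hxU] at h1
    set W := ∫ z : REuc n, fderiv ℝ h z (EuclideanSpace.single i 1) / (x i - z i) with hW
    have h2 := hM (x i) (by linarith)
    obtain ⟨h3, h4⟩ := hT (x i) (by linarith)
    have h5 : 1 / 2 ≤ x i ^ 2 * |W| := by
      have h6 : |x i ^ 2 * W| = x i ^ 2 * |W| := by
        rw [abs_mul, abs_of_pos (by positivity : 0 < x i ^ 2)]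
      have h7 := abs_lt.1 (h2.trans_lt h3)
      rw [← h6]
      linarith [h7.2, neg_abs_le (x i ^ 2 * W)]
    have h6 : ‖x‖ ^ (-μ) ≤ x i ^ (-μ) :=
      Real.rpow_le_rpow_of_nonpos ht0 hle (by linarith)
    have h7 : x i ^ 2 * x i ^ (-μ) = x i ^ (-(μ - 2)) := by
      rw [← Real.rpow_natCast, ← Real.rpow_add ht0]
      congr 1
      push_cast
      ring
    have h8 : |c| / 2 ≤ C * x i ^ (-(μ - 2)) := by
      calc |c| / 2 = |c| * (1 / 2) := by ring
        _ ≤ |c| * (x i ^ 2 * |W|) := by gcongr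
        _ = x i ^ 2 * ‖c * W‖ := by rw [Real.norm_eq_abs, abs_mul]; ring
        _ ≤ x i ^ 2 * (C * x i ^ (-μ)) := by gcongr; exact h1.trans (by gcongr)
        _ = _ := by rw [← h7]; ring
    linarith
  have h0 : volume (tube i N') = 0 := by
    simpa [ae_iff] using hempty
  exact (volume_tube_pos i N').ne' h0

/-- Integration by parts along a segment whose endpoints lie on either side of the bump `ρ`. -/
lemma integral_segment_deriv {ρ : ℝ → ℝ} (hρ : ContDiff ℝ ∞ ρ) {a b x z : ℝ}
    (hs : ∀ t, ρ t ≠ 0 → a < t ∧ t < b) (hz : z ≤ a) (hx : b ≤ x) (hzx : z < x) :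
    (x - z) * ∫ s in (0 : ℝ)..1, s * deriv ρ (s * x + (1 - s) * z) = -((∫ t, ρ t) / (x - z)) := by
  have hL : x - z ≠ 0 := (sub_pos.2 hzx).ne'
  have hρ' : Continuous (deriv ρ) := hρ.continuous_deriv (by simp)
  have hρc := hρ.continuous
  have hd : ∀ s : ℝ, HasDerivAt (fun s : ℝ => s * ρ (s * x + (1 - s) * z))
      (ρ (s * x + (1 - s) * z) + (x - z) * (s * deriv ρ (s * x + (1 - s) * z))) s := by
    intro s
    have h1 : HasDerivAt (fun s : ℝ => s * x + (1 - s) * z) (x - z) s := by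
      refine (((hasDerivAt_id s).mul_const x).add
        (((hasDerivAt_id s).const_sub 1).mul_const z)).congr_deriv ?_
      ring
    have h2 : HasDerivAt (fun s : ℝ => ρ (s * x + (1 - s) * z))
        (deriv ρ (s * x + (1 - s) * z) * (x - z)) s :=
      ((hρ.differentiable (by simp) _).hasDerivAt).comp s h1
    refine ((hasDerivAt_id s).mul h2).congr_deriv ?_
    simp only [id]
    ring
  have hi1 : IntervalIntegrable (fun s : ℝ => ρ (s * x + (1 - s) * z)) volume 0 1 :=
    (by fun_prop : Continuous _).intervalIntegrable _ _
  have hi2 : IntervalIntegrable (fun s : ℝ => (x - z) * (s * deriv ρ (s * x + (1 - s) * z)))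
      volume 0 1 := (by fun_prop : Continuous _).intervalIntegrable _ _
  have h1 := intervalIntegral.integral_eq_sub_of_hasDerivAt (fun s _ => hd s) (hi1.add hi2)
  have hρx : ρ x = 0 := by
    by_contra h
    linarith [(hs x h).2]
  rw [intervalIntegral.integral_add hi1 hi2, intervalIntegral.integral_const_mul] at h1
  simp only [one_mul, sub_self, zero_mul, add_zero, hρx] at h1
  have h2 : ∫ s in (0 : ℝ)..1, ρ (s * x + (1 - s) * z) = (x - z)⁻¹ * ∫ t in z..x, ρ t := by
    have h3 := intervalIntegral.integral_comp_mul_add (a := 0) (b := 1) ρ hL z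
    simp only [mul_zero, zero_add, mul_one, sub_add_cancel, smul_eq_mul] at h3
    rw [← h3]
    refine intervalIntegral.integral_congr fun s _ => congrArg ρ ?_
    ring
  have h3 : ∫ t in z..x, ρ t = ∫ t, ρ t := by
    refine intervalIntegral.integral_eq_integral_of_support_subset fun t ht => ?_
    have := hs t ht
    exact ⟨hz.trans_lt this.1, (this.2.le.trans hx)⟩
  rw [h2, h3, ← div_eq_inv_mul] at h1
  linarith

/-- Where the integrand is a pure derivative along the `i`-th axis, the component of the gauge is
the reciprocal transform of `h`. -/
lemma griesinger_apply_on_tube {n : ℕ} {F : Type*} [NormedAddCommGroup F]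
    [NormedSpace ℝ F] (Λ : REuc n →L[ℝ] F →L[ℝ] REuc n) {h : REuc n → ℝ} {B : REuc n → F}
    (hconv : GriesingerConverges (fun v w => Λ v w) h B) {r : ℝ} (hr0 : 0 < r)
    (hr : ∀ z, h z ≠ 0 → ‖z‖ ≤ r) {ρ : ℝ → ℝ} (hρ : ContDiff ℝ ∞ ρ)
    (hs : ∀ t, ρ t ≠ 0 → r + 1 < t ∧ t < r + 2) {i k : Fin n}
    (hB : ∀ y, (∀ j, j ≠ i → |y j| < r + 2) → ∀ v : REuc n, ∀ s : ℝ,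
      Λ v (s • B y) k = v i * (s * deriv ρ (y i)))
    {x : REuc n} (hx : x ∈ tube i (r + 2)) :
    griesinger (fun v w => Λ v w) h B x k = (∫ t, ρ t) * ∫ z : REuc n, h z / (x i - z i) := by
  have hint := hconv x
  rw [IntegrableOn, prod_restrict_Icc_eq] at hint
  have h1 : ∫ q, griesingerIntegrand (fun v w => Λ v w) h B x q k
      ∂(volume.prod (volume.restrict (Icc (0 : ℝ) 1))) = _ :=
    (EuclideanSpace.proj k : REuc n →L[ℝ] ℝ).integral_comp_comm hint
  have h2 : Integrable (fun q => griesingerIntegrand (fun v w => Λ v w) h B x q k)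
      (volume.prod (volume.restrict (Icc (0 : ℝ) 1))) :=
    (EuclideanSpace.proj k : REuc n →L[ℝ] ℝ).integrable_comp hint
  rw [PiLp.proj_apply] at h1
  rw [griesinger_eq_neg_integral_prod hconv, PiLp.neg_apply, ← h1, integral_prod _ h2,
    ← integral_neg, ← integral_const_mul]
  refine integral_congr_ae (ae_of_all _ fun z => ?_)
  simp only
  by_cases hz : h z = 0
  · simp [griesingerIntegrand, hz]
  have hzr := hr z hz
  have hzi := abs_le.1 ((abs_coord_le_norm z i).trans hzr)
  have h3 : ∀ s ∈ Icc (0 : ℝ) 1, griesingerIntegrand (fun v w => Λ v w) h B x (z, s) k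
      = h z * ((x i - z i) * (s * deriv ρ (s * x i + (1 - s) * z i))) := by
    intro s hs01
    simp only [griesingerIntegrand, PiLp.smul_apply, smul_eq_mul]
    rw [hB]
    · simp
    · intro j hj
      have hxj := hx.2 j hj
      have hzj := (abs_coord_le_norm z j).trans hzr
      simp only [PiLp.add_apply, PiLp.smul_apply, smul_eq_mul]
      calc |s * x j + (1 - s) * z j| ≤ |s * x j| + |(1 - s) * z j| := abs_add_le _ _
        _ = s * |x j| + (1 - s) * |z j| := by
          rw [abs_mul, abs_mul, abs_of_nonneg hs01.1, abs_of_nonneg (sub_nonneg.2 hs01.2)]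
        _ < r + 2 := by nlinarith [hs01.1, hs01.2]
  rw [setIntegral_congr_fun measurableSet_Icc h3, integral_const_mul, integral_const_mul,
    setIntegral_Icc_eq_intervalIntegral zero_le_one,
    integral_segment_deriv hρ hs (by linarith) hx.1.le (by linarith [hx.1])]
  ring

lemma norm_le_sum_abs {n : ℕ} (y : REuc n) : ‖y‖ ≤ ∑ j, |y j| := by
  have h1 : y = ∑ j, y j • EuclideanSpace.single j (1 : ℝ) := by
    have := (EuclideanSpace.basisFun (Fin n) ℝ).sum_repr y
    simpa using this.symm
  conv_lhs => rw [h1]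
  refine (norm_sum_le _ _).trans (Finset.sum_le_sum fun j _ => ?_)
  simp [norm_smul]

/-- A test function that near the `i`-th axis depends on the `i`-th coordinate only. -/
lemma exists_potential {n : ℕ} (i : Fin n) {r : ℝ} (hr : 0 < r) :
    ∃ (ρ : ℝ → ℝ) (ψ : REuc n → ℝ), ContDiff ℝ ∞ ρ ∧ (∀ t, ρ t ≠ 0 → r + 1 < t ∧ t < r + 2) ∧
      ∫ t, ρ t ≠ 0 ∧ ContDiff ℝ ∞ ψ ∧ HasCompactSupport ψ ∧
      ∀ y, (∀ j, j ≠ i → |y j| < r + 2) → ∀ v, fderiv ℝ ψ y v = v i * deriv ρ (y i) := by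
  -- `ρ` lives on `(r + 1, r + 2)`; the cut-off `β` is one wherever `ρ (y i) ≠ 0` near the axis
  let ρ : ContDiffBump (r + 3 / 2 : ℝ) := ⟨1 / 4, 1 / 2, by norm_num, by norm_num⟩
  let β : ContDiffBump (0 : REuc n) :=
    ⟨n * (r + 2) + 1, n * (r + 2) + 2, by positivity, by linarith⟩
  have hρs : ∀ t, ρ t ≠ 0 → r + 1 < t ∧ t < r + 2 := by
    intro t ht
    have h1 : t ∈ Function.support ρ := ht
    rw [ρ.support_eq, Metric.mem_ball, Real.dist_eq, abs_lt] at h1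
    have h2 : ρ.rOut = 1 / 2 := rfl
    rw [h2] at h1
    constructor <;> linarith
  have hproj : ContDiff ℝ ∞ fun y : REuc n => y i :=
    (EuclideanSpace.proj i : REuc n →L[ℝ] ℝ).contDiff
  refine ⟨ρ, fun y => ρ (y i) * β y, ρ.contDiff, hρs, (ρ.integral_pos (μ := volume)).ne',
    (ρ.contDiff.comp hproj).mul β.contDiff, β.hasCompactSupport.mul_left, fun y hy v => ?_⟩
  have hopen : IsOpen {y : REuc n | ∀ j, j ≠ i → |y j| < r + 2} := by
    have : {y : REuc n | ∀ j, j ≠ i → |y j| < r + 2}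
        = ⋂ j ∈ ({i}ᶜ : Set (Fin n)), {y : REuc n | |y j| < r + 2} := by
      ext; simp
    rw [this]
    exact (Set.toFinite _).isOpen_biInter fun j _ => isOpen_lt (by fun_prop) continuous_const
  have hloc : (fun y : REuc n => ρ (y i) * β y) =ᶠ[nhds y] fun y => ρ (y i) := by
    filter_upwards [hopen.mem_nhds hy] with y hy
    by_cases h0 : ρ (y i) = 0
    · simp [h0]
    · have h1 : ‖y‖ ≤ n * (r + 2) := by
        refine (norm_le_sum_abs y).trans ?_
        have h2 : ∀ j, |y j| ≤ r + 2 := fun j => by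
          by_cases hj : j = i
          · subst hj
            have := hρs _ h0
            rw [abs_of_pos (by linarith)]
            linarith
          · exact (hy j hj).le
        refine (Finset.sum_le_sum fun j _ => h2 j).trans_eq ?_
        simp [mul_add]
      rw [β.one_of_mem_closedBall, mul_one]
      have h2 : β.rIn = n * (r + 2) + 1 := rfl
      rw [mem_closedBall_zero_iff, h2]
      linarith
  rw [hloc.fderiv_eq]
  have h3 : HasFDerivAt (fun y : REuc n => y i) (EuclideanSpace.proj i : REuc n →L[ℝ] ℝ) y :=
    (EuclideanSpace.proj i : REuc n →L[ℝ] ℝ).hasFDerivAt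
  have h4 : HasDerivAt ρ (deriv ρ (y i)) (y i) :=
    ((ρ.contDiff (n := 1)).differentiable (by simp) _).hasDerivAt
  have h5 : HasFDerivAt (fun y : REuc n => ρ (y i)) _ y :=
    HasDerivAt.comp_hasFDerivAt (h₂ := ρ) y h4 h3
  rw [h5.fderiv]
  simp [mul_comm]

lemma decaysAE_of_hasCompactSupport {n : ℕ} {F : Type*} [NormedAddCommGroup F] {f : REuc n → F}
    (hf : HasCompactSupport f) (μ : ℝ) : DecaysAE f μ := by
  obtain ⟨R, hR⟩ := hf.isCompact.isBounded.exists_norm_le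
  refine ⟨0, R + 1, ae_of_all _ fun x hx => ?_⟩
  have h1 : f x = 0 := image_eq_zero_of_notMem_tsupport fun hm => by linarith [hR x hm]
  simp [h1]

lemma integral_fderiv_mul_fderiv_comm {n : ℕ} {ψ : REuc n → ℝ} (hψ : ContDiff ℝ ∞ ψ)
    (hc : HasCompactSupport ψ) {φ : REuc n → ℝ} (hφ : ContDiff ℝ ∞ φ) (v w : REuc n) :
    ∫ x, fderiv ℝ ψ x v * fderiv ℝ φ x w = ∫ x, fderiv ℝ ψ x w * fderiv ℝ φ x v := by
  have key : ∀ v w, ∫ x, fderiv ℝ ψ x v * fderiv ℝ φ x w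
      = -∫ x, fderiv ℝ (fderiv ℝ ψ) x w v * φ x := by
    intro v w
    have hv := contDiff_fderiv_apply hψ v
    have hvc := hasCompactSupport_fderiv_apply hc v
    have h1 : ∀ x, fderiv ℝ (fun x => fderiv ℝ ψ x v) x w = fderiv ℝ (fderiv ℝ ψ) x w v := by
      intro x
      have h2 : DifferentiableAt ℝ (fderiv ℝ ψ) x :=
        (hψ.fderiv_right (m := ∞) (by simp)).differentiable (by simp) x
      rw [fderiv_clm_apply h2 (by fun_prop)]
      simp
    simp only [← h1]
    refine integral_mul_fderiv_eq_neg_fderiv_mul_of_integrable ?_ ?_ ?_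
      (fun x _ => hv.differentiable (by simp) x) (fun x _ => hφ.differentiable (by simp) x)
    · exact ((contDiff_fderiv_apply hv w).continuous.mul hφ.continuous
        ).integrable_of_hasCompactSupport (hasCompactSupport_fderiv_apply hvc w).mul_right
    · exact (hv.continuous.mul (contDiff_fderiv_apply hφ w).continuous
        ).integrable_of_hasCompactSupport hvc.mul_right
    · exact (hv.continuous.mul hφ.continuous).integrable_of_hasCompactSupport hvc.mul_right
  rw [key, key]
  congr 1
  refine integral_congr_ae (ae_of_all _ fun x => ?_)
  have := (hψ.contDiffAt (x := x)).isSymmSndFDerivAt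
    (by simp only [minSmoothness_of_isRCLikeNormedField]; exact WithTop.coe_le_coe.2 le_top) v w
  simp only [this]

/-- In the plane the field `-∂₁ψ` serves. -/
lemma exists_field2 {h : REuc 2 → ℝ} (hm : IsMollifier h) {μ : ℝ} (hμ : 2 < μ) :
    ∃ B : REuc 2 → ℝ, MediumDecay2 B ∧ DecaysAE B μ ∧
      ∀ D : Fin 2 → Fin 2 → REuc 2 → ℝ, IsWeakJacobian (griesinger cross2 h B) D →
        ∃ i k, ¬ DecaysAE (D i k) μ := by
  obtain ⟨hh, hc, hh1⟩ := hm
  obtain ⟨r, hr0, hr⟩ := exists_radius_of_hasCompactSupport hc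
  obtain ⟨ρ, ψ, hρ, hρs, hρi, hψ, hψc, hψd⟩ := exists_potential (0 : Fin 2) hr0
  set B : REuc 2 → ℝ := fun y => -fderiv ℝ ψ y (EuclideanSpace.single 0 1) with hB
  have hBc : Continuous B := (contDiff_fderiv_apply hψ _).continuous.neg
  have hBs : HasCompactSupport B := (hasCompactSupport_fderiv_apply hψc _).neg
  have hBp : ∀ p : ENNReal, MemLp B p := fun p => hBc.memLp_of_hasCompactSupport hBs
  refine ⟨B, ⟨⟨3, by norm_num, hBp 3⟩, 2, by norm_num, decaysAE_of_hasCompactSupport hBs 2⟩,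
    decaysAE_of_hasCompactSupport hBs μ, fun D hD => ⟨0, 1, ?_⟩⟩
  have hconv := griesingerConverges_of_memLp crossCLM2 hh.continuous hc (p := 3) (by norm_num)
    (by norm_num) (hBp 3)
  refine not_decaysAE_weakPartial (N := r + 2) hh hc hh1 (hD 0 1) hρi (fun x hx => ?_) hμ
  refine griesinger_apply_on_tube crossCLM2 hconv hr0 hr hρ hρs (fun y hy v s => ?_) hx
  simp only [crossCLM2_apply, cross2, hB, hψd y hy]
  simp

/-- The field `curl (0, 0, -ψ)` in three-space, divergence-free by the symmetry of second
derivatives. -/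
lemma exists_field3 {h : REuc 3 → ℝ} (hm : IsMollifier h) {μ : ℝ} (hμ : 2 < μ) :
    ∃ B : REuc 3 → REuc 3, MediumDecay3 B ∧ DecaysAE B μ ∧
      ∀ D : Fin 3 → Fin 3 → REuc 3 → ℝ, IsWeakJacobian (griesinger cross3 h B) D →
        ∃ i k, ¬ DecaysAE (D i k) μ := by
  obtain ⟨hh, hc, hh1⟩ := hm
  obtain ⟨r, hr0, hr⟩ := exists_radius_of_hasCompactSupport hc
  obtain ⟨ρ, ψ, hρ, hρs, hρi, hψ, hψc, hψd⟩ := exists_potential (0 : Fin 3) hr0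
  set e : Fin 3 → REuc 3 := fun i => EuclideanSpace.single i 1 with he
  set B : REuc 3 → REuc 3 := fun y =>
    fderiv ℝ ψ y (e 0) • e 1 - fderiv ℝ ψ y (e 1) • e 0 with hB
  have hd : ∀ i, Continuous fun y => fderiv ℝ ψ y (e i) := fun i =>
    (contDiff_fderiv_apply hψ _).continuous
  have hdc : ∀ i, HasCompactSupport fun y => fderiv ℝ ψ y (e i) := fun i =>
    hasCompactSupport_fderiv_apply hψc _
  have hBc : Continuous B := ((hd 0).smul continuous_const).sub ((hd 1).smul continuous_const)
  have hBs : HasCompactSupport B := (hdc 0).smul_right.sub (hdc 1).smul_right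
  have hBp : ∀ p : ENNReal, MemLp B p := fun p => hBc.memLp_of_hasCompactSupport hBs
  have hdiv : DivFree B := by
    intro φ
    have hφ : ContDiff ℝ ∞ φ := φ.smooth ⊤
    have hi : ∀ i j, Integrable fun x => fderiv ℝ ψ x (e i) * fderiv ℝ φ x (e j) := fun i j =>
      ((hd i).mul (contDiff_fderiv_apply hφ _).continuous).integrable_of_hasCompactSupport
        (hdc i).mul_right
    simp only [hB, map_sub, map_smul, smul_eq_mul]
    rw [integral_sub (hi 0 1) (hi 1 0), integral_fderiv_mul_fderiv_comm hψ hψc hφ, sub_self]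
  refine ⟨B, ⟨⟨4, by norm_num, hBp 4⟩, ⟨2, by norm_num, decaysAE_of_hasCompactSupport hBs 2⟩, hdiv⟩,
    decaysAE_of_hasCompactSupport hBs μ, fun D hD => ⟨0, 2, ?_⟩⟩
  have hconv := griesingerConverges_of_memLp crossCLM3 hh.continuous hc (p := 4) (by norm_num)
    (by norm_num) (hBp 4)
  refine not_decaysAE_weakPartial (N := r + 2) hh hc hh1 (hD 0 2) hρi (fun x hx => ?_) hμ
  refine griesinger_apply_on_tube crossCLM3 hconv hr0 hr hρ hρs (fun y hy v s => ?_) hx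
  simp only [crossCLM3_apply, cross3, cross_apply, hB, hψd y hy, he]
  simp

/-! ### The Griesinger gauge -/

/-- The positive statements in both dimensions at once, for an arbitrary orthogonal product. -/
lemma griesinger_properties {n : ℕ} (hn2 : 2 ≤ n) (hn : n ≤ 3) {F : Type*}
    [NormedAddCommGroup F] [NormedSpace ℝ F] (Λ : REuc n →L[ℝ] F →L[ℝ] REuc n)
    (hΛ : ∀ v w, inner ℝ (Λ v w) v = 0) {h : REuc n → ℝ} (hm : IsMollifier h)
    {B : REuc n → F} {p : ENNReal} (hp : (n : ENNReal) < p) (hBp : MemLp B p) {μ : ℝ}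
    (hμ : 3 / 2 < μ) (hB : DecaysAE B μ) :
    MemLp B 2 ∧
    GriesingerConverges (fun v w => Λ v w) h B ∧
    Continuous (griesinger (fun v w => Λ v w) h B) ∧
    GriesingerDecay μ (griesinger (fun v w => Λ v w) h B) ∧
    ShortRange (longitudinal (griesinger (fun v w => Λ v w) h B)) ∧
    MediumRange (griesinger (fun v w => Λ v w) h B) ∧
    ∃ D : Fin n → Fin n → REuc n → ℝ,
      IsWeakJacobian (griesinger (fun v w => Λ v w) h B) D ∧ ∀ i k, MemL2Loc (D i k) := by
  have hn2' : (2 : ENNReal) ≤ n := by exact_mod_cast hn2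
  have hp2 : 2 ≤ p := hn2'.trans hp.le
  have hp1 : 1 ≤ p := le_trans (by norm_num) hp2
  have hn3 : (n : ℝ) ≤ 3 := by exact_mod_cast hn
  have hB2 : MemLp B 2 := memLp_two_of_decaysAE hp2 hBp (by linarith) hB
  have hh := hm.1.continuous
  have hconv := griesingerConverges_of_memLp Λ hh hm.2.1 hp1 hp hBp
  have hcont := continuous_griesinger Λ hh hm.2.1 hp1 hp hBp
  obtain ⟨h1, h2, h3⟩ := griesinger_mediumRange_of_memLp Λ hΛ hh hm.2.1 hp1 hp hBp hμ hB
  exact ⟨hB2, hconv, hcont, h1, h2, h3,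
    exists_isWeakJacobian_griesinger hn Λ hm.1 hm.2.1 hconv hcont hB2⟩

theorem mainTheorem5 :
    -- dimension two
    (∀ h : REuc 2 → ℝ, IsMollifier h →
      (∀ (B : REuc 2 → ℝ) (μ : ℝ), MediumDecay2 B → 3 / 2 < μ → DecaysAE B μ →
        GriesingerConverges cross2 h B ∧
        Continuous (griesinger cross2 h B) ∧
        GriesingerDecay μ (griesinger cross2 h B) ∧
        ShortRange (longitudinal (griesinger cross2 h B)) ∧
        MediumRange (griesinger cross2 h B) ∧
        ∃ D : Fin 2 → Fin 2 → REuc 2 → ℝ,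
          IsWeakJacobian (griesinger cross2 h B) D ∧
          (∀ i k, MemL2Loc (D i k)) ∧
          ∀ᵐ x, curl2 D x = B x) ∧
      (∀ μ : ℝ, 2 < μ → ∃ B : REuc 2 → ℝ, MediumDecay2 B ∧ DecaysAE B μ ∧
        ∀ D : Fin 2 → Fin 2 → REuc 2 → ℝ, IsWeakJacobian (griesinger cross2 h B) D →
          ∃ i k, ¬ DecaysAE (D i k) μ)) ∧
    -- dimension three
    (∀ h : REuc 3 → ℝ, IsMollifier h →
      (∀ (B : REuc 3 → REuc 3) (μ : ℝ), MediumDecay3 B → 3 / 2 < μ → DecaysAE B μ →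
        GriesingerConverges cross3 h B ∧
        Continuous (griesinger cross3 h B) ∧
        GriesingerDecay μ (griesinger cross3 h B) ∧
        ShortRange (longitudinal (griesinger cross3 h B)) ∧
        MediumRange (griesinger cross3 h B) ∧
        ∃ D : Fin 3 → Fin 3 → REuc 3 → ℝ,
          IsWeakJacobian (griesinger cross3 h B) D ∧
          (∀ i k, MemL2Loc (D i k)) ∧
          ∀ᵐ x, curl3 D x = B x) ∧
      (∀ μ : ℝ, 2 < μ → ∃ B : REuc 3 → REuc 3, MediumDecay3 B ∧ DecaysAE B μ ∧
        ∀ D : Fin 3 → Fin 3 → REuc 3 → ℝ, IsWeakJacobian (griesinger cross3 h B) D →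
          ∃ i k, ¬ DecaysAE (D i k) μ)) := by

  refine ⟨fun h hm => ⟨fun B μ hBm hμ hB => ?_, fun μ hμ => exists_field2 hm hμ⟩,
    fun h hm => ⟨fun B μ hBm hμ hB => ?_, fun μ hμ => exists_field3 hm hμ⟩⟩
  · obtain ⟨⟨p, hp, hBp⟩, -⟩ := hBm
    obtain ⟨hB2, h1, h2, h3, h4, h5, D, hD, hD2⟩ := griesinger_properties le_rfl (by norm_num)
      crossCLM2 inner_crossCLM2 hm (by exact_mod_cast hp) hBp hμ hB
    exact ⟨h1, h2, h3, h4, h5, D, hD, hD2, curl2_griesinger hm.1.continuous hm.2.1 hm.2.2 h1 hB2 hD⟩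
  · obtain ⟨⟨p, hp, hBp⟩, -, hdiv⟩ := hBm
    obtain ⟨hB2, h1, h2, h3, h4, h5, D, hD, hD2⟩ := griesinger_properties (by norm_num) le_rfl
      crossCLM3 inner_crossCLM3 hm (by exact_mod_cast hp) hBp hμ hB
    exact ⟨h1, h2, h3, h4, h5, D, hD, hD2,
      curl3_griesinger hm.1.continuous hm.2.1 hm.2.2 h1 hB2 hdiv hD⟩
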